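/- For $N\in\mathbb N$ call $\delta>0$ a rigidity threshold for $N$ if for every $\ell>0$, $Q=(-\ell,\ell)^2$, $M\in\mathbb R^{N\times 2}$ and $d\in\mathbb R^N$ with $\frac1{\ell^2}\|\mathrm{dist}(Mx+d,\mathbb Z^N)\|_{L^1(Q)}\le\delta$ there is $z\in\mathbb Z^N$ with $\|Mx+d-z\|_{L^1(Q;\mathbb R^N)}=\|\mathrm{dist}(Mx+d,\mathbb Z^N)\|_{L^1(Q)}$. **Theorem.** There is $\delta>0$ that is a rigidity threshold for every $N$. Moreover, for every $N$ there is a constant $c>0$, depending only on $N$, such that the following holds. Let $\delta>0$ be a rigidity threshold for $N$, let $\ell>0$, $Q=(-\ell,\ell)^2$, $q=(-\ell/4,\ell/4)^2$, let $A\in\mathbb R^{N\times2}$ with $|A|=1$, let $u\in W^{1,1}(Q;\mathbb R^N)$, and define $$\eta_1=\frac1{\ell^2}\|\mathrm{dist}(u,\mathbb Z^N)\|_{L^1(Q)},\qquad \eta_2=\frac1\ell\|Du\|_{L^1(Q;\mathbb R^{N\times2})},\qquad \eta_3=\frac1\ell\|Du-A(A\cdot Du)_+\|_{L^1(Q;\mathbb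 R^{N\times2})},$$ where $A\cdot B=\mathrm{Tr}\,A^TB$, $|A|^2=A\cdot A$ and $s_+=\max\{s,0\}$. Assume $\eta_1\le\delta/2$. Then there are $a,b\in\mathbb R^N$, $\nu\in S^1$ and a nondecreasing $\lambda\in W^{1,1}_{\mathrm{loc}}(\mathbb R)$ with $\lambda'\in L^1(\mathbb R)$ such that $\tilde u(x)=a\,\lambda(x\cdot\nu)+b$ obeys $$\frac1\ell\|u-\tilde u\|_{L^2(q;\mathbb R^N)}\le c\,\eta_2^{2/3}\eta_3^{1/3}+c\,\eta_2\,\eta_3^{1/2}+c\,\eta_1$$ and $$\|a\lambda\|_{L^\infty(\mathbb R;\mathbb R^N)}\le c\,\eta_2 .$$ -/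

import Mathlib

open MeasureTheory Set
open scoped ContDiff Matrix

noncomputable section

/-- The Euclidean scalar product of matrices, `A · B = Tr (Aᵀ B)`. -/
def matInner {N : ℕ} (A B : Matrix (Fin N) (Fin 2) ℝ) : ℝ := (Aᵀ * B).trace

/-- The Euclidean (Frobenius) norm of a matrix, `|A|² = A · A`. -/
def matNorm {N : ℕ} (A : Matrix (Fin N) (Fin 2) ℝ) : ℝ := Real.sqrt (matInner A A)

/-- The open square `(-ℓ, ℓ)²`. -/
def openSquare (ℓ : ℝ) : Set (EuclideanSpace ℝ (Fin 2)) := {x | ∀ i, x i ∈ Ioo (-ℓ) ℓ}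

/-- The lattice `ℤ^N` in `ℝ^N`. -/
def intLattice (N : ℕ) : Set (EuclideanSpace ℝ (Fin N)) := {z | ∀ i, ∃ k : ℤ, z i = (k : ℝ)}

/-- `g` is the weak derivative of `f` in direction `v` on `Ω`:
`∫_Ω f ∂_v φ = - ∫_Ω g φ` for all test functions `φ ∈ C_c^∞(Ω)`. -/
def HasWeakDirDeriv {E : Type*} [NormedAddCommGroup E] [NormedSpace ℝ E] [MeasureSpace E]
    (Ω : Set E) (f g : E → ℝ) (v : E) : Prop :=
  ∀ φ : E → ℝ, ContDiff ℝ ∞ φ → HasCompactSupport φ → tsupport φ ⊆ Ω →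
    ∫ x in Ω, f x * fderiv ℝ φ x v = - ∫ x in Ω, g x * φ x

/-- `u ∈ W^{1,1}(Ω; ℝ^N)` (for `Ω ⊆ ℝ²`) with weak gradient `Du`, whose entry `(Du)_{ij}` is the
weak partial derivative `∂_j u_i`. -/
structure IsW11WithGradient {N : ℕ} (Ω : Set (EuclideanSpace ℝ (Fin 2)))
    (u : EuclideanSpace ℝ (Fin 2) → EuclideanSpace ℝ (Fin N))
    (Du : EuclideanSpace ℝ (Fin 2) → Matrix (Fin N) (Fin 2) ℝ) : Prop where
  integrable_fun : IntegrableOn u Ω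
  integrable_grad : ∀ i j, IntegrableOn (fun x => Du x i j) Ω
  weak_deriv : ∀ i j, HasWeakDirDeriv Ω (fun x => u x i) (fun x => Du x i j)
    (EuclideanSpace.single j (1 : ℝ))

/-- `f ∈ W^{1,1}_loc(ℝ)` with weak derivative `f' ∈ L¹(ℝ)`. -/
def IsW11LocWithIntegrableDeriv (f : ℝ → ℝ) : Prop :=
  LocallyIntegrable f ∧ ∃ f' : ℝ → ℝ, Integrable f' ∧ HasWeakDirDeriv univ f f' 1

/-- `η₁ = ℓ⁻² ‖dist(u, ℤ^N)‖_{L¹(Q)}`, `Q = (-ℓ, ℓ)²`. -/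
def etaOne {N : ℕ} (ℓ : ℝ) (u : EuclideanSpace ℝ (Fin 2) → EuclideanSpace ℝ (Fin N)) : ℝ :=
  1 / ℓ ^ 2 * ∫ x in openSquare ℓ, Metric.infDist (u x) (intLattice N)

/-- `η₂ = ℓ⁻¹ ‖Du‖_{L¹(Q)}`, `Q = (-ℓ, ℓ)²`. -/
def etaTwo {N : ℕ} (ℓ : ℝ) (Du : EuclideanSpace ℝ (Fin 2) → Matrix (Fin N) (Fin 2) ℝ) : ℝ :=
  1 / ℓ * ∫ x in openSquare ℓ, matNorm (Du x)

/-- `η₃ = ℓ⁻¹ ‖Du - A (A · Du)₊‖_{L¹(Q)}`, `Q = (-ℓ, ℓ)²`. -/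
def etaThree {N : ℕ} (ℓ : ℝ) (A : Matrix (Fin N) (Fin 2) ℝ)
    (Du : EuclideanSpace ℝ (Fin 2) → Matrix (Fin N) (Fin 2) ℝ) : ℝ :=
  1 / ℓ * ∫ x in openSquare ℓ, matNorm (Du x - max (matInner A (Du x)) 0 • A)

/-- The affine map `x ↦ A x + b` from `ℝ²` to `ℝ^N`. -/
def affineFun {N : ℕ} (A : Matrix (Fin N) (Fin 2) ℝ) (b : EuclideanSpace ℝ (Fin N))
    (x : EuclideanSpace ℝ (Fin 2)) : EuclideanSpace ℝ (Fin N) :=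
  WithLp.toLp 2 (A *ᵥ x.ofLp) + b

/-- `δ` is a threshold for the rigidity of affine maps into `ℝ^N`: on every square
`Q = (-ℓ, ℓ)²`, an affine map whose normalized `L¹` distance from `ℤ^N` is at most `δ` has a single
lattice point that realizes this distance. -/
def IsAffineRigidityThreshold (N : ℕ) (δ : ℝ) : Prop :=
  ∀ (ℓ : ℝ), 0 < ℓ → ∀ (A : Matrix (Fin N) (Fin 2) ℝ) (b : EuclideanSpace ℝ (Fin N)),
    etaOne ℓ (affineFun A b) ≤ δ →
    ∃ z ∈ intLattice N,
      ∫ x in openSquare ℓ, ‖affineFun A b x - z‖ =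
        ∫ x in openSquare ℓ, Metric.infDist (affineFun A b x) (intLattice N)

end

/-!
The idea is to choose between two simple models for `u`. Put `μ = (A · Du)₊`, so that
`Du = μ A + E` with `‖E‖_{L¹} = ℓ η₃`.

All estimates are made on `(-1, 1)²` in linear coordinates. There a `W^{1,1}` function `f` is
represented on almost every line by an average plus the integral of one weak partial derivative
against a bounded kernel (`HasWeakDerivSnd.ae_eq`). Hence `|f - F|`, where `F` is the average of `f`
over the second variable, is bounded both by an integrable function of the first variable and by
one of the second; the product of the two bounds is integrable, with
`‖f - F‖²_{L²} ≲ ‖∂₂f‖_{L¹} (‖∂₁f‖_{L¹} + ‖∂₂f‖_{L¹})`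
(`HasWeakPartials.eLpNorm_sub_avgSnd_le`). This is the only place where `L²` norms are gained from
`L¹` norms of derivatives.

Choose coordinates in which `A` is rank one up to an error `σ ∈ [0, 1]`, the length of the part of
the smaller column of `A` orthogonal to the larger one (`IsAdaptedFrame`).

* One-dimensional model (`exists_oneDimensional_approx`). In the direction of the larger column,
  `u` has derivative nearly `μ ≥ 0` along one coordinate and nearly `0` along the other, so it is
  close to a monotone function of the first coordinate; the other components have small derivative.
  The error is of order `σ η₂ + η₃ + √(η₂ η₃)`.
* Affine model (`exists_affine_approx`). If `σ > 0`, then `A` has a left inverse of norm of order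
  `1 / σ`, and the derivative of its composition with `u` is nearly `μ` times the identity. As in
  Korn's inequality, equality of mixed derivatives forces `μ` to be nearly constant in an averaged
  sense, so `u` is close to an affine map, with error of order `η₃ / σ` in `L¹` and
  `η₃ / σ + √(η₂ η₃ / σ)` in `L²`. If `η₃ / σ` is small, the affine map is then close to the lattice
  on average, and by rigidity to a single lattice point, at the additional cost `η₁`
  (`exists_lattice_approx`); the approximation is constant.

If `σ³ η₂ ≤ η₃`, the one-dimensional model gives the error `η₂^(2/3) η₃^(1/3)`. Otherwise the affine
model does, plus `η₁`, provided that `η₃ / σ` is small. If it is not, then `σ ≤ √σ ≲ √η₃`, and the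
one-dimensional model gives the error `η₂ √η₃ + η₂^(2/3) η₃^(1/3)`.

The number `1 / 5` is a rigidity threshold for all dimensions
(`isAffineRigidityThreshold_one_div_five`): if a component of an affine map takes a half-integer
value at a point of the square, then comparing the distances to the lattice at `x` and at the
midpoint of `x` and this point shows that the average distance is at least `2 / 9`; otherwise each component
stays within `1 / 2` of a fixed integer.
-/

/-! ### Test functions and the averaging kernel on an interval -/

/-- Lebesgue measure on the interval `(-1, 1)`. -/
noncomputable abbrev intervalMeasure : Measure ℝ := volume.restrict (Ioo (-1 : ℝ) 1)

/-- Lebesgue measure on the square `(-1, 1)²`, as a product. -/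
noncomputable abbrev squareMeasure : Measure (ℝ × ℝ) := intervalMeasure.prod intervalMeasure

/-- Test functions on the interval `(-1, 1)`. -/
structure IsIntervalTest (φ : ℝ → ℝ) : Prop where
  contDiff : ContDiff ℝ ∞ φ
  hasCompactSupport : HasCompactSupport φ
  tsupport_subset : tsupport φ ⊆ Ioo (-1) 1

lemma intervalMeasure_univ : intervalMeasure univ = 2 := by
  simp only [Measure.restrict_apply_univ, Real.volume_Ioo]; norm_num

lemma IsCompact.subset_Icc_of_subset_Ioo {s : Set ℝ} (hs : IsCompact s) (h : s ⊆ Ioo (-1) 1) :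
    ∃ r < 1, s ⊆ Icc (-r) r := by
  rcases s.eq_empty_or_nonempty with rfl | hne
  · exact ⟨0, by norm_num, by simp⟩
  obtain ⟨x, hx, hmax⟩ := hs.exists_isMaxOn hne (continuous_abs.continuousOn)
  refine ⟨|x|, abs_lt.2 ⟨(h hx).1, (h hx).2⟩, fun y hy => ?_⟩
  have := hmax hy
  exact abs_le.1 this

namespace IsIntervalTest

variable {φ ψ : ℝ → ℝ}

lemma continuous (h : IsIntervalTest φ) : Continuous φ := h.contDiff.continuous

lemma eq_zero (h : IsIntervalTest φ) {x : ℝ} (hx : x ∉ Ioo (-1 : ℝ) 1) : φ x = 0 :=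
  image_eq_zero_of_notMem_tsupport fun h' => hx (h.tsupport_subset h')

lemma exists_bound (h : IsIntervalTest φ) : ∃ C, ∀ x, ‖φ x‖ ≤ C :=
  h.hasCompactSupport.exists_bound_of_continuous h.continuous

lemma integrable (h : IsIntervalTest φ) : Integrable φ :=
  h.continuous.integrable_of_hasCompactSupport h.hasCompactSupport

lemma deriv (h : IsIntervalTest φ) : IsIntervalTest (deriv φ) where
  contDiff := (contDiff_infty_iff_deriv.1 h.contDiff).2
  hasCompactSupport := h.hasCompactSupport.deriv
  tsupport_subset := tsupport_deriv_subset.trans h.tsupport_subset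

lemma setIntegral_eq (h : IsIntervalTest φ) : ∫ x, φ x ∂intervalMeasure = ∫ x, φ x :=
  setIntegral_eq_integral_of_forall_compl_eq_zero fun _ hx => h.eq_zero hx

lemma integrable_mul (h : IsIntervalTest φ) {μ : Measure ℝ} {f : ℝ → ℝ} (hf : Integrable f μ) :
    Integrable (fun x => φ x * f x) μ :=
  let ⟨_, hC⟩ := h.exists_bound
  hf.bdd_mul h.continuous.aestronglyMeasurable (Filter.Eventually.of_forall hC)

end IsIntervalTest

/-- A fixed smooth probability density, compactly supported in `(-1, 1)`. -/
noncomputable def weight : ℝ → ℝ :=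
  (⟨1 / 4, 1 / 2, by norm_num, by norm_num⟩ : ContDiffBump (0 : ℝ)).normed volume

lemma weight_isIntervalTest : IsIntervalTest weight where
  contDiff := ContDiffBump.contDiff_normed _
  hasCompactSupport := ContDiffBump.hasCompactSupport_normed _
  tsupport_subset := by
    rw [weight, ContDiffBump.tsupport_normed_eq, Real.closedBall_eq_Icc]
    intro x hx
    simp only [mem_Icc, mem_Ioo] at hx ⊢
    constructor <;> linarith [hx.1, hx.2]

lemma weight_nonneg (x : ℝ) : 0 ≤ weight x := ContDiffBump.nonneg_normed _ _

lemma integral_weight : ∫ x, weight x = 1 := ContDiffBump.integral_normed _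

lemma integral_weight_interval : ∫ x, weight x ∂intervalMeasure = 1 := by
  rw [weight_isIntervalTest.setIntegral_eq, integral_weight]

lemma exists_weight_bound : ∃ B : ℝ, 1 ≤ B ∧ ∀ x, |weight x| ≤ B ∧ |deriv weight x| ≤ B := by
  obtain ⟨B, hB⟩ := weight_isIntervalTest.exists_bound
  obtain ⟨B', hB'⟩ := weight_isIntervalTest.deriv.exists_bound
  refine ⟨max 1 (max B B'), le_max_left _ _, fun x => ⟨(hB x).trans ?_, (hB' x).trans ?_⟩⟩
  · exact (le_max_left _ _).trans (le_max_right _ _)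
  · exact (le_max_right _ _).trans (le_max_right _ _)

/-- A common bound, at least `1`, for `|weight|` and `|weight'|`. -/
noncomputable def weightBound : ℝ := exists_weight_bound.choose

lemma one_le_weightBound : 1 ≤ weightBound := exists_weight_bound.choose_spec.1

lemma weightBound_pos : 0 < weightBound := one_pos.trans_le one_le_weightBound

lemma abs_weight_le (x : ℝ) : |weight x| ≤ weightBound := (exists_weight_bound.choose_spec.2 x).1

lemma abs_deriv_weight_le (x : ℝ) : |deriv weight x| ≤ weightBound :=
  (exists_weight_bound.choose_spec.2 x).2

/-- The tail `∫_s^1 φ` of a function on `(-1, 1)`. -/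
noncomputable def tail (φ : ℝ → ℝ) (s : ℝ) : ℝ :=
  ∫ y, (if s < y then φ y else 0) ∂intervalMeasure

lemma tail_eq (φ : ℝ → ℝ) (s : ℝ) : tail φ s = ∫ y in Ioi s, φ y ∂intervalMeasure := by
  rw [tail, ← integral_indicator measurableSet_Ioi]
  rfl

lemma IsIntervalTest.tail_eq_Ioi {φ : ℝ → ℝ} (h : IsIntervalTest φ) (s : ℝ) :
    tail φ s = ∫ y in Ioi s, φ y := by
  rw [tail_eq, Measure.restrict_restrict measurableSet_Ioi]
  refine (setIntegral_eq_of_subset_of_forall_sdiff_eq_zero measurableSet_Ioi inter_subset_left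
    fun x hx => ?_).symm
  exact h.eq_zero fun h' => hx.2 ⟨hx.1, h'⟩

lemma IsIntervalTest.hasDerivAt_tail {φ : ℝ → ℝ} (h : IsIntervalTest φ) (s : ℝ) :
    HasDerivAt (tail φ) (-φ s) s := by
  have key : tail φ = fun s => (∫ y, φ y ∂volume.restrict (Ioi 0)) - ∫ y in (0 : ℝ)..s, φ y := by
    ext s
    rw [h.tail_eq_Ioi, ← intervalIntegral.integral_interval_add_Ioi (a := 0) (b := s)
      h.integrable.integrableOn h.integrable.integrableOn]
    ring
  rw [key]
  exact (h.continuous.integral_hasStrictDerivAt 0 s).hasDerivAt.const_sub _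

lemma tail_weight_nonneg (s : ℝ) : 0 ≤ tail weight s := by
  rw [tail_eq]
  exact integral_nonneg weight_nonneg

lemma tail_weight_le_one (s : ℝ) : tail weight s ≤ 1 := by
  rw [tail_eq, ← integral_weight_interval]
  exact setIntegral_le_integral weight_isIntervalTest.integrable.restrict
    (Filter.Eventually.of_forall weight_nonneg)

lemma continuous_tail_weight : Continuous (tail weight) :=
  continuous_iff_continuousAt.2 fun s =>
    (weight_isIntervalTest.hasDerivAt_tail s).continuousAt

/-- The kernel that recovers a function on `(-1, 1)`, up to its weighted average, from its
derivative. -/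
noncomputable def avgKernel (y s : ℝ) : ℝ := (if s < y then 1 else 0) - tail weight s

lemma abs_avgKernel_le (y s : ℝ) : |avgKernel y s| ≤ 1 := by
  have h0 := tail_weight_nonneg s
  have h1 := tail_weight_le_one s
  rw [avgKernel, abs_le]
  split_ifs <;> constructor <;> linarith

lemma measurable_avgKernel : Measurable (Function.uncurry avgKernel) := by
  unfold avgKernel Function.uncurry
  refine Measurable.sub ?_ (continuous_tail_weight.measurable.comp measurable_snd)
  exact Measurable.ite (measurableSet_lt measurable_snd measurable_fst) measurable_const
    measurable_const

lemma integrable_avgKernel_mul {g : ℝ → ℝ} (hg : Integrable g intervalMeasure) (y : ℝ) :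
    Integrable (fun s => avgKernel y s * g s) intervalMeasure :=
  hg.bdd_mul (measurable_avgKernel.comp measurable_prodMk_left).aestronglyMeasurable
    (Filter.Eventually.of_forall fun s => abs_avgKernel_le y s)

lemma abs_integral_avgKernel_mul_le {g : ℝ → ℝ} (hg : Integrable g intervalMeasure) (y : ℝ) :
    |∫ s, avgKernel y s * g s ∂intervalMeasure| ≤ ∫ s, |g s| ∂intervalMeasure := by
  refine (abs_integral_le_integral_abs).trans (integral_mono (integrable_avgKernel_mul hg y).abs
    hg.abs fun s => ?_)
  rw [abs_mul]
  exact mul_le_of_le_one_left (abs_nonneg _) (abs_avgKernel_le y s)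

/-- `χ - (∫ χ) weight` has a primitive that is a test function; its values are the integrals of
`-χ` against `avgKernel`. -/
lemma IsIntervalTest.primitive {χ : ℝ → ℝ} (h : IsIntervalTest χ) :
    ∃ ψ, IsIntervalTest ψ ∧
      (∀ s, _root_.deriv ψ s = χ s - (∫ y, χ y ∂intervalMeasure) * weight s) ∧
      ∀ s, ψ s = -∫ y, χ y * avgKernel y s ∂intervalMeasure := by
  set c := ∫ y, χ y ∂intervalMeasure with hc
  have hd : ∀ s, HasDerivAt (fun s => c * tail weight s - tail χ s) (χ s - c * weight s) s := by
    intro s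
    have := ((weight_isIntervalTest.hasDerivAt_tail s).const_mul c).sub (h.hasDerivAt_tail s)
    exact this.congr_deriv (by ring)
  have hd' : _root_.deriv (fun s => c * tail weight s - tail χ s) = fun s => χ s - c * weight s :=
    funext fun s => (hd s).deriv
  obtain ⟨r, hr, hsub⟩ := IsCompact.subset_Icc_of_subset_Ioo
    (h.hasCompactSupport.isCompact.union weight_isIntervalTest.hasCompactSupport.isCompact)
    (union_subset h.tsupport_subset weight_isIntervalTest.tsupport_subset)
  have hz : ∀ {φ : ℝ → ℝ}, IsIntervalTest φ → tsupport φ ⊆ Icc (-r) r → ∀ s, s ∉ Icc (-r) r →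
      (s < 0 → tail φ s = ∫ y, φ y ∂intervalMeasure) ∧ (0 ≤ s → tail φ s = 0) := by
    intro φ hφ hs s hsr
    have hφ0 : ∀ y, y ∉ Icc (-r) r → φ y = 0 := fun y hy =>
      image_eq_zero_of_notMem_tsupport fun h' => hy (hs h')
    refine ⟨fun h0 => ?_, fun h0 => ?_⟩
    · refine integral_congr_ae (Filter.Eventually.of_forall fun y => ?_)
      by_cases hy : s < y
      · simp [hy]
      · simp only [hy, if_false]
        refine (hφ0 y fun hy' => hsr ⟨?_, ?_⟩).symm
        · linarith [hy'.1]
        · linarith [hy'.1, hy'.2]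
    · rw [tail, integral_eq_zero_of_ae]
      refine Filter.Eventually.of_forall fun y => ?_
      by_cases hy : s < y
      · simp only [hy, if_true, Pi.zero_apply]
        refine hφ0 y fun hy' => hsr ⟨?_, ?_⟩
        · linarith [hy'.1, hy'.2]
        · linarith [hy'.1, hy'.2]
      · simp [hy]
  have hsupp : ∀ s, s ∉ Icc (-r) r → c * tail weight s - tail χ s = 0 := by
    intro s hs
    have h1 := hz h (subset_union_left.trans hsub) s hs
    have h2 := hz weight_isIntervalTest (subset_union_right.trans hsub) s hs
    rcases lt_or_ge s 0 with h0 | h0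
    · rw [h1.1 h0, h2.1 h0, integral_weight_interval]; ring
    · rw [h1.2 h0, h2.2 h0]; ring
  refine ⟨fun s => c * tail weight s - tail χ s, ⟨?_, ?_, ?_⟩, fun s => (hd s).deriv, fun s => ?_⟩
  · rw [contDiff_infty_iff_deriv, hd']
    exact ⟨fun s => (hd s).differentiableAt,
      h.contDiff.sub (contDiff_const.mul weight_isIntervalTest.contDiff)⟩
  · exact HasCompactSupport.intro isCompact_Icc hsupp
  · refine (closure_minimal (fun s hs => ?_) isClosed_Icc).trans
      (Icc_subset_Ioo (by linarith) hr : Icc (-r) r ⊆ Ioo (-1) 1)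
    by_contra hs'
    exact hs (hsupp s hs')
  · have h1 : ∀ y, χ y * avgKernel y s = (if s < y then χ y else 0) - tail weight s * χ y := by
      intro y
      rw [avgKernel]
      split_ifs <;> ring
    have hi : Integrable (fun y => if s < y then χ y else 0) intervalMeasure := by
      have := (h.integrable.restrict (s := Ioo (-1) 1)).indicator (measurableSet_Ioi (a := s))
      exact this
    simp only [h1]
    rw [integral_sub hi (h.integrable.restrict.const_mul _), integral_const_mul, ← hc]
    simp only [tail]
    ring

/-! ### Functions with integrable weak derivatives on an interval and on a square -/

/-- On `(-1, 1)`, the integrable function `f` has the integrable weak derivative `g`. -/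
structure HasWeakDerivOnInterval (f g : ℝ → ℝ) : Prop where
  integrable_fun : Integrable f intervalMeasure
  integrable_deriv : Integrable g intervalMeasure
  weak_deriv : ∀ φ, IsIntervalTest φ →
    ∫ y, deriv φ y * f y ∂intervalMeasure = -∫ y, φ y * g y ∂intervalMeasure

/-- On `(-1, 1)²`, the integrable function `f` has the integrable weak derivative `g` in the second
variable. Only products of functions of one variable serve as test functions. -/
structure HasWeakDerivSnd (f g : ℝ × ℝ → ℝ) : Prop where
  integrable_fun : Integrable f squareMeasure
  integrable_deriv : Integrable g squareMeasure
  weak_deriv : ∀ η χ, IsIntervalTest η → IsIntervalTest χ →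
    ∫ p, η p.1 * (deriv χ p.2 * f p) ∂squareMeasure =
      -∫ p, η p.1 * (χ p.2 * g p) ∂squareMeasure

/-- On `(-1, 1)²`, the integrable function `f` has the integrable weak partial derivatives `g₁` and
`g₂`. -/
structure HasWeakPartials (f g₁ g₂ : ℝ × ℝ → ℝ) : Prop where
  fst : HasWeakDerivSnd (f ∘ Prod.swap) (g₁ ∘ Prod.swap)
  snd : HasWeakDerivSnd f g₂

lemma HasWeakPartials.swap {f g₁ g₂ : ℝ × ℝ → ℝ} (h : HasWeakPartials f g₁ g₂) :
    HasWeakPartials (f ∘ Prod.swap) (g₂ ∘ Prod.swap) (g₁ ∘ Prod.swap) :=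
  ⟨h.snd, h.fst⟩

lemma ae_eq_zero_of_forall_intervalTest {h : ℝ → ℝ} (hi : Integrable h intervalMeasure)
    (h0 : ∀ φ, IsIntervalTest φ → ∫ y, φ y * h y ∂intervalMeasure = 0) :
    ∀ᵐ y ∂intervalMeasure, h y = 0 := by
  rw [ae_restrict_iff' measurableSet_Ioo]
  refine isOpen_Ioo.ae_eq_zero_of_integral_contDiff_smul_eq_zero (IntegrableOn.locallyIntegrableOn hi)
    fun φ h1 h2 h3 => ?_
  have hφ : IsIntervalTest φ := ⟨h1, h2, h3⟩
  rw [← h0 φ hφ]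
  refine (setIntegral_eq_integral_of_forall_compl_eq_zero fun x hx => ?_).symm
  simp [hφ.eq_zero hx]

lemma integrable_integral_avgKernel {g : ℝ → ℝ} (hg : Integrable g intervalMeasure) :
    Integrable (fun y => ∫ s, avgKernel y s * g s ∂intervalMeasure) intervalMeasure ∧
      Integrable (fun p : ℝ × ℝ => avgKernel p.1 p.2 * g p.2) squareMeasure := by
  have : Integrable (fun p : ℝ × ℝ => avgKernel p.1 p.2 * g p.2) squareMeasure :=
    (hg.comp_snd intervalMeasure).bdd_mul measurable_avgKernel.aestronglyMeasurable
      (Filter.Eventually.of_forall fun p => abs_avgKernel_le p.1 p.2)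
  exact ⟨this.integral_prod_left, this⟩

/-- A function on `(-1, 1)` is its weighted average plus the integral of its derivative against
`avgKernel`. -/
lemma HasWeakDerivOnInterval.ae_eq {f g : ℝ → ℝ} (h : HasWeakDerivOnInterval f g) :
    ∀ᵐ y ∂intervalMeasure, f y = (∫ t, weight t * f t ∂intervalMeasure) +
      ∫ s, avgKernel y s * g s ∂intervalMeasure := by
  obtain ⟨hKi, hKp⟩ := integrable_integral_avgKernel h.integrable_deriv
  set c := ∫ t, weight t * f t ∂intervalMeasure
  have hf := h.integrable_fun
  have key := ae_eq_zero_of_forall_intervalTest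
    (h := fun y => f y - c - ∫ s, avgKernel y s * g s ∂intervalMeasure)
    ((hf.sub (integrable_const c)).sub hKi) ?_
  · filter_upwards [key] with y hy
    linarith
  intro χ hχ
  obtain ⟨ψ, hψ, hd, hv⟩ := hχ.primitive
  have hw := h.weak_deriv ψ hψ
  set C := ∫ y, χ y ∂intervalMeasure
  have e1 : ∫ y, deriv ψ y * f y ∂intervalMeasure =
      (∫ y, χ y * f y ∂intervalMeasure) - C * c := by
    have : ∀ y, deriv ψ y * f y = χ y * f y - C * (weight y * f y) := fun y => by rw [hd]; ring
    simp only [this]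
    rw [integral_sub (hχ.integrable_mul hf)
      ((weight_isIntervalTest.integrable_mul hf).const_mul C), integral_const_mul]
  have hswapI : Integrable (fun p : ℝ × ℝ => χ p.1 * (avgKernel p.1 p.2 * g p.2))
      squareMeasure := by
    obtain ⟨M, hM⟩ := hχ.exists_bound
    exact hKp.bdd_mul (hχ.continuous.comp continuous_fst).aestronglyMeasurable
      (Filter.Eventually.of_forall fun p => hM p.1)
  have e2 : ∫ y, ψ y * g y ∂intervalMeasure =
      -∫ y, χ y * ∫ s, avgKernel y s * g s ∂intervalMeasure ∂intervalMeasure := by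
    simp only [← integral_const_mul]
    rw [integral_integral_swap hswapI, ← integral_neg]
    refine integral_congr_ae (Filter.Eventually.of_forall fun s => ?_)
    simp only [hv, ← mul_assoc]
    rw [integral_mul_const]
    ring
  have e3 : ∀ y, χ y * (f y - c - ∫ s, avgKernel y s * g s ∂intervalMeasure) =
      χ y * f y - c * χ y - χ y * ∫ s, avgKernel y s * g s ∂intervalMeasure := fun y => by ring
  have hi : Integrable (fun y => χ y * f y - c * χ y) intervalMeasure :=
    (hχ.integrable_mul hf).sub (hχ.integrable.restrict.const_mul c)
  simp only [e3]
  rw [integral_sub hi (hχ.integrable_mul hKi),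
    integral_sub (hχ.integrable_mul hf) (hχ.integrable.restrict.const_mul c), integral_const_mul]
  linarith [mul_comm C c]

section Slices

variable {f g : ℝ × ℝ → ℝ}

lemma IsIntervalTest.integrable_mul_snd {χ : ℝ → ℝ} (hχ : IsIntervalTest χ) {ν : Measure (ℝ × ℝ)}
    (hf : Integrable f ν) : Integrable (fun p : ℝ × ℝ => χ p.2 * f p) ν :=
  let ⟨_, hM⟩ := hχ.exists_bound
  hf.bdd_mul (hχ.continuous.comp continuous_snd).aestronglyMeasurable
    (Filter.Eventually.of_forall fun p => hM p.2)

lemma IsIntervalTest.integrable_mul_fst {χ : ℝ → ℝ} (hχ : IsIntervalTest χ) {ν : Measure (ℝ × ℝ)}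
    (hf : Integrable f ν) : Integrable (fun p : ℝ × ℝ => χ p.1 * f p) ν :=
  let ⟨_, hM⟩ := hχ.exists_bound
  hf.bdd_mul (hχ.continuous.comp continuous_fst).aestronglyMeasurable
    (Filter.Eventually.of_forall fun p => hM p.1)

lemma HasWeakDerivSnd.slice (h : HasWeakDerivSnd f g) {χ : ℝ → ℝ} (hχ : IsIntervalTest χ) :
    ∀ᵐ x ∂intervalMeasure, ∫ y, deriv χ y * f (x, y) ∂intervalMeasure =
      -∫ y, χ y * g (x, y) ∂intervalMeasure := by
  have h1 := hχ.deriv.integrable_mul_snd h.integrable_fun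
  have h2 := hχ.integrable_mul_snd h.integrable_deriv
  have key := ae_eq_zero_of_forall_intervalTest
    (h := fun x => (∫ y, deriv χ y * f (x, y) ∂intervalMeasure) +
      ∫ y, χ y * g (x, y) ∂intervalMeasure) (h1.integral_prod_left.add h2.integral_prod_left) ?_
  · filter_upwards [key] with x hx
    linarith
  intro η hη
  have hw := h.weak_deriv η χ hη hχ
  rw [integral_prod _ (hη.integrable_mul_fst h1), integral_prod _ (hη.integrable_mul_fst h2)] at hw
  simp only [integral_const_mul] at hw
  simp only [mul_add]
  rw [integral_add (hη.integrable_mul h1.integral_prod_left)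
    (hη.integrable_mul h2.integral_prod_left)]
  linarith

lemma integrable_restrict_prod (hf : Integrable f squareMeasure) (A : Set ℝ) :
    Integrable f ((intervalMeasure.restrict A).prod intervalMeasure) := by
  have := hf.restrict (s := A ×ˢ univ)
  rwa [← Measure.prod_restrict, Measure.restrict_univ] at this

/-- Integrating out the first variable over a set preserves weak derivatives in the second. -/
lemma HasWeakDerivSnd.integral_fst (h : HasWeakDerivSnd f g) (A : Set ℝ) :
    HasWeakDerivOnInterval (fun y => ∫ x in A, f (x, y) ∂intervalMeasure)
      (fun y => ∫ x in A, g (x, y) ∂intervalMeasure) where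
  integrable_fun := (integrable_restrict_prod h.integrable_fun A).integral_prod_right
  integrable_deriv := (integrable_restrict_prod h.integrable_deriv A).integral_prod_right
  weak_deriv χ hχ := by
    have h1 := integrable_restrict_prod (hχ.deriv.integrable_mul_snd h.integrable_fun) A
    have h2 := integrable_restrict_prod (hχ.integrable_mul_snd h.integrable_deriv) A
    simp only [← integral_const_mul]
    have s1 := integral_integral_swap (f := fun x y => deriv χ y * f (x, y)) h1
    have s2 := integral_integral_swap (f := fun x y => χ y * g (x, y)) h2
    rw [← s1, ← s2, ← integral_neg]
    exact integral_congr_ae (ae_restrict_of_ae (h.slice hχ))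

/-- An integrable function on the square whose integrals over all measurable rectangles vanish is
zero. -/
lemma ae_eq_zero_of_forall_setIntegral_prod_eq_zero {H : ℝ × ℝ → ℝ} (hH : Integrable H squareMeasure)
    (h0 : ∀ A B : Set ℝ, MeasurableSet A → MeasurableSet B →
      ∫ y in B, ∫ x in A, H (x, y) ∂intervalMeasure ∂intervalMeasure = 0) :
    ∀ᵐ p ∂squareMeasure, H p = 0 := by
  have hrect : ∀ A B : Set ℝ, MeasurableSet A → MeasurableSet B →
      ∫ p in A ×ˢ B, H p ∂squareMeasure = 0 := by
    intro A B hA hB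
    have hi := hH.restrict (s := A ×ˢ B)
    rw [← Measure.prod_restrict] at hi ⊢
    rw [integral_prod_symm _ hi]
    exact h0 A B hA hB
  have hall : ∀ s : Set (ℝ × ℝ), MeasurableSet s → ∫ p in s, H p ∂squareMeasure = 0 := by
    intro s hs
    induction s, hs using MeasurableSpace.induction_on_inter generateFrom_prod.symm isPiSystem_prod
      with
    | empty => simp
    | basic t ht =>
      obtain ⟨A, hA, B, hB, rfl⟩ := ht
      exact hrect A B hA hB
    | compl t ht ih =>
      have := integral_add_compl ht hH
      have hu := hrect univ univ .univ .univ
      rw [univ_prod_univ, Measure.restrict_univ] at hu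
      linarith
    | iUnion F hd hF ih =>
      rw [integral_iUnion hF hd hH.integrableOn]
      simp [ih]
  exact hH.ae_eq_of_forall_setIntegral_eq _ _ (integrable_zero _ _ _)
    fun s hs _ => by simp [hall s hs]

lemma aestronglyMeasurable_integral_avgKernel_snd (hg : Integrable g squareMeasure) :
    AEStronglyMeasurable
      (fun p : ℝ × ℝ => ∫ s, avgKernel p.2 s * g (p.1, s) ∂intervalMeasure) squareMeasure := by
  have hq : Measure.QuasiMeasurePreserving (Prod.map Prod.fst id : (ℝ × ℝ) × ℝ → ℝ × ℝ)
      (squareMeasure.prod intervalMeasure) squareMeasure :=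
    QuasiMeasurePreserving.prodMap Measure.quasiMeasurePreserving_fst (.id _)
  have hm : AEStronglyMeasurable
      (fun q : (ℝ × ℝ) × ℝ => avgKernel q.1.2 q.2 * g (q.1.1, q.2))
      (squareMeasure.prod intervalMeasure) := by
    refine AEStronglyMeasurable.mul ?_ (hg.aestronglyMeasurable.comp_quasiMeasurePreserving hq)
    exact (measurable_avgKernel.comp
      ((measurable_snd.comp measurable_fst).prodMk measurable_snd)).aestronglyMeasurable
  exact hm.integral_prod_right'

lemma ae_abs_integral_avgKernel_snd_le (hg : Integrable g squareMeasure) :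
    ∀ᵐ x ∂intervalMeasure, ∀ y, |∫ s, avgKernel y s * g (x, s) ∂intervalMeasure| ≤
      ∫ s, |g (x, s)| ∂intervalMeasure := by
  filter_upwards [hg.prod_right_ae] with x hx y
  exact abs_integral_avgKernel_mul_le hx y

lemma ae_fst_of_ae {P : ℝ → Prop} (h : ∀ᵐ x ∂intervalMeasure, P x) :
    ∀ᵐ p ∂squareMeasure, P p.1 :=
  Measure.quasiMeasurePreserving_fst.ae h

lemma ae_snd_of_ae {P : ℝ → Prop} (h : ∀ᵐ x ∂intervalMeasure, P x) :
    ∀ᵐ p ∂squareMeasure, P p.2 :=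
  Measure.quasiMeasurePreserving_snd.ae h

/-- The weighted average of `f` over the second variable. -/
noncomputable def avgSnd (f : ℝ × ℝ → ℝ) (x : ℝ) : ℝ :=
  ∫ y, weight y * f (x, y) ∂intervalMeasure

lemma integrable_avgSnd (hf : Integrable f squareMeasure) : Integrable (avgSnd f) intervalMeasure :=
  (weight_isIntervalTest.integrable_mul_snd hf).integral_prod_left

/-- The two-dimensional form of `HasWeakDerivOnInterval.ae_eq`: almost every slice in the second
variable is represented by its derivative. -/
lemma HasWeakDerivSnd.ae_eq (h : HasWeakDerivSnd f g) :
    ∀ᵐ p ∂squareMeasure, f p = avgSnd f p.1 +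
      ∫ s, avgKernel p.2 s * g (p.1, s) ∂intervalMeasure := by
  have hf := h.integrable_fun
  have hg := h.integrable_deriv
  have hw := weight_isIntervalTest.integrable_mul_snd hf
  have hF : Integrable (fun p : ℝ × ℝ => avgSnd f p.1) squareMeasure :=
    (integrable_avgSnd hf).comp_fst intervalMeasure
  have hK : Integrable
      (fun p : ℝ × ℝ => ∫ s, avgKernel p.2 s * g (p.1, s) ∂intervalMeasure) squareMeasure := by
    refine Integrable.mono' (hg.abs.integral_prod_left.comp_fst intervalMeasure)
      (aestronglyMeasurable_integral_avgKernel_snd hg) ?_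
    filter_upwards [ae_fst_of_ae (ae_abs_integral_avgKernel_snd_le hg)] with p hp
    exact hp p.2
  have key := ae_eq_zero_of_forall_setIntegral_prod_eq_zero
    (H := fun p => f p - avgSnd f p.1 - ∫ s, avgKernel p.2 s * g (p.1, s) ∂intervalMeasure)
    ((hf.sub hF).sub hK) ?_
  · filter_upwards [key] with p hp
    linarith
  intro A B hA hB
  rw [integral_eq_zero_of_ae]
  refine ae_restrict_of_ae ?_
  have h1 := (integrable_restrict_prod hf A).prod_left_ae
  have h2 := (integrable_restrict_prod hK A).prod_left_ae
  filter_upwards [(h.integral_fst A).ae_eq, h1, h2] with y hy h1 h2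
  have hFA : Integrable (avgSnd f) (intervalMeasure.restrict A) := (integrable_avgSnd hf).restrict
  have h3 : Integrable (fun x => f (x, y) - avgSnd f x) (intervalMeasure.restrict A) := h1.sub hFA
  rw [integral_sub h3 h2, integral_sub h1 hFA, hy]
  have e1 : ∫ x in A, avgSnd f x ∂intervalMeasure =
      ∫ t, weight t * ∫ x in A, f (x, t) ∂intervalMeasure ∂intervalMeasure := by
    simp only [avgSnd, ← integral_const_mul]
    exact integral_integral_swap (integrable_restrict_prod hw A)
  have e2 : ∫ x in A, ∫ s, avgKernel y s * g (x, s) ∂intervalMeasure ∂intervalMeasure =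
      ∫ s, avgKernel y s * ∫ x in A, g (x, s) ∂intervalMeasure ∂intervalMeasure := by
    simp only [← integral_const_mul]
    have hi : Integrable (fun p : ℝ × ℝ => avgKernel y p.2 * g p)
        ((intervalMeasure.restrict A).prod intervalMeasure) :=
      (integrable_restrict_prod hg A).bdd_mul
        (measurable_avgKernel.comp (measurable_const.prodMk measurable_snd)).aestronglyMeasurable
        (Filter.Eventually.of_forall fun p => abs_avgKernel_le y p.2)
    exact integral_integral_swap (f := fun x s => avgKernel y s * g (x, s)) hi
  rw [e1, e2, Pi.zero_apply]
  ring

end Slices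

/-! ### Estimates on the square -/

/-- The `L¹` norm on the square `(-1, 1)²`. -/
noncomputable def squareL1 (g : ℝ × ℝ → ℝ) : ℝ := ∫ p, |g p| ∂squareMeasure

/-- The weighted average of `f` over the square. -/
noncomputable def weightedMean (f : ℝ × ℝ → ℝ) : ℝ := ∫ x, weight x * avgSnd f x ∂intervalMeasure

section SquareEstimates

variable {f g g₁ g₂ : ℝ × ℝ → ℝ}

lemma squareL1_nonneg (g : ℝ × ℝ → ℝ) : 0 ≤ squareL1 g := integral_nonneg fun _ => abs_nonneg _

lemma squareL1_swap (g : ℝ × ℝ → ℝ) : squareL1 (g ∘ Prod.swap) = squareL1 g :=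
  integral_prod_swap (fun p => |g p|)

lemma squareL1_add_le (hf : Integrable f squareMeasure) (hg : Integrable g squareMeasure) :
    squareL1 (fun p => f p + g p) ≤ squareL1 f + squareL1 g := by
  rw [squareL1, squareL1, squareL1, ← integral_add hf.abs hg.abs]
  exact integral_mono (hf.add hg).abs (hf.abs.add hg.abs) fun p => abs_add_le _ _

lemma squareL1_eq (hg : Integrable g squareMeasure) :
    squareL1 g = ∫ x, ∫ y, |g (x, y)| ∂intervalMeasure ∂intervalMeasure :=
  integral_prod _ hg.abs

lemma squareL1_eq_symm (hg : Integrable g squareMeasure) :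
    squareL1 g = ∫ y, ∫ x, |g (x, y)| ∂intervalMeasure ∂intervalMeasure :=
  integral_prod_symm _ hg.abs

lemma weightedMean_swap (hf : Integrable f squareMeasure) :
    weightedMean (f ∘ Prod.swap) = weightedMean f := by
  simp only [weightedMean, avgSnd, ← integral_const_mul]
  have hi : Integrable (fun p : ℝ × ℝ => weight p.1 * (weight p.2 * f p)) squareMeasure :=
    weight_isIntervalTest.integrable_mul_fst (weight_isIntervalTest.integrable_mul_snd hf)
  rw [integral_integral_swap (f := fun x y => weight x * (weight y * f (x, y))) hi]
  simp only [Function.comp, Prod.swap_prod_mk]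
  refine integral_congr_ae (.of_forall fun x => integral_congr_ae (.of_forall fun y => ?_))
  simp only
  ring

lemma avgSnd_add (hf : Integrable f squareMeasure) (hg : Integrable g squareMeasure) :
    ∀ᵐ x ∂intervalMeasure, avgSnd (fun p => f p + g p) x = avgSnd f x + avgSnd g x := by
  filter_upwards [hf.prod_right_ae, hg.prod_right_ae] with x h1 h2
  simp only [avgSnd, mul_add]
  exact integral_add (weight_isIntervalTest.integrable_mul h1)
    (weight_isIntervalTest.integrable_mul h2)

lemma integral_abs_avgSnd_le (hg : Integrable g squareMeasure) :
    ∫ x, |avgSnd g x| ∂intervalMeasure ≤ weightBound * squareL1 g := by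
  rw [squareL1_eq hg, ← integral_const_mul]
  refine integral_mono_ae (integrable_avgSnd hg).abs (hg.abs.integral_prod_left.const_mul _) ?_
  filter_upwards [hg.prod_right_ae] with x hx
  rw [avgSnd, ← integral_const_mul]
  refine abs_integral_le_integral_abs.trans (integral_mono
    (weight_isIntervalTest.integrable_mul hx).abs (hx.abs.const_mul _) fun y => ?_)
  simp only [abs_mul]
  exact mul_le_mul_of_nonneg_right (abs_weight_le y) (abs_nonneg _)

lemma HasWeakDerivSnd.ae_abs_sub_avgSnd_le (h : HasWeakDerivSnd f g) :
    ∀ᵐ p ∂squareMeasure, |f p - avgSnd f p.1| ≤ ∫ s, |g (p.1, s)| ∂intervalMeasure := by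
  filter_upwards [h.ae_eq, ae_fst_of_ae (ae_abs_integral_avgKernel_snd_le h.integrable_deriv)]
    with p h1 h2
  rw [h1, add_sub_cancel_left]
  exact h2 p.2

lemma ae_swap {P : ℝ × ℝ → Prop} (h : ∀ᵐ p ∂squareMeasure, P p) :
    ∀ᵐ p ∂squareMeasure, P p.swap :=
  Measure.measurePreserving_swap.quasiMeasurePreserving.ae h

lemma HasWeakPartials.integrable_fst (h : HasWeakPartials f g₁ g₂) :
    Integrable g₁ squareMeasure := h.fst.integrable_deriv.swap

lemma HasWeakPartials.hasWeakDeriv_avgSnd (h : HasWeakPartials f g₁ g₂) :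
    HasWeakDerivOnInterval (avgSnd f) (avgSnd g₁) where
  integrable_fun := integrable_avgSnd h.snd.integrable_fun
  integrable_deriv := integrable_avgSnd h.integrable_fst
  weak_deriv φ hφ := by
    have hw := h.fst.weak_deriv weight φ weight_isIntervalTest hφ
    have i1 := weight_isIntervalTest.integrable_mul_fst
      (hφ.deriv.integrable_mul_snd h.fst.integrable_fun)
    have i2 := weight_isIntervalTest.integrable_mul_fst
      (hφ.integrable_mul_snd h.fst.integrable_deriv)
    rw [integral_prod_symm _ i1, integral_prod_symm _ i2] at hw
    simp only [avgSnd, ← integral_const_mul]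
    simpa only [Function.comp_def, Prod.swap_prod_mk, mul_left_comm (weight _)] using hw

lemma HasWeakPartials.ae_avgSnd_eq (h : HasWeakPartials f g₁ g₂) :
    ∀ᵐ x ∂intervalMeasure, avgSnd f x = weightedMean f +
      ∫ s, avgKernel x s * avgSnd g₁ s ∂intervalMeasure :=
  h.hasWeakDeriv_avgSnd.ae_eq

lemma HasWeakPartials.ae_abs_avgSnd_sub_le (h : HasWeakPartials f g₁ g₂) :
    ∀ᵐ x ∂intervalMeasure, |avgSnd f x - weightedMean f| ≤ weightBound * squareL1 g₁ := by
  filter_upwards [h.ae_avgSnd_eq] with x hx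
  rw [hx, add_sub_cancel_left]
  exact (abs_integral_avgKernel_mul_le (integrable_avgSnd h.integrable_fst) x).trans
    (integral_abs_avgSnd_le h.integrable_fst)

lemma eLpNorm_two_le_of_sq_le {α : Type*} [MeasurableSpace α] {μ : Measure α} {v w : α → ℝ}
    (hw : Integrable w μ) (h : ∀ᵐ x ∂μ, v x ^ 2 ≤ w x) :
    eLpNorm v 2 μ ≤ ENNReal.ofReal (√(∫ x, w x ∂μ)) := by
  have hw0 : 0 ≤ᵐ[μ] w := h.mono fun x hx => (sq_nonneg _).trans hx
  rw [eLpNorm_eq_lintegral_rpow_enorm_toReal (by norm_num) (by norm_num), Real.sqrt_eq_rpow,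
    ← ENNReal.ofReal_rpow_of_nonneg (integral_nonneg_of_ae hw0) (by norm_num),
    ofReal_integral_eq_lintegral_ofReal hw hw0]
  simp only [ENNReal.toReal_ofNat]
  gcongr ?_ ^ _
  refine lintegral_mono_ae ?_
  filter_upwards [h] with x hx
  rw [Real.enorm_eq_ofReal_abs, ENNReal.ofReal_rpow_of_nonneg (abs_nonneg _) (by norm_num)]
  refine ENNReal.ofReal_le_ofReal ?_
  rwa [Real.rpow_ofNat, sq_abs]

/-- The product structure of the square: `f - avgSnd f` is controlled both by a function of `x`
that is small when `∂₂f` is small and by a function of `y` plus constants, so its square has an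
integral that splits into a product. -/
lemma HasWeakPartials.eLpNorm_sub_avgSnd_le (h : HasWeakPartials f g₁ g₂) :
    eLpNorm (fun p => f p - avgSnd f p.1) 2 squareMeasure ≤
      ENNReal.ofReal (√(3 * weightBound * squareL1 g₂ * (squareL1 g₁ + squareL1 g₂))) := by
  have hB := one_le_weightBound
  have hg1 := h.integrable_fst
  have hg2 := h.snd.integrable_deriv
  have n1 := squareL1_nonneg g₁
  have n2 := squareL1_nonneg g₂
  set c := weightBound * squareL1 g₁ + weightBound * squareL1 g₂ with hc
  have hi1 : Integrable (fun y => (∫ x, |g₁ (x, y)| ∂intervalMeasure) + c) intervalMeasure :=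
    hg1.abs.integral_prod_right.add (integrable_const c)
  have hi2 : Integrable (fun x => ∫ y, |g₂ (x, y)| ∂intervalMeasure) intervalMeasure :=
    hg2.abs.integral_prod_left
  have hmean := weightedMean_swap h.snd.integrable_fun
  refine (eLpNorm_two_le_of_sq_le (hi2.mul_prod hi1) ?_).trans ?_
  · filter_upwards [h.snd.ae_abs_sub_avgSnd_le, ae_swap h.fst.ae_abs_sub_avgSnd_le,
      ae_fst_of_ae h.ae_abs_avgSnd_sub_le, ae_snd_of_ae h.swap.ae_abs_avgSnd_sub_le]
      with p h1 h2 h3 h4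
    simp only [Function.comp_def, Prod.swap_swap, Prod.fst_swap, Prod.swap_prod_mk] at h2
    rw [hmean, squareL1_swap] at h4
    rw [← sq_abs, sq]
    refine mul_le_mul h1 ?_ (abs_nonneg _) ((abs_nonneg _).trans h1)
    rw [abs_le] at h2 h3 h4 ⊢
    simp only [Function.comp_def] at h4
    constructor <;> linarith [h2.1, h2.2, h3.1, h3.2, h4.1, h4.2]
  · refine ENNReal.ofReal_le_ofReal (Real.sqrt_le_sqrt ?_)
    rw [integral_prod_mul (fun x => ∫ y, |g₂ (x, y)| ∂intervalMeasure)
      (fun y => (∫ x, |g₁ (x, y)| ∂intervalMeasure) + c), ← squareL1_eq hg2,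
      integral_add hg1.abs.integral_prod_right (integrable_const c), ← squareL1_eq_symm hg1,
      integral_const, Measure.real, intervalMeasure_univ]
    simp only [ENNReal.toReal_ofNat, smul_eq_mul, hc]
    have e : 3 * weightBound * squareL1 g₂ * (squareL1 g₁ + squareL1 g₂) -
        squareL1 g₂ * (squareL1 g₁ + 2 * (weightBound * squareL1 g₁ + weightBound * squareL1 g₂)) =
        squareL1 g₂ * ((weightBound - 1) * squareL1 g₁ + weightBound * squareL1 g₂) := by ring
    have : 0 ≤ squareL1 g₂ * ((weightBound - 1) * squareL1 g₁ + weightBound * squareL1 g₂) := by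
      have := sub_nonneg.2 hB
      positivity
    linarith

lemma squareMeasure_univ : squareMeasure univ = 4 := by
  rw [← univ_prod_univ, Measure.prod_prod, intervalMeasure_univ]
  norm_num

lemma eLpNorm_two_le_of_ae_abs_le {v : ℝ × ℝ → ℝ} {κ : ℝ}
    (h : ∀ᵐ p ∂squareMeasure, |v p| ≤ κ) :
    eLpNorm v 2 squareMeasure ≤ ENNReal.ofReal (2 * κ) := by
  refine (eLpNorm_le_of_ae_bound h).trans ?_
  have : (4 : ENNReal) ^ ((2 : ENNReal).toReal)⁻¹ = 2 := by
    rw [show (4 : ENNReal) = 2 ^ (2 : ℝ) by norm_num, ← ENNReal.rpow_mul]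
    norm_num
  rw [squareMeasure_univ, this, ENNReal.ofReal_mul (by norm_num)]
  simp

/-- Comparison of `f` with a function `φ` of the first variable that is uniformly close to the
average of `f` over the second variable. -/
lemma HasWeakPartials.eLpNorm_sub_le (h : HasWeakPartials f g₁ g₂) {φ : ℝ → ℝ} {κ : ℝ}
    (hφ : AEStronglyMeasurable φ intervalMeasure) (hκ : 0 ≤ κ)
    (hle : ∀ᵐ x ∂intervalMeasure, |avgSnd f x - φ x| ≤ κ) :
    eLpNorm (fun p => f p - φ p.1) 2 squareMeasure ≤
      ENNReal.ofReal (√(3 * weightBound * squareL1 g₂ * (squareL1 g₁ + squareL1 g₂)) + 2 * κ) := by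
  have hF : AEStronglyMeasurable (fun p : ℝ × ℝ => avgSnd f p.1) squareMeasure :=
    (integrable_avgSnd h.snd.integrable_fun).aestronglyMeasurable.comp_fst
  have e : (fun p => f p - φ p.1) = (fun p => f p - avgSnd f p.1) +
      fun p : ℝ × ℝ => avgSnd f p.1 - φ p.1 := by
    ext p
    simp
  rw [e, ENNReal.ofReal_add (Real.sqrt_nonneg _) (by positivity)]
  refine (eLpNorm_add_le (h.snd.integrable_fun.aestronglyMeasurable.sub hF)
    (hF.sub hφ.comp_fst) (by norm_num)).trans (add_le_add h.eLpNorm_sub_avgSnd_le ?_)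
  exact eLpNorm_two_le_of_ae_abs_le (ae_fst_of_ae hle)

lemma HasWeakPartials.squareL1_sub_le (h : HasWeakPartials f g₁ g₂) {φ : ℝ → ℝ} {κ : ℝ}
    (hφ : Integrable φ intervalMeasure)
    (hle : ∀ᵐ x ∂intervalMeasure, |avgSnd f x - φ x| ≤ κ) :
    squareL1 (fun p => f p - φ p.1) ≤ 2 * squareL1 g₂ + 4 * κ := by
  have hg2 := h.snd.integrable_deriv
  have hi : Integrable (fun p : ℝ × ℝ => ∫ y, |g₂ (p.1, y)| ∂intervalMeasure) squareMeasure :=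
    hg2.abs.integral_prod_left.comp_fst intervalMeasure
  have hle' : squareL1 (fun p => f p - φ p.1) ≤
      ∫ p : ℝ × ℝ, ((∫ y, |g₂ (p.1, y)| ∂intervalMeasure) + κ) ∂squareMeasure := by
    refine integral_mono_ae (h.snd.integrable_fun.sub (hφ.comp_fst intervalMeasure)).abs
      (hi.add (integrable_const κ)) ?_
    filter_upwards [h.snd.ae_abs_sub_avgSnd_le, ae_fst_of_ae hle] with p h1 h2
    rw [abs_le] at h1 h2 ⊢
    constructor <;> linarith [h1.1, h1.2, h2.1, h2.2]
  refine hle'.trans_eq ?_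
  rw [integral_add hi (integrable_const κ), integral_fun_fst
    (fun x => ∫ y, |g₂ (x, y)| ∂intervalMeasure), ← squareL1_eq hg2, integral_const, Measure.real,
    Measure.real, intervalMeasure_univ, squareMeasure_univ]
  simp

/-- A Poincaré–Sobolev inequality on the square. -/
lemma HasWeakPartials.eLpNorm_sub_weightedMean_le (h : HasWeakPartials f g₁ g₂) :
    eLpNorm (fun p => f p - weightedMean f) 2 squareMeasure ≤
      ENNReal.ofReal (5 * weightBound * (squareL1 g₁ + squareL1 g₂)) := by
  have hB := one_le_weightBound
  have n1 := squareL1_nonneg g₁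
  have n2 := squareL1_nonneg g₂
  refine (h.eLpNorm_sub_le (φ := fun _ => weightedMean f) aestronglyMeasurable_const
    (by positivity) h.ae_abs_avgSnd_sub_le).trans (ENNReal.ofReal_le_ofReal ?_)
  have h1 : √(3 * weightBound * squareL1 g₂ * (squareL1 g₁ + squareL1 g₂)) ≤
      3 * weightBound * (squareL1 g₁ + squareL1 g₂) := by
    refine Real.sqrt_le_iff.2 ⟨by positivity, ?_⟩
    rw [mul_pow, sq (3 * weightBound), sq (squareL1 g₁ + squareL1 g₂), ← mul_assoc]
    gcongr
    · nlinarith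
    · linarith
    · linarith
  nlinarith

/-- The nondecreasing profile generated by the averages of a density over the second variable. -/
noncomputable def profile (m : ℝ × ℝ → ℝ) (x : ℝ) : ℝ :=
  ∫ s, (if s < x then avgSnd m s else 0) ∂intervalMeasure

lemma integrable_ite_avgSnd (hf : Integrable f squareMeasure) (x : ℝ) :
    Integrable (fun s => if s < x then avgSnd f s else 0) intervalMeasure := by
  have := (integrable_avgSnd hf).indicator (measurableSet_Iio (a := x))
  exact this

lemma HasWeakPartials.exists_ae_abs_avgSnd_sub_profile_le {m e : ℝ × ℝ → ℝ}
    (h : HasWeakPartials f (fun p => m p + e p) g₂) (hm : Integrable m squareMeasure)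
    (he : Integrable e squareMeasure) :
    ∃ b, ∀ᵐ x ∂intervalMeasure, |avgSnd f x - (profile m x + b)| ≤
      weightBound * squareL1 e := by
  have hM := integrable_avgSnd hm
  have hE := integrable_avgSnd he
  have hT : Integrable (fun s => tail weight s * avgSnd m s) intervalMeasure :=
    hM.bdd_mul (c := 1) continuous_tail_weight.aestronglyMeasurable
      (.of_forall fun s => by
        rw [Real.norm_eq_abs, abs_of_nonneg (tail_weight_nonneg s)]
        exact tail_weight_le_one s)
  refine ⟨weightedMean f - ∫ s, tail weight s * avgSnd m s ∂intervalMeasure, ?_⟩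
  filter_upwards [h.ae_avgSnd_eq] with x hx
  have e1 : ∫ s, avgKernel x s * avgSnd (fun p => m p + e p) s ∂intervalMeasure =
      (∫ s, avgKernel x s * avgSnd m s ∂intervalMeasure) +
        ∫ s, avgKernel x s * avgSnd e s ∂intervalMeasure := by
    rw [← integral_add (integrable_avgKernel_mul hM x) (integrable_avgKernel_mul hE x)]
    refine integral_congr_ae ?_
    filter_upwards [avgSnd_add hm he] with s hs
    rw [hs]
    ring
  have e2 : ∫ s, avgKernel x s * avgSnd m s ∂intervalMeasure =
      profile m x - ∫ s, tail weight s * avgSnd m s ∂intervalMeasure := by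
    rw [profile, ← integral_sub (integrable_ite_avgSnd hm x) hT]
    refine integral_congr_ae (.of_forall fun s => ?_)
    simp only [avgKernel]
    split_ifs <;> ring
  rw [hx, e1, e2]
  have := (abs_integral_avgKernel_mul_le hE x).trans (integral_abs_avgSnd_le he)
  rwa [show ∀ a b c d : ℝ, a + (b - c + d) - (b + (a - c)) = d by intros; ring]

end SquareEstimates

/-- A Korn-type rigidity on the square: if `∂₁U` and `∂₂V` both nearly equal `m` while `∂₂U` and
`∂₁V` nearly vanish, then the averages of `U` over the second variable are nearly affine, with
slope the weighted mean of `m`. Indeed the average of `m` over the second variable is that of `∂₂V`,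
which is an integral of `-V` against `weight'`; as `V` hardly depends on the first variable, neither
does this average. -/
lemma HasWeakPartials.exists_ae_abs_avgSnd_sub_affine_le {U V m e₁ e₂ e₃ e₄ : ℝ × ℝ → ℝ}
    (hU : HasWeakPartials U (fun p => m p + e₁ p) e₂)
    (hV : HasWeakPartials V e₃ (fun p => m p + e₄ p)) (hm : Integrable m squareMeasure)
    (h1 : Integrable e₁ squareMeasure) (h4 : Integrable e₄ squareMeasure) :
    ∃ b, ∀ᵐ x ∂intervalMeasure, |avgSnd U x - (weightedMean m * x + b)| ≤
      4 * weightBound ^ 2 * (squareL1 e₁ + squareL1 e₃ + squareL1 e₄) := by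
  have hB := one_le_weightBound
  have n1 := squareL1_nonneg e₁
  have n3 := squareL1_nonneg e₃
  have n4 := squareL1_nonneg e₄
  have h3 : Integrable e₃ squareMeasure := hV.integrable_fst
  set G := avgSnd (V ∘ Prod.swap) with hG
  set k := -∫ y, deriv weight y * G y ∂intervalMeasure with hk
  set m₀ := weightedMean m with hm₀
  have hGi : Integrable G intervalMeasure := integrable_avgSnd hV.fst.integrable_fun
  have hw := weight_isIntervalTest
  -- The average of `m + e₄` is the constant `k` up to an error controlled by `e₃`.
  have hmean4 : ∀ᵐ x ∂intervalMeasure,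
      |avgSnd m x + avgSnd e₄ x - k| ≤ weightBound * squareL1 e₃ := by
    have hVG := ae_swap hV.fst.ae_abs_sub_avgSnd_le
    filter_upwards [hV.snd.slice hw, avgSnd_add hm h4, Measure.ae_ae_of_ae_prod hVG,
      hV.snd.integrable_fun.prod_right_ae] with x hx hadd hxG hVi
    have hi : Integrable (fun y => deriv weight y * (V (x, y) - G y)) intervalMeasure :=
      hw.deriv.integrable_mul (hVi.sub hGi)
    have e : avgSnd m x + avgSnd e₄ x - k =
        -∫ y, deriv weight y * (V (x, y) - G y) ∂intervalMeasure := by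
      rw [← hadd, avgSnd, hk]
      simp only [mul_sub]
      rw [integral_sub (hw.deriv.integrable_mul hVi) (hw.deriv.integrable_mul hGi)]
      linarith
    rw [e, abs_neg, squareL1_eq_symm h3, ← integral_const_mul]
    refine abs_integral_le_integral_abs.trans (integral_mono_ae hi.abs
      (h3.abs.integral_prod_right.const_mul _) ?_)
    filter_upwards [hxG] with y hy
    simp only [Function.comp, Prod.swap_prod_mk] at hy
    simp only [abs_mul]
    exact mul_le_mul (abs_deriv_weight_le y) hy (abs_nonneg _) weightBound_pos.le
  have hMi := integrable_avgSnd hm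
  have hE1 := integrable_avgSnd h1
  have hE4 := integrable_avgSnd h4
  have hk0 : |m₀ - k| ≤ weightBound * squareL1 e₃ + weightBound ^ 2 * squareL1 e₄ := by
    have e : m₀ - k = ∫ x, weight x * (avgSnd m x - k) ∂intervalMeasure := by
      simp only [mul_sub]
      rw [integral_sub (hw.integrable_mul hMi) (hw.integrable_mul (integrable_const k)),
        integral_mul_const, integral_weight_interval, hm₀, weightedMean]
      ring
    have hrhs : weightBound * squareL1 e₃ + weightBound ^ 2 * squareL1 e₄ ≥
        ∫ x, (weight x * (weightBound * squareL1 e₃) + weightBound * |avgSnd e₄ x|)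
          ∂intervalMeasure := by
      rw [integral_add (hw.integrable_mul (integrable_const _)) (hE4.abs.const_mul _),
        integral_mul_const, integral_weight_interval, integral_const_mul, sq, mul_assoc, one_mul]
      gcongr
      exact integral_abs_avgSnd_le h4
    refine le_trans ?_ hrhs
    rw [e]
    refine abs_integral_le_integral_abs.trans (integral_mono_ae
      (hw.integrable_mul (hMi.sub (integrable_const k))).abs
      ((hw.integrable_mul (integrable_const _)).add (hE4.abs.const_mul _)) ?_)
    filter_upwards [hmean4] with x hx
    have hwx := weight_nonneg x
    have hwB := (abs_le.1 (abs_weight_le x)).2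
    have : |avgSnd m x - k| ≤ weightBound * squareL1 e₃ + |avgSnd e₄ x| := by
      have h := abs_sub (avgSnd m x + avgSnd e₄ x - k) (avgSnd e₄ x)
      rw [show avgSnd m x + avgSnd e₄ x - k - avgSnd e₄ x = avgSnd m x - k by ring] at h
      linarith
    simp only [abs_mul, abs_of_nonneg hwx]
    calc weight x * |avgSnd m x - k|
        ≤ weight x * (weightBound * squareL1 e₃ + |avgSnd e₄ x|) := by gcongr
      _ ≤ _ := by rw [mul_add]; gcongr
  have hSi : Integrable (avgSnd fun p => m p + e₁ p) intervalMeasure :=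
    integrable_avgSnd (hm.add h1)
  have hdiff : ∫ s, |avgSnd (fun p => m p + e₁ p) s - m₀| ∂intervalMeasure ≤
      4 * weightBound ^ 2 * (squareL1 e₁ + squareL1 e₃ + squareL1 e₄) := by
    have hle : ∫ s, |avgSnd (fun p => m p + e₁ p) s - m₀| ∂intervalMeasure ≤
        ∫ s, (|avgSnd e₁ s| + |avgSnd e₄ s| + (weightBound * squareL1 e₃ + |m₀ - k|))
          ∂intervalMeasure := by
      refine integral_mono_ae (hSi.sub (integrable_const _)).abs
        ((hE1.abs.add hE4.abs).add (integrable_const _)) ?_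
      filter_upwards [hmean4, avgSnd_add hm h1] with x hx hadd
      simp only [hadd]
      have a1 := neg_abs_le (avgSnd e₁ x)
      have a2 := le_abs_self (avgSnd e₁ x)
      have a3 := neg_abs_le (avgSnd e₄ x)
      have a4 := le_abs_self (avgSnd e₄ x)
      have a5 := neg_abs_le (m₀ - k)
      have a6 := le_abs_self (m₀ - k)
      rw [abs_le] at hx ⊢
      constructor <;> linarith [hx.1, hx.2]
    refine hle.trans ?_
    have hi2 : Integrable (fun s => |avgSnd e₁ s| + |avgSnd e₄ s|) intervalMeasure :=
      hE1.abs.add hE4.abs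
    rw [integral_add hi2 (integrable_const _), integral_add hE1.abs hE4.abs, integral_const,
      Measure.real, intervalMeasure_univ]
    simp only [ENNReal.toReal_ofNat, smul_eq_mul]
    have b1 := integral_abs_avgSnd_le h1
    have b4 := integral_abs_avgSnd_le h4
    have hB2 : weightBound ≤ weightBound ^ 2 := by nlinarith
    have p1 := mul_le_mul_of_nonneg_right hB2 n1
    have p3 := mul_le_mul_of_nonneg_right hB2 n3
    have p4 := mul_le_mul_of_nonneg_right hB2 n4
    have q1 : 0 ≤ weightBound ^ 2 * squareL1 e₁ := by positivity
    have q4 : 0 ≤ weightBound ^ 2 * squareL1 e₄ := by positivity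
    linarith
  refine ⟨weightedMean U + m₀ * (1 - ∫ s, tail weight s ∂intervalMeasure), ?_⟩
  filter_upwards [hU.ae_avgSnd_eq, ae_restrict_mem measurableSet_Ioo] with x hx hxI
  have hTi : Integrable (tail weight) intervalMeasure :=
    Integrable.of_bound continuous_tail_weight.aestronglyMeasurable 1 (.of_forall fun s => by
      rw [Real.norm_eq_abs, abs_of_nonneg (tail_weight_nonneg s)]
      exact tail_weight_le_one s)
  have hKi : ∫ s, avgKernel x s ∂intervalMeasure =
      x + 1 - ∫ s, tail weight s ∂intervalMeasure := by
    have hite : Integrable (fun s => if s < x then (1 : ℝ) else 0) intervalMeasure := by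
      have := (integrable_const (μ := intervalMeasure) (1 : ℝ)).indicator
        (measurableSet_Iio (a := x))
      exact this
    have hval : ∫ s, (if s < x then (1 : ℝ) else 0) ∂intervalMeasure = x + 1 := by
      have : (fun s => if s < x then (1 : ℝ) else 0) = (Iio x).indicator fun _ => 1 := rfl
      rw [this, integral_indicator measurableSet_Iio, Measure.restrict_restrict measurableSet_Iio]
      have hs : Iio x ∩ Ioo (-1) 1 = Ioo (-1) x := by
        ext s
        simp only [mem_inter_iff, mem_Iio, mem_Ioo]
        constructor
        · rintro ⟨a, b, c⟩; exact ⟨b, a⟩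
        · rintro ⟨a, b⟩; exact ⟨b, a, b.trans hxI.2⟩
      rw [hs]
      simp [max_eq_left (show (0 : ℝ) ≤ x + 1 by linarith [hxI.1])]
    simp only [avgKernel]
    rw [integral_sub hite hTi, hval]
  have key : avgSnd U x - (m₀ * x + (weightedMean U +
      m₀ * (1 - ∫ s, tail weight s ∂intervalMeasure))) =
      ∫ s, avgKernel x s * (avgSnd (fun p => m p + e₁ p) s - m₀) ∂intervalMeasure := by
    simp only [mul_sub]
    rw [integral_sub (integrable_avgKernel_mul hSi x)
      (integrable_avgKernel_mul (integrable_const m₀) x), integral_mul_const, hKi, hx]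
    ring
  rw [key]
  exact (abs_integral_avgKernel_mul_le (hSi.sub (integrable_const m₀)) x).trans hdiff

lemma intervalMeasure_integral_id : ∫ x, x ∂intervalMeasure = 0 := by
  rw [← integral_Ioc_eq_integral_Ioo, ← intervalIntegral.integral_of_le (by norm_num), integral_id]
  norm_num

lemma intervalMeasure_integral_sq : ∫ x, x * x ∂intervalMeasure = 2 / 3 := by
  simp only [← sq]
  rw [← integral_Ioc_eq_integral_Ioo, ← intervalIntegral.integral_of_le (by norm_num), integral_pow]
  norm_num

/-- On the space of affine functions the `L²` norm is bounded by the `L¹` norm. -/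
lemma eLpNorm_affine_le (c₀ c₁ c₂ : ℝ) :
    eLpNorm (fun p : ℝ × ℝ => c₀ + p.1 * c₁ + p.2 * c₂) 2 squareMeasure ≤
      ENNReal.ofReal (4 * squareL1 fun p => c₀ + p.1 * c₁ + p.2 * c₂) := by
  set L := squareL1 fun p => c₀ + p.1 * c₁ + p.2 * c₂ with hL
  have hmem : ∀ᵐ p ∂squareMeasure, |p.1| ≤ 1 ∧ |p.2| ≤ 1 := by
    have : ∀ᵐ x ∂intervalMeasure, |x| ≤ 1 := by
      filter_upwards [ae_restrict_mem measurableSet_Ioo] with x hx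
      exact abs_le.2 ⟨hx.1.le, hx.2.le⟩
    filter_upwards [ae_fst_of_ae this, ae_snd_of_ae this] with p h1 h2 using ⟨h1, h2⟩
  have hbd : ∀ (φ : ℝ × ℝ → ℝ), Continuous φ → (∀ p : ℝ × ℝ, |p.1| ≤ 1 → |p.2| ≤ 1 → |φ p| ≤ 1) →
      ∀ g : ℝ × ℝ → ℝ, Integrable g squareMeasure →
      Integrable (fun p => φ p * g p) squareMeasure ∧
        |∫ p, φ p * g p ∂squareMeasure| ≤ squareL1 g := by
    intro φ hφ h1 g hg
    have hb : ∀ᵐ p ∂squareMeasure, ‖φ p‖ ≤ 1 := hmem.mono fun p hp => h1 p hp.1 hp.2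
    have hi := hg.bdd_mul hφ.aestronglyMeasurable hb
    refine ⟨hi, abs_integral_le_integral_abs.trans (integral_mono_ae hi.abs hg.abs ?_)⟩
    filter_upwards [hb] with p hp
    simp only [abs_mul]
    exact mul_le_of_le_one_left (abs_nonneg _) hp
  have i0 : Integrable (fun _ : ℝ × ℝ => (1 : ℝ)) squareMeasure := integrable_const 1
  have i1 : Integrable (fun p : ℝ × ℝ => p.1) squareMeasure := by
    simpa using (hbd Prod.fst continuous_fst (fun p h _ => h) _ i0).1
  have i2 : Integrable (fun p : ℝ × ℝ => p.2) squareMeasure := by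
    simpa using (hbd Prod.snd continuous_snd (fun p _ h => h) _ i0).1
  have i11 := (hbd Prod.fst continuous_fst (fun p h _ => h) _ i1).1
  have i12 := (hbd Prod.fst continuous_fst (fun p h _ => h) _ i2).1
  have i21 := (hbd Prod.snd continuous_snd (fun p _ h => h) _ i1).1
  have i22 := (hbd Prod.snd continuous_snd (fun p _ h => h) _ i2).1
  have hM : (intervalMeasure.real univ : ℝ) = 2 := by
    rw [Measure.real, intervalMeasure_univ, ENNReal.toReal_ofNat]
  have v0 : ∫ _ : ℝ × ℝ, (1 : ℝ) ∂squareMeasure = 4 := by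
    simp [Measure.real, squareMeasure_univ]
  have v1 : ∫ p : ℝ × ℝ, p.1 ∂squareMeasure = 0 := by
    rw [integral_fun_fst (fun x : ℝ => x), intervalMeasure_integral_id, smul_zero]
  have v2 : ∫ p : ℝ × ℝ, p.2 ∂squareMeasure = 0 := by
    rw [integral_fun_snd (fun x : ℝ => x), intervalMeasure_integral_id, smul_zero]
  have v11 : ∫ p : ℝ × ℝ, p.1 * p.1 ∂squareMeasure = 4 / 3 := by
    rw [integral_fun_fst (fun x : ℝ => x * x), intervalMeasure_integral_sq, hM]; norm_num
  have v22 : ∫ p : ℝ × ℝ, p.2 * p.2 ∂squareMeasure = 4 / 3 := by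
    rw [integral_fun_snd (fun x : ℝ => x * x), intervalMeasure_integral_sq, hM]; norm_num
  have v12 : ∫ p : ℝ × ℝ, p.1 * p.2 ∂squareMeasure = 0 := by
    rw [integral_prod_mul (fun x : ℝ => x) (fun x : ℝ => x), intervalMeasure_integral_id, mul_zero]
  have v21 : ∫ p : ℝ × ℝ, p.2 * p.1 ∂squareMeasure = 0 := by
    simpa only [mul_comm] using v12
  have ia : Integrable (fun p : ℝ × ℝ => c₀ + p.1 * c₁ + p.2 * c₂) squareMeasure :=
    ((integrable_const c₀).add (i1.mul_const c₁)).add (i2.mul_const c₂)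
  have expand : ∀ φ : ℝ × ℝ → ℝ, Integrable φ squareMeasure →
      Integrable (fun p => φ p * p.1) squareMeasure →
      Integrable (fun p => φ p * p.2) squareMeasure →
      ∫ p, φ p * (c₀ + p.1 * c₁ + p.2 * c₂) ∂squareMeasure =
        (∫ p, φ p ∂squareMeasure) * c₀ + (∫ p, φ p * p.1 ∂squareMeasure) * c₁ +
          (∫ p, φ p * p.2 ∂squareMeasure) * c₂ := by
    intro φ h0 h1 h2
    have h01 : Integrable (fun p => φ p * c₀ + φ p * p.1 * c₁) squareMeasure :=
      (h0.mul_const c₀).add (h1.mul_const c₁)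
    rw [← integral_mul_const, ← integral_mul_const, ← integral_mul_const,
      ← integral_add (h0.mul_const c₀) (h1.mul_const c₁), ← integral_add h01 (h2.mul_const c₂)]
    refine integral_congr_ae (.of_forall fun p => ?_)
    simp only
    ring
  have b0 : |c₀| ≤ L / 4 := by
    have h := (hbd (fun _ => 1) continuous_const (fun _ _ _ => by simp) _ ia).2
    rw [expand _ i0 (by simpa using i1) (by simpa using i2)] at h
    simp only [one_mul, v0, v1, v2, zero_mul, add_zero, abs_mul] at h
    rw [abs_of_pos (by norm_num : (0 : ℝ) < 4)] at h
    linarith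
  have b1 : |c₁| ≤ 3 / 4 * L := by
    have h := (hbd Prod.fst continuous_fst (fun p h _ => h) _ ia).2
    rw [expand _ i1 i11 i12, v1, v11, v12, zero_mul, zero_mul, add_zero, zero_add, abs_mul,
      abs_of_pos (by norm_num : (0 : ℝ) < 4 / 3)] at h
    linarith
  have b2 : |c₂| ≤ 3 / 4 * L := by
    have h := (hbd Prod.snd continuous_snd (fun p _ h => h) _ ia).2
    rw [expand _ i2 i21 i22, v2, v21, v22, zero_mul, zero_mul, add_zero, zero_add, abs_mul,
      abs_of_pos (by norm_num : (0 : ℝ) < 4 / 3)] at h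
    linarith
  rw [show 4 * L = 2 * (2 * L) by ring]
  refine eLpNorm_two_le_of_ae_abs_le (hmem.mono fun p hp => ?_)
  have t1 : |p.1 * c₁| ≤ |c₁| := by
    rw [abs_mul]; exact mul_le_of_le_one_left (abs_nonneg _) hp.1
  have t2 : |p.2 * c₂| ≤ |c₂| := by
    rw [abs_mul]; exact mul_le_of_le_one_left (abs_nonneg _) hp.2
  have := abs_add_three c₀ (p.1 * c₁) (p.2 * c₂)
  have := squareL1_nonneg fun p => c₀ + p.1 * c₁ + p.2 * c₂
  linarith

/-! ### Monotone profiles -/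

lemma isW11LocWithIntegrableDeriv_integral_lt {M : ℝ → ℝ} (hM : Integrable M) (h0 : ∀ s, 0 ≤ M s) :
    IsW11LocWithIntegrableDeriv fun t => ∫ s, if s < t then M s else 0 := by
  have hi : ∀ t, Integrable fun s => if s < t then M s else 0 := fun t => by
    have := hM.indicator (measurableSet_Iio (a := t))
    exact this
  have hmono : Monotone fun t => ∫ s, if s < t then M s else 0 := by
    intro t t' htt
    refine integral_mono (hi t) (hi t') fun s => ?_
    simp only
    split_ifs with h1 h2
    · exact le_rfl
    · exact absurd (h1.trans_le htt) h2
    · exact h0 s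
    · exact le_rfl
  refine ⟨hmono.locallyIntegrable, M, hM, fun φ h1 h2 _ => ?_⟩
  have hd : HasCompactSupport (deriv φ) := h2.deriv
  have hdi : Integrable (deriv φ) := (h1.continuous_deriv (by simp)).integrable_of_hasCompactSupport hd
  have hI : Integrable (fun p : ℝ × ℝ => (if p.2 < p.1 then M p.2 else 0) * deriv φ p.1)
      (volume.prod volume) := by
    have := (hdi.mul_prod hM).indicator (measurableSet_lt measurable_snd measurable_fst)
    refine this.congr (.of_forall fun p => ?_)
    simp only [indicator_apply, mem_ofPred_eq]
    split_ifs <;> ring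
  simp only [Measure.restrict_univ, fderiv_apply_one_eq_deriv, ← integral_mul_const]
  rw [integral_integral_swap (f := fun x s => (if s < x then M s else 0) * deriv φ x) hI,
    ← integral_neg]
  refine integral_congr_ae (.of_forall fun s => ?_)
  have e : ∀ x, (if s < x then M s else 0) * deriv φ x = M s * (Ioi s).indicator (deriv φ) x := by
    intro x
    simp only [indicator_apply, mem_Ioi]
    split_ifs <;> ring
  simp only [e]
  rw [integral_const_mul, integral_indicator measurableSet_Ioi,
    h2.integral_Ioi_deriv_eq (h1.of_le (by simp))]
  ring

section Profile

variable {m : ℝ × ℝ → ℝ}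

lemma avgSnd_nonneg (h0 : ∀ p, 0 ≤ m p) (x : ℝ) : 0 ≤ avgSnd m x :=
  integral_nonneg fun y => mul_nonneg (weight_nonneg y) (h0 _)

lemma profile_mono (hm : Integrable m squareMeasure) (h0 : ∀ p, 0 ≤ m p) : Monotone (profile m) := by
  intro t t' htt
  refine integral_mono (integrable_ite_avgSnd hm t) (integrable_ite_avgSnd hm t') fun s => ?_
  have := avgSnd_nonneg h0 s
  simp only
  split_ifs with h1 h2
  · exact le_rfl
  · exact absurd (h1.trans_le htt) h2
  · exact this
  · exact le_rfl

lemma abs_profile_le (hm : Integrable m squareMeasure) (x : ℝ) :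
    |profile m x| ≤ weightBound * squareL1 m := by
  refine le_trans ?_ (integral_abs_avgSnd_le hm)
  refine abs_integral_le_integral_abs.trans
    (integral_mono (integrable_ite_avgSnd hm x).abs (integrable_avgSnd hm).abs fun s => ?_)
  simp only
  split_ifs
  · exact le_rfl
  · simp

lemma isW11LocWithIntegrableDeriv_profile (hm : Integrable m squareMeasure) (h0 : ∀ p, 0 ≤ m p)
    {κ : ℝ} (hκ : 0 < κ) : IsW11LocWithIntegrableDeriv fun t => profile m (κ * t) := by
  set M : ℝ → ℝ := (Ioo (-1 : ℝ) 1).indicator (avgSnd m) with hMdef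
  have hM : Integrable M := (integrable_indicator_iff measurableSet_Ioo).2 (integrable_avgSnd hm)
  have hM0 : ∀ s, 0 ≤ M s := indicator_nonneg fun s _ => avgSnd_nonneg h0 s
  have e : (fun t => profile m (κ * t)) = fun t => ∫ s, if s < t then κ * M (κ * s) else 0 := by
    ext t
    have e1 : profile m (κ * t) = ∫ s, if s < κ * t then M s else 0 := by
      rw [profile, ← integral_indicator measurableSet_Ioo]
      refine integral_congr_ae (.of_forall fun s => ?_)
      simp only [hMdef, indicator_apply]
      split_ifs <;> rfl
    have e2 : ∀ s, (if s < t then κ * M (κ * s) else 0) =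
        κ * (fun s => if s < κ * t then M s else 0) (κ * s) := by
      intro s
      simp only [mul_lt_mul_iff_right₀ hκ]
      split_ifs <;> simp
    simp only [e2]
    rw [integral_const_mul, Measure.integral_comp_mul_left
      (fun s => if s < κ * t then M s else 0) κ, e1, abs_of_pos (inv_pos.2 hκ), smul_eq_mul,
      mul_inv_cancel_left₀ hκ.ne']
  rw [e]
  exact isW11LocWithIntegrableDeriv_integral_lt ((hM.comp_mul_left' hκ.ne').const_mul κ)
    fun s => mul_nonneg hκ.le (hM0 _)

end Profile

/-! ### Linear charts and weak derivatives -/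

/-- The square `(-1, 1)²` in `ℝ × ℝ`. -/
def productSquare : Set (ℝ × ℝ) := Ioo (-1) 1 ×ˢ Ioo (-1) 1

lemma isOpen_productSquare : IsOpen productSquare := isOpen_Ioo.prod isOpen_Ioo

lemma measurableSet_openSquare (ℓ : ℝ) : MeasurableSet (openSquare ℓ) := by
  have : openSquare ℓ = ⋂ i, (fun x : EuclideanSpace ℝ (Fin 2) => x i) ⁻¹' Ioo (-ℓ) ℓ := by
    ext x; simp [openSquare]
  rw [this]
  exact (isOpen_iInter_of_finite fun i => isOpen_Ioo.preimage (by fun_prop)).measurableSet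

/-- The bilinear pairing `p · M t` of a matrix with two vectors. -/
noncomputable def matPairing {N : ℕ} (p : EuclideanSpace ℝ (Fin N)) (M : Matrix (Fin N) (Fin 2) ℝ)
    (t : EuclideanSpace ℝ (Fin 2)) : ℝ := ∑ i, ∑ k, p i * M i k * t k

/-- `T` is the linear chart `y ↦ y₁ t₁ + y₂ t₂`, it multiplies areas by `d` and maps the square
`(-1, 1)²` into `(-ℓ, ℓ)²`. -/
structure IsSquareChart (ℓ d : ℝ) (t₁ t₂ : EuclideanSpace ℝ (Fin 2))
    (T : (ℝ × ℝ) ≃L[ℝ] EuclideanSpace ℝ (Fin 2)) : Prop where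
  apply_eq : ∀ p, T p = p.1 • t₁ + p.2 • t₂
  det_pos : 0 < d
  map_volume : Measure.map T volume = ENNReal.ofReal d⁻¹ • volume
  mapsTo : ∀ p ∈ productSquare, T p ∈ openSquare ℓ

lemma squareMeasure_eq :
    squareMeasure = volume.restrict productSquare :=
  Measure.prod_restrict _ _

/-- Two vectors of the plane with nonvanishing determinant define a linear chart. -/
lemma exists_linear_chart (t₁ t₂ : EuclideanSpace ℝ (Fin 2)) {d : ℝ}
    (hd : |t₁ 0 * t₂ 1 - t₁ 1 * t₂ 0| = d) (hd0 : 0 < d) :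
    ∃ T : (ℝ × ℝ) ≃L[ℝ] EuclideanSpace ℝ (Fin 2),
      (∀ p, T p = p.1 • t₁ + p.2 • t₂) ∧
        Measure.map T volume = ENNReal.ofReal d⁻¹ • volume := by
  set b := Module.Basis.finTwoProd ℝ
  set M : Matrix (Fin 2) (Fin 2) ℝ := !![t₁ 0, t₂ 0; t₁ 1, t₂ 1]
  set G : (ℝ × ℝ) →ₗ[ℝ] (ℝ × ℝ) := Matrix.toLin b b M with hG
  have hdet : LinearMap.det G = t₁ 0 * t₂ 1 - t₁ 1 * t₂ 0 := by
    rw [hG, LinearMap.det_toLin, Matrix.det_fin_two_of]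
    ring
  have hne : LinearMap.det G ≠ 0 := by
    rw [hdet]
    intro h
    rw [h, abs_zero] at hd
    exact hd0.ne hd
  have hGa : ∀ p, G p = (p.1 * t₁ 0 + p.2 * t₂ 0, p.1 * t₁ 1 + p.2 * t₂ 1) := by
    intro p
    have := Matrix.toLin_finTwoProd_apply (t₁ 0) (t₂ 0) (t₁ 1) (t₂ 1) p
    rw [hG, this]
    ext <;> simp only <;> ring
  set e1 : (ℝ × ℝ) ≃L[ℝ] (Fin 2 → ℝ) := (ContinuousLinearEquiv.finTwoArrow ℝ ℝ).symm
  set e2 : (Fin 2 → ℝ) ≃L[ℝ] EuclideanSpace ℝ (Fin 2) :=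
    (PiLp.continuousLinearEquiv 2 ℝ fun _ : Fin 2 => ℝ).symm
  set Ge : (ℝ × ℝ) ≃L[ℝ] (ℝ × ℝ) := (G.equivOfDetNeZero hne).toContinuousLinearEquiv
  have hGe : ∀ p, Ge p = G p := fun p => rfl
  refine ⟨(Ge.trans e1).trans e2, fun p => ?_, ?_⟩
  · ext i
    have : ((Ge.trans e1).trans e2) p i = ![(G p).1, (G p).2] i := rfl
    rw [this, hGa]
    fin_cases i <;> simp
  · have hc : ⇑((Ge.trans e1).trans e2) = (e2 ∘ e1) ∘ Ge := rfl
    have hpres : MeasurePreserving (e2 ∘ e1) volume volume :=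
      (EuclideanSpace.volume_preserving_symm_measurableEquiv_toLp (Fin 2)).symm.comp
        (volume_preserving_finTwoArrow ℝ).symm
    rw [hc, ← Measure.map_map hpres.measurable Ge.continuous.measurable, show ⇑Ge = ⇑G from rfl,
      Measure.map_linearMap_addHaar_eq_smul_addHaar volume hne, Measure.map_smul, hpres.map_eq,
      hdet, abs_inv, hd]

namespace IsSquareChart

variable {ℓ d : ℝ} {t₁ t₂ : EuclideanSpace ℝ (Fin 2)}
  {T : (ℝ × ℝ) ≃L[ℝ] EuclideanSpace ℝ (Fin 2)}

lemma measurableEmbedding (T : (ℝ × ℝ) ≃L[ℝ] EuclideanSpace ℝ (Fin 2)) : MeasurableEmbedding T :=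
  T.toHomeomorph.measurableEmbedding

lemma map_squareMeasure (h : IsSquareChart ℓ d t₁ t₂ T) :
    Measure.map T squareMeasure = ENNReal.ofReal d⁻¹ • volume.restrict (T '' productSquare) := by
  rw [squareMeasure_eq, ← Measure.restrict_smul, ← h.map_volume,
    (measurableEmbedding T).restrict_map, preimage_image_eq _ T.injective]

lemma image_subset (h : IsSquareChart ℓ d t₁ t₂ T) : T '' productSquare ⊆ openSquare ℓ := by
  rintro _ ⟨p, hp, rfl⟩
  exact h.mapsTo p hp

lemma integrable_comp {F : Type*} [NormedAddCommGroup F] (h : IsSquareChart ℓ d t₁ t₂ T)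
    {f : EuclideanSpace ℝ (Fin 2) → F} (hf : IntegrableOn f (openSquare ℓ)) :
    Integrable (fun p => f (T p)) squareMeasure := by
  have := (measurableEmbedding T).integrable_map_iff (μ := squareMeasure) (g := f)
  refine this.1 ?_
  rw [h.map_squareMeasure]
  exact Integrable.smul_measure (hf.mono_set h.image_subset) ENNReal.ofReal_ne_top

lemma integral_comp (h : IsSquareChart ℓ d t₁ t₂ T) (f : EuclideanSpace ℝ (Fin 2) → ℝ) :
    ∫ p, f (T p) ∂squareMeasure = d⁻¹ * ∫ x in T '' productSquare, f x := by
  rw [← (measurableEmbedding T).integral_map, h.map_squareMeasure, integral_smul_measure,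
    ENNReal.toReal_ofReal (inv_pos.2 h.det_pos).le, smul_eq_mul]

lemma integral_comp_le (h : IsSquareChart ℓ d t₁ t₂ T) {f : EuclideanSpace ℝ (Fin 2) → ℝ}
    (hf : IntegrableOn f (openSquare ℓ)) (h0 : ∀ x, 0 ≤ f x) :
    ∫ p, f (T p) ∂squareMeasure ≤ d⁻¹ * ∫ x in openSquare ℓ, f x := by
  rw [h.integral_comp]
  refine mul_le_mul_of_nonneg_left ?_ (inv_pos.2 h.det_pos).le
  exact setIntegral_mono_set hf (.of_forall h0) h.image_subset.eventuallyLE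

lemma eLpNorm_restrict_le {F : Type*} [NormedAddCommGroup F] (h : IsSquareChart ℓ d t₁ t₂ T)
    {q : Set (EuclideanSpace ℝ (Fin 2))} (hq : q ⊆ T '' productSquare) (f : EuclideanSpace ℝ (Fin 2) → F) :
    eLpNorm f 2 (volume.restrict q) ≤
      ENNReal.ofReal (√d) * eLpNorm (fun p => f (T p)) 2 squareMeasure := by
  have hd := h.det_pos
  have e : volume.restrict (T '' productSquare) = ENNReal.ofReal d • Measure.map T squareMeasure := by
    rw [h.map_squareMeasure, smul_smul, ← ENNReal.ofReal_mul hd.le, mul_inv_cancel₀ hd.ne',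
      ENNReal.ofReal_one, one_smul]
  refine (eLpNorm_mono_measure f (Measure.restrict_mono hq le_rfl)).trans_eq ?_
  rw [e, eLpNorm_smul_measure_of_ne_zero (ENNReal.ofReal_pos.2 hd).ne',
    (measurableEmbedding T).eLpNorm_map_measure, smul_eq_mul, Real.sqrt_eq_rpow,
    ← ENNReal.ofReal_rpow_of_pos hd]
  congr 2
  norm_num

end IsSquareChart

section WeakDerivative

variable {N : ℕ} {Ω : Set (EuclideanSpace ℝ (Fin 2))}
  {u : EuclideanSpace ℝ (Fin 2) → EuclideanSpace ℝ (Fin N)}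
  {Du : EuclideanSpace ℝ (Fin 2) → Matrix (Fin N) (Fin 2) ℝ}

lemma IsW11WithGradient.integrable_inner (h : IsW11WithGradient Ω u Du)
    (p : EuclideanSpace ℝ (Fin N)) : IntegrableOn (fun x => inner ℝ p (u x)) Ω :=
  (innerSL ℝ p).integrable_comp h.integrable_fun

lemma IsW11WithGradient.integrable_apply (h : IsW11WithGradient Ω u Du) (i : Fin N) :
    IntegrableOn (fun x => u x i) Ω :=
  (EuclideanSpace.proj i : EuclideanSpace ℝ (Fin N) →L[ℝ] ℝ).integrable_comp h.integrable_fun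

lemma IsW11WithGradient.integrable_matPairing (h : IsW11WithGradient Ω u Du)
    (p : EuclideanSpace ℝ (Fin N)) (t : EuclideanSpace ℝ (Fin 2)) :
    IntegrableOn (fun x => matPairing p (Du x) t) Ω :=
  integrable_finsetSum _ fun i _ => integrable_finsetSum _ fun k _ =>
    ((h.integrable_grad i k).const_mul _).mul_const _

/-- The weak derivative of `p · u` in direction `t` is `p · Du t`. -/
lemma IsW11WithGradient.hasWeakDirDeriv (h : IsW11WithGradient Ω u Du)
    (p : EuclideanSpace ℝ (Fin N)) (t : EuclideanSpace ℝ (Fin 2)) :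
    HasWeakDirDeriv Ω (fun x => inner ℝ p (u x)) (fun x => matPairing p (Du x) t) t := by
  intro φ h1 h2 h3
  have hφ' : ∀ v, Continuous fun x => fderiv ℝ φ x v := fun v =>
    (h1.continuous_fderiv (by simp)).clm_apply continuous_const
  have hbd : ∀ ψ : EuclideanSpace ℝ (Fin 2) → ℝ, Continuous ψ → HasCompactSupport ψ →
      ∀ f, IntegrableOn f Ω → IntegrableOn (fun x => f x * ψ x) Ω := by
    intro ψ hψ hψc f hf
    obtain ⟨C, hC⟩ := hψc.exists_bound_of_continuous hψ
    exact hf.mul_bdd hψ.aestronglyMeasurable (.of_forall hC)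
  have hc' : ∀ v, HasCompactSupport fun x => fderiv ℝ φ x v := fun v =>
    (h2.fderiv ℝ).mono' (fun x hx => subset_tsupport _ fun h0 => hx (by simp [h0]))
  have hdir : ∀ x, fderiv ℝ φ x t = ∑ k, t k * fderiv ℝ φ x (EuclideanSpace.single k 1) := by
    intro x
    have : t = ∑ k, t k • EuclideanSpace.single k (1 : ℝ) := by
      ext i
      fin_cases i <;> simp
    conv_lhs => rw [this]
    simp
  have hL : ∀ x, inner ℝ p (u x) * fderiv ℝ φ x t =
      ∑ i, ∑ k, p i * t k * (u x i * fderiv ℝ φ x (EuclideanSpace.single k 1)) := by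
    intro x
    rw [hdir, PiLp.inner_apply, Finset.sum_mul_sum]
    refine Finset.sum_congr rfl fun i _ => Finset.sum_congr rfl fun k _ => ?_
    rw [show inner ℝ (p i) (u x i) = p i * u x i by simp [mul_comm]]
    ring
  have hR : ∀ x, matPairing p (Du x) t * φ x = ∑ i, ∑ k, p i * t k * (Du x i k * φ x) := by
    intro x
    rw [matPairing, Finset.sum_mul]
    refine Finset.sum_congr rfl fun i _ => ?_
    rw [Finset.sum_mul]
    exact Finset.sum_congr rfl fun k _ => by ring
  have iL : ∀ i k, IntegrableOn
      (fun x => p i * t k * (u x i * fderiv ℝ φ x (EuclideanSpace.single k 1))) Ω := fun i k =>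
    (hbd _ (hφ' _) (hc' _) _ (h.integrable_apply i)).const_mul _
  have iR : ∀ i k, IntegrableOn (fun x => p i * t k * (Du x i k * φ x)) Ω := fun i k =>
    (hbd _ h1.continuous h2 _ (h.integrable_grad i k)).const_mul _
  simp only [hL, hR]
  rw [integral_finsetSum _ fun i _ => integrable_finsetSum _ fun k _ => iL i k,
    integral_finsetSum _ fun i _ => integrable_finsetSum _ fun k _ => iR i k,
    ← Finset.sum_neg_distrib]
  refine Finset.sum_congr rfl fun i _ => ?_
  rw [integral_finsetSum _ fun k _ => iL i k, integral_finsetSum _ fun k _ => iR i k,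
    ← Finset.sum_neg_distrib]
  refine Finset.sum_congr rfl fun k _ => ?_
  rw [integral_const_mul, integral_const_mul, h.weak_deriv i k φ h1 h2 h3]
  ring

variable {ℓ d : ℝ} {t₁ t₂ : EuclideanSpace ℝ (Fin 2)}
  {T : (ℝ × ℝ) ≃L[ℝ] EuclideanSpace ℝ (Fin 2)}

/-- Weak directional derivatives pull back under linear charts. -/
lemma IsSquareChart.integral_fderiv_mul (hT : IsSquareChart ℓ d t₁ t₂ T)
    {f g : EuclideanSpace ℝ (Fin 2) → ℝ} {v : ℝ × ℝ}
    (hfg : HasWeakDirDeriv (openSquare ℓ) f g (T v)) {w : ℝ × ℝ → ℝ} (h1 : ContDiff ℝ ∞ w)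
    (h2 : HasCompactSupport w) (h3 : tsupport w ⊆ productSquare) :
    ∫ p, f (T p) * fderiv ℝ w p v ∂squareMeasure = -∫ p, g (T p) * w p ∂squareMeasure := by
  set φ : EuclideanSpace ℝ (Fin 2) → ℝ := w ∘ T.symm with hφ
  have hsupp : tsupport φ = T '' tsupport w := by
    have := tsupport_comp_eq_preimage w T.symm.toHomeomorph
    rw [hφ, T.image_eq_preimage_symm]
    exact this
  have hsub : tsupport φ ⊆ T '' productSquare :=
    hsupp ▸ image_mono h3
  have hopen : IsOpen (T '' productSquare) :=
    T.toHomeomorph.isOpenMap _ isOpen_productSquare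
  have key := hfg φ (h1.comp T.symm.contDiff) (h2.comp_homeomorph T.symm.toHomeomorph)
    (hsub.trans hT.image_subset)
  have hQ := measurableSet_openSquare ℓ
  have hres : ∀ H : EuclideanSpace ℝ (Fin 2) → ℝ, (∀ x, x ∉ tsupport φ → H x = 0) →
      ∫ x in openSquare ℓ, H x = d * ∫ p, H (T p) ∂squareMeasure := by
    intro H hH
    rw [hT.integral_comp, mul_inv_cancel_left₀ hT.det_pos.ne']
    exact setIntegral_eq_of_subset_of_forall_sdiff_eq_zero hQ hT.image_subset
      fun x hx => hH x fun h' => hx.2 (hsub h')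
  rw [hres, hres, ← mul_neg] at key
  · have key' := mul_left_cancel₀ hT.det_pos.ne' key
    have hfd : ∀ p, fderiv ℝ φ (T p) (T v) = fderiv ℝ w p v := by
      intro p
      rw [hφ, T.symm.comp_right_fderiv]
      simp
    simp only [hfd] at key'
    simpa only [hφ, Function.comp, T.symm_apply_apply] using key'
  · intro x hx
    rw [image_eq_zero_of_notMem_tsupport hx, mul_zero]
  · intro x hx
    have : fderiv ℝ φ x = 0 := by
      by_contra h0
      exact hx (support_fderiv_subset ℝ h0)
    rw [this]
    simp

lemma intervalTest_prod {η χ : ℝ → ℝ} (hη : IsIntervalTest η) (hχ : IsIntervalTest χ) :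
    ContDiff ℝ ∞ (fun p : ℝ × ℝ => η p.1 * χ p.2) ∧
      HasCompactSupport (fun p : ℝ × ℝ => η p.1 * χ p.2) ∧
      tsupport (fun p : ℝ × ℝ => η p.1 * χ p.2) ⊆ productSquare ∧
      (∀ p, fderiv ℝ (fun p : ℝ × ℝ => η p.1 * χ p.2) p (1, 0) = deriv η p.1 * χ p.2) ∧
      ∀ p, fderiv ℝ (fun p : ℝ × ℝ => η p.1 * χ p.2) p (0, 1) = η p.1 * deriv χ p.2 := by
  have hsub : tsupport (fun p : ℝ × ℝ => η p.1 * χ p.2) ⊆ tsupport η ×ˢ tsupport χ := by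
    refine closure_minimal (fun p hp => ?_) ((isClosed_tsupport _).prod (isClosed_tsupport _))
    exact ⟨subset_tsupport _ (left_ne_zero_of_mul hp), subset_tsupport _ (right_ne_zero_of_mul hp)⟩
  have hd : ∀ p : ℝ × ℝ, HasFDerivAt (fun p : ℝ × ℝ => η p.1 * χ p.2)
      (η p.1 • (deriv χ p.2 • ContinuousLinearMap.snd ℝ ℝ ℝ) +
        χ p.2 • (deriv η p.1 • ContinuousLinearMap.fst ℝ ℝ ℝ)) p := by
    intro p
    have d1 : HasDerivAt η (deriv η p.1) p.1 :=
      (hη.contDiff.differentiable (by simp) p.1).hasDerivAt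
    have d2 : HasDerivAt χ (deriv χ p.2) p.2 :=
      (hχ.contDiff.differentiable (by simp) p.2).hasDerivAt
    exact (d1.comp_hasFDerivAt p hasFDerivAt_fst).mul (d2.comp_hasFDerivAt p hasFDerivAt_snd)
  refine ⟨(hη.contDiff.comp contDiff_fst).mul (hχ.contDiff.comp contDiff_snd),
    (hη.hasCompactSupport.isCompact.prod hχ.hasCompactSupport.isCompact).of_isClosed_subset
      (isClosed_tsupport _) hsub,
    hsub.trans (prod_mono hη.tsupport_subset hχ.tsupport_subset), fun p => ?_, fun p => ?_⟩
  · rw [(hd p).fderiv]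
    simp [mul_comm]
  · rw [(hd p).fderiv]
    simp

/-- The components of a `W^{1,1}` map, read in a linear chart. -/
lemma IsW11WithGradient.hasWeakPartials (h : IsW11WithGradient (openSquare ℓ) u Du)
    (hT : IsSquareChart ℓ d t₁ t₂ T) (p : EuclideanSpace ℝ (Fin N)) :
    HasWeakPartials (fun y => inner ℝ p (u (T y))) (fun y => matPairing p (Du (T y)) t₁)
      (fun y => matPairing p (Du (T y)) t₂) := by
  have hf := hT.integrable_comp (h.integrable_inner p)
  have T1 : T (1, 0) = t₁ := by rw [hT.apply_eq]; simp
  have T2 : T (0, 1) = t₂ := by rw [hT.apply_eq]; simp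
  refine ⟨⟨hf.swap, (hT.integrable_comp (h.integrable_matPairing p t₁)).swap, ?_⟩,
    ⟨hf, hT.integrable_comp (h.integrable_matPairing p t₂), ?_⟩⟩
  · intro η χ hη hχ
    obtain ⟨c1, c2, c3, c4, -⟩ := intervalTest_prod hχ hη
    have key := hT.integral_fderiv_mul (v := (1, 0)) (T1.symm ▸ h.hasWeakDirDeriv p t₁) c1 c2 c3
    simp only [c4, T1] at key
    rw [← integral_prod_swap, ← integral_prod_swap (fun p : ℝ × ℝ => η p.1 * _)]
    simp only [Function.comp, Prod.swap_swap, Prod.fst_swap, Prod.snd_swap]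
    convert key using 3
    · ring
    · exact funext fun _ => by ring
  · intro η χ hη hχ
    obtain ⟨c1, c2, c3, -, c5⟩ := intervalTest_prod hη hχ
    have key := hT.integral_fderiv_mul (v := (0, 1)) (T2.symm ▸ h.hasWeakDirDeriv p t₂) c1 c2 c3
    simp only [c5, T2] at key
    convert key using 3
    · ring
    · exact funext fun _ => by ring

end WeakDerivative

/-! ### Matrices -/

section Matrices

variable {N : ℕ}

lemma matInner_eq (A B : Matrix (Fin N) (Fin 2) ℝ) : matInner A B = ∑ i, ∑ k, A i k * B i k := by
  simp only [matInner, Matrix.trace, Matrix.diag_apply, Matrix.mul_apply, Matrix.transpose_apply]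
  exact Finset.sum_comm

lemma matInner_self_nonneg (A : Matrix (Fin N) (Fin 2) ℝ) : 0 ≤ matInner A A := by
  rw [matInner_eq]
  exact Finset.sum_nonneg fun i _ => Finset.sum_nonneg fun k _ => mul_self_nonneg _

lemma matNorm_nonneg (A : Matrix (Fin N) (Fin 2) ℝ) : 0 ≤ matNorm A := Real.sqrt_nonneg _

lemma matNorm_sq (A : Matrix (Fin N) (Fin 2) ℝ) : matNorm A ^ 2 = matInner A A :=
  Real.sq_sqrt (matInner_self_nonneg A)

lemma matInner_le (A B : Matrix (Fin N) (Fin 2) ℝ) : matInner A B ≤ matNorm A * matNorm B := by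
  have h := Finset.sum_mul_sq_le_sq_mul_sq (Finset.univ : Finset (Fin N × Fin 2))
    (fun x => A x.1 x.2) (fun x => B x.1 x.2)
  simp only [Fintype.sum_prod_type] at h
  refine le_of_sq_le_sq ?_ (mul_nonneg (matNorm_nonneg A) (matNorm_nonneg B))
  rw [mul_pow, matNorm_sq, matNorm_sq, matInner_eq, matInner_eq, matInner_eq]
  simpa only [sq] using h

lemma max_matInner_le {A : Matrix (Fin N) (Fin 2) ℝ} (hA : matNorm A = 1)
    (M : Matrix (Fin N) (Fin 2) ℝ) : max (matInner A M) 0 ≤ matNorm M :=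
  max_le ((matInner_le A M).trans_eq (by rw [hA, one_mul])) (matNorm_nonneg M)

/-- Removing the component along a unit matrix, when positive, does not increase the norm. -/
lemma matNorm_sub_le {A : Matrix (Fin N) (Fin 2) ℝ} (hA : matNorm A = 1)
    (M : Matrix (Fin N) (Fin 2) ℝ) : matNorm (M - max (matInner A M) 0 • A) ≤ matNorm M := by
  refine Real.sqrt_le_sqrt ?_
  set c := max (matInner A M) 0 with hc
  have h1 : matInner A A = 1 := by rw [← matNorm_sq, hA, one_pow]
  have h2 : matInner (M - c • A) (M - c • A) =
      matInner M M - 2 * c * matInner A M + c ^ 2 * matInner A A := by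
    simp only [matInner_eq, Finset.mul_sum, ← Finset.sum_sub_distrib, ← Finset.sum_add_distrib]
    refine Finset.sum_congr rfl fun i _ => Finset.sum_congr rfl fun k _ => ?_
    simp only [Matrix.sub_apply, Matrix.smul_apply, smul_eq_mul]
    ring
  rw [h2, h1]
  rcases le_total (matInner A M) 0 with h | h
  · rw [hc, max_eq_right h]
    simp
  · rw [hc, max_eq_left h]
    nlinarith [sq_nonneg (matInner A M)]

lemma norm_sq_eq_sum {n : ℕ} (p : EuclideanSpace ℝ (Fin n)) : ‖p‖ ^ 2 = ∑ i, p i ^ 2 := by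
  rw [EuclideanSpace.norm_sq_eq]
  simp

lemma abs_apply_le_norm {n : ℕ} (p : EuclideanSpace ℝ (Fin n)) (i : Fin n) : |p i| ≤ ‖p‖ := by
  rw [← Real.norm_eq_abs]
  exact PiLp.norm_apply_le p i

lemma abs_matPairing_le (p : EuclideanSpace ℝ (Fin N)) (M : Matrix (Fin N) (Fin 2) ℝ)
    (t : EuclideanSpace ℝ (Fin 2)) : |matPairing p M t| ≤ ‖p‖ * ‖t‖ * matNorm M := by
  have h := Finset.sum_mul_sq_le_sq_mul_sq (Finset.univ : Finset (Fin N × Fin 2))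
    (fun x => p x.1 * t x.2) (fun x => M x.1 x.2)
  simp only [Fintype.sum_prod_type] at h
  have hs : ∑ i, ∑ k, (p i * t k) ^ 2 = ‖p‖ ^ 2 * ‖t‖ ^ 2 := by
    rw [norm_sq_eq_sum, norm_sq_eq_sum, Finset.sum_mul_sum]
    simp only [mul_pow]
  refine abs_le_of_sq_le_sq ?_ (mul_nonneg (by positivity) (matNorm_nonneg M))
  rw [mul_pow, mul_pow, matNorm_sq, matInner_eq, ← hs]
  simp only [← sq]
  refine le_trans (le_of_eq ?_) h
  rw [matPairing]
  congr 1
  exact Finset.sum_congr rfl fun i _ => Finset.sum_congr rfl fun k _ => by ring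

lemma matPairing_split (p : EuclideanSpace ℝ (Fin N)) (A M : Matrix (Fin N) (Fin 2) ℝ) (c : ℝ)
    (t : EuclideanSpace ℝ (Fin 2)) :
    matPairing p M t = c * matPairing p A t + matPairing p (M - c • A) t := by
  simp only [matPairing, Finset.mul_sum, ← Finset.sum_add_distrib, Matrix.sub_apply,
    Matrix.smul_apply, smul_eq_mul]
  exact Finset.sum_congr rfl fun i _ => Finset.sum_congr rfl fun k _ => by ring

/-- The `k`-th column of a matrix, as a vector of the Euclidean space. -/
noncomputable def matCol (A : Matrix (Fin N) (Fin 2) ℝ) (k : Fin 2) : EuclideanSpace ℝ (Fin N) :=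
  WithLp.toLp 2 fun i => A i k

lemma real_inner_eq_sum {n : ℕ} (p q : EuclideanSpace ℝ (Fin n)) : inner ℝ p q = ∑ i, p i * q i := by
  rw [PiLp.inner_apply]
  exact Finset.sum_congr rfl fun i _ => by simp [mul_comm]

lemma matPairing_eq (p : EuclideanSpace ℝ (Fin N)) (A : Matrix (Fin N) (Fin 2) ℝ)
    (t : EuclideanSpace ℝ (Fin 2)) :
    matPairing p A t = t 0 * inner ℝ p (matCol A 0) + t 1 * inner ℝ p (matCol A 1) := by
  simp only [matPairing, real_inner_eq_sum, Finset.mul_sum, ← Finset.sum_add_distrib,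
    Fin.sum_univ_two, matCol]
  exact Finset.sum_congr rfl fun i _ => by ring

lemma norm_matCol_sq_add (A : Matrix (Fin N) (Fin 2) ℝ) :
    ‖matCol A 0‖ ^ 2 + ‖matCol A 1‖ ^ 2 = matNorm A ^ 2 := by
  rw [matNorm_sq, matInner_eq, norm_sq_eq_sum, norm_sq_eq_sum, ← Finset.sum_add_distrib]
  simp only [Fin.sum_univ_two, matCol, sq]

/-- An orthogonal decomposition `A e_{j₁} = t A e_{j₀} + r` of the smaller column of a unit matrix
along the larger one; the norm `σ = |r|` is comparable to the smaller singular value. -/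
structure IsAdaptedFrame (A : Matrix (Fin N) (Fin 2) ℝ) (j₀ j₁ : Fin 2) (t σ : ℝ) : Prop where
  ne : j₀ ≠ j₁
  abs_le : |t| ≤ 1
  inner_eq_zero : inner ℝ (matCol A j₀) (matCol A j₁ - t • matCol A j₀) = 0
  norm_eq : ‖matCol A j₁ - t • matCol A j₀‖ = σ
  half_le : 1 / 2 ≤ ‖matCol A j₀‖
  le_one : ‖matCol A j₀‖ ≤ 1
  sigma_le : σ ≤ 1

lemma exists_isAdaptedFrame {A : Matrix (Fin N) (Fin 2) ℝ} (hA : matNorm A = 1) :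
    ∃ j₀ j₁ t σ, IsAdaptedFrame A j₀ j₁ t σ := by
  have hsum := norm_matCol_sq_add A
  rw [hA, one_pow] at hsum
  have main : ∀ j₀ j₁ : Fin 2, j₀ ≠ j₁ → ‖matCol A j₀‖ ^ 2 + ‖matCol A j₁‖ ^ 2 = 1 →
      ‖matCol A j₁‖ ≤ ‖matCol A j₀‖ → ∃ j₀ j₁ t σ, IsAdaptedFrame A j₀ j₁ t σ := by
    intro j₀ j₁ hj hs hle
    set α := matCol A j₀
    set β := matCol A j₁
    have hα0 := norm_nonneg α
    have hβ0 := norm_nonneg β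
    have hhalf : 1 / 2 ≤ ‖α‖ := by nlinarith
    have hαpos : 0 < ‖α‖ := by linarith
    have hinner : inner ℝ α (β - (inner ℝ α β / ‖α‖ ^ 2) • α) = 0 := by
      rw [inner_sub_right, real_inner_smul_right, real_inner_self_eq_norm_sq,
        div_mul_cancel₀ _ (by positivity), sub_self]
    refine ⟨j₀, j₁, inner ℝ α β / ‖α‖ ^ 2, _, hj, ?_, hinner, rfl, hhalf, by nlinarith, ?_⟩
    · rw [abs_div, abs_of_pos (pow_pos hαpos 2), div_le_one (by positivity)]
      refine (abs_real_inner_le_norm α β).trans ?_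
      rw [sq]
      gcongr
    · set r := β - (inner ℝ α β / ‖α‖ ^ 2) • α with hr
      set s := inner ℝ α β / ‖α‖ ^ 2
      have hβ : ‖β‖ ^ 2 = ‖s • α‖ ^ 2 + ‖r‖ ^ 2 := by
        have : β = s • α + r := by rw [hr]; abel
        conv_lhs => rw [this]
        rw [norm_add_sq_real, real_inner_smul_left, hinner]
        ring
      have := norm_nonneg r
      nlinarith [sq_nonneg ‖s • α‖]
  rcases le_total ‖matCol A 1‖ ‖matCol A 0‖ with h | h
  · exact main 0 1 (by decide) hsum h
  · exact main 1 0 (by decide) (by linarith) h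

/-- Dual vectors to the columns of a matrix of rank two. -/
lemma IsAdaptedFrame.exists_dual {A : Matrix (Fin N) (Fin 2) ℝ} {j₀ j₁ : Fin 2} {t σ : ℝ}
    (h : IsAdaptedFrame A j₀ j₁ t σ) (hσ : 0 < σ) :
    ∃ P : Fin 2 → EuclideanSpace ℝ (Fin N), (∀ k, ‖P k‖ ≤ 3 / σ) ∧
      ∀ k l, inner ℝ (P k) (matCol A l) = if k = l then 1 else 0 := by
  set α := matCol A j₀ with hα
  set β := matCol A j₁ with hβ
  set r := β - t • α with hr
  have hαpos : 0 < ‖α‖ := by linarith [h.half_le]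
  have hrσ : ‖r‖ = σ := h.norm_eq
  have hαr : inner ℝ α r = 0 := h.inner_eq_zero
  have hrα : inner ℝ r α = 0 := by rw [real_inner_comm]; exact hαr
  have hβe : β = t • α + r := by rw [hr]; abel
  have hrβ : inner ℝ r β = σ ^ 2 := by
    rw [hβe, inner_add_right, real_inner_smul_right, hrα, real_inner_self_eq_norm_sq, hrσ]
    ring
  have hαβ : inner ℝ α β = t * ‖α‖ ^ 2 := by
    rw [hβe, inner_add_right, real_inner_smul_right, hαr, real_inner_self_eq_norm_sq]
    ring
  set b := (σ ^ 2)⁻¹ • r with hb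
  set a := (‖α‖ ^ 2)⁻¹ • α - t • b with ha
  have hbα : inner ℝ b α = 0 := by rw [hb, real_inner_smul_left, hrα, mul_zero]
  have hbβ : inner ℝ b β = 1 := by
    rw [hb, real_inner_smul_left, hrβ, inv_mul_cancel₀ (by positivity)]
  have haα : inner ℝ a α = 1 := by
    rw [ha, inner_sub_left, real_inner_smul_left, real_inner_smul_left, hbα,
      real_inner_self_eq_norm_sq, inv_mul_cancel₀ (by positivity)]
    ring
  have haβ : inner ℝ a β = 0 := by
    rw [ha, inner_sub_left, real_inner_smul_left, real_inner_smul_left, hbβ, hαβ, mul_comm t,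
      inv_mul_cancel_left₀ (by positivity)]
    ring
  have hbn : ‖b‖ = 1 / σ := by
    rw [hb, norm_smul, hrσ, norm_inv, norm_pow, Real.norm_of_nonneg hσ.le]
    field_simp
  have han : ‖a‖ ≤ 3 / σ := by
    have h1 : ‖(‖α‖ ^ 2)⁻¹ • α‖ ≤ 2 := by
      rw [norm_smul, norm_inv, norm_pow, norm_norm, sq, mul_inv, mul_assoc,
        inv_mul_cancel₀ hαpos.ne', mul_one]
      rw [inv_le_comm₀ hαpos (by norm_num)]
      linarith [h.half_le]
    have h2 : ‖t • b‖ ≤ 1 / σ := by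
      rw [norm_smul, hbn]
      exact mul_le_of_le_one_left (by positivity) h.abs_le
    have h3 : 2 ≤ 2 / σ := by
      rw [le_div_iff₀ hσ]
      linarith [h.sigma_le]
    calc ‖a‖ ≤ 2 + 1 / σ := (norm_sub_le _ _).trans (add_le_add h1 h2)
      _ ≤ 2 / σ + 1 / σ := by gcongr
      _ = 3 / σ := by ring
  have hbn' : ‖b‖ ≤ 3 / σ := by rw [hbn]; gcongr; norm_num
  have hj := h.ne
  have hcases : ∀ l, l = j₀ ∨ l = j₁ := by omega
  refine ⟨fun k => if k = j₀ then a else b, fun k => ?_, fun k l => ?_⟩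
  · simp only
    split_ifs
    · exact han
    · exact hbn'
  · rcases hcases k with rfl | rfl <;> rcases hcases l with rfl | rfl
    · simpa using haα
    · simpa [hj] using haβ
    · simpa [hj.symm] using hbα
    · simpa [hj.symm] using hbβ

end Matrices

/-! ### Norms of the gradient in a chart -/

section ChartNorms

variable {N : ℕ} {ℓ d : ℝ} {t₁ t₂ : EuclideanSpace ℝ (Fin 2)}
  {T : (ℝ × ℝ) ≃L[ℝ] EuclideanSpace ℝ (Fin 2)} {Ω : Set (EuclideanSpace ℝ (Fin 2))}
  {u : EuclideanSpace ℝ (Fin 2) → EuclideanSpace ℝ (Fin N)}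
  {Du M : EuclideanSpace ℝ (Fin 2) → Matrix (Fin N) (Fin 2) ℝ} {A : Matrix (Fin N) (Fin 2) ℝ}

lemma integrableOn_matNorm (hM : ∀ i k, IntegrableOn (fun x => M x i k) Ω) :
    IntegrableOn (fun x => matNorm (M x)) Ω := by
  have hs : IntegrableOn (fun x => ∑ i, ∑ k, |M x i k|) Ω :=
    integrable_finsetSum _ fun i _ => integrable_finsetSum _ fun k _ => (hM i k).abs
  refine Integrable.mono' hs ?_ (.of_forall fun x => ?_)
  · simp only [matNorm, matInner_eq]
    refine Real.continuous_sqrt.comp_aestronglyMeasurable ?_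
    refine Finset.aestronglyMeasurable_fun_sum _ fun i _ =>
      Finset.aestronglyMeasurable_fun_sum _ fun k _ => ?_
    exact (hM i k).aestronglyMeasurable.mul (hM i k).aestronglyMeasurable
  · rw [Real.norm_of_nonneg (matNorm_nonneg _), matNorm, matInner_eq]
    have h0 : 0 ≤ ∑ i, ∑ k, |M x i k| :=
      Finset.sum_nonneg fun i _ => Finset.sum_nonneg fun k _ => abs_nonneg _
    refine Real.sqrt_le_iff.2 ⟨h0, ?_⟩
    have := Finset.sum_sq_le_sq_sum_of_nonneg (s := (Finset.univ : Finset (Fin N × Fin 2)))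
      (f := fun x' => |M x x'.1 x'.2|) fun i _ => abs_nonneg _
    simp only [Fintype.sum_prod_type, sq_abs] at this
    simpa only [sq] using this

lemma integrableOn_max_matInner (hM : ∀ i k, IntegrableOn (fun x => M x i k) Ω) :
    IntegrableOn (fun x => max (matInner A (M x)) 0) Ω := by
  have : IntegrableOn (fun x => matInner A (M x)) Ω := by
    simp only [matInner_eq]
    exact integrable_finsetSum _ fun i _ => integrable_finsetSum _ fun k _ => (hM i k).const_mul _
  exact this.pos_part

lemma integrableOn_sub_smul (hM : ∀ i k, IntegrableOn (fun x => M x i k) Ω) (i : Fin N) (k : Fin 2) :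
    IntegrableOn (fun x => (M x - max (matInner A (M x)) 0 • A) i k) Ω := by
  simp only [Matrix.sub_apply, Matrix.smul_apply, smul_eq_mul]
  exact (hM i k).sub ((integrableOn_max_matInner hM).mul_const _)

lemma etaTwo_nonneg (hℓ : 0 < ℓ) (Du : EuclideanSpace ℝ (Fin 2) → Matrix (Fin N) (Fin 2) ℝ) :
    0 ≤ etaTwo ℓ Du :=
  mul_nonneg (by positivity) (integral_nonneg fun _ => matNorm_nonneg _)

lemma etaThree_eq_etaTwo (A : Matrix (Fin N) (Fin 2) ℝ) (ℓ : ℝ)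
    (Du : EuclideanSpace ℝ (Fin 2) → Matrix (Fin N) (Fin 2) ℝ) :
    etaThree ℓ A Du = etaTwo ℓ fun x => Du x - max (matInner A (Du x)) 0 • A := rfl

lemma etaThree_le_etaTwo (hℓ : 0 < ℓ) (hA : matNorm A = 1)
    (hM : ∀ i k, IntegrableOn (fun x => Du x i k) (openSquare ℓ)) :
    etaThree ℓ A Du ≤ etaTwo ℓ Du := by
  refine mul_le_mul_of_nonneg_left ?_ (by positivity)
  exact integral_mono (integrableOn_matNorm (integrableOn_sub_smul hM)) (integrableOn_matNorm hM)
    fun x => matNorm_sub_le hA _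

/-- The `L¹` norm of the pullback, under a chart of scale at least `ℓ / 2`, of a function bounded by
the norm of a matrix field. -/
lemma IsSquareChart.squareL1_le (hT : IsSquareChart ℓ d t₁ t₂ T) (hℓ : 0 < ℓ)
    (hd : ℓ ^ 2 / 4 ≤ d) {f : EuclideanSpace ℝ (Fin 2) → ℝ}
    (hM : ∀ i k, IntegrableOn (fun x => M x i k) (openSquare ℓ)) {c : ℝ} (hc : 0 ≤ c)
    (hf : ∀ x, |f x| ≤ c * ℓ * matNorm (M x))
    (hfi : IntegrableOn f (openSquare ℓ)) :
    squareL1 (fun y => f (T y)) ≤ 4 * c * etaTwo ℓ M := by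
  have hMi := integrableOn_matNorm hM
  have h1 : squareL1 (fun y => f (T y)) ≤
      ∫ y, c * ℓ * matNorm (M (T y)) ∂squareMeasure :=
    integral_mono (hT.integrable_comp hfi).abs ((hT.integrable_comp hMi).const_mul _)
      fun y => hf _
  refine h1.trans ?_
  rw [integral_const_mul]
  have h2 := hT.integral_comp_le hMi fun x => matNorm_nonneg _
  have hI : 0 ≤ ∫ x in openSquare ℓ, matNorm (M x) := integral_nonneg fun _ => matNorm_nonneg _
  have hdinv : d⁻¹ ≤ 4 / ℓ ^ 2 := by
    rw [show 4 / ℓ ^ 2 = (ℓ ^ 2 / 4)⁻¹ by rw [inv_div]]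
    exact inv_anti₀ (by positivity) hd
  calc c * ℓ * ∫ y, matNorm (M (T y)) ∂squareMeasure
      ≤ c * ℓ * (4 / ℓ ^ 2 * ∫ x in openSquare ℓ, matNorm (M x)) := by
        gcongr
        exact h2.trans (by gcongr)
    _ = 4 * c * etaTwo ℓ M := by
        rw [etaTwo]
        field_simp

lemma IsSquareChart.squareL1_matPairing_le (hT : IsSquareChart ℓ d t₁ t₂ T) (hℓ : 0 < ℓ)
    (hd : ℓ ^ 2 / 4 ≤ d) (hM : ∀ i k, IntegrableOn (fun x => M x i k) (openSquare ℓ))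
    {p : EuclideanSpace ℝ (Fin N)} {t : EuclideanSpace ℝ (Fin 2)} {c : ℝ} (hp : ‖p‖ ≤ c)
    (ht : ‖t‖ ≤ ℓ) :
    squareL1 (fun y => matPairing p (M (T y)) t) ≤ 4 * c * etaTwo ℓ M := by
  have hc : 0 ≤ c := (norm_nonneg p).trans hp
  refine hT.squareL1_le (f := fun x => matPairing p (M x) t) hℓ hd hM hc (fun x => ?_) ?_
  · refine (abs_matPairing_le _ _ _).trans ?_
    have := matNorm_nonneg (M x)
    gcongr
  · exact integrable_finsetSum _ fun i _ => integrable_finsetSum _ fun k _ =>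
      ((hM i k).const_mul _).mul_const _

lemma eLpNorm_le_sum_apply {α : Type*} [MeasurableSpace α] {μ : Measure α}
    {v : α → EuclideanSpace ℝ (Fin N)} (hv : ∀ i, AEStronglyMeasurable (fun x => v x i) μ) :
    eLpNorm v 2 μ ≤ ∑ i, eLpNorm (fun x => v x i) 2 μ := by
  have e : v = ∑ i, fun x => v x i • EuclideanSpace.single i (1 : ℝ) := by
    ext x j
    simp [Finset.sum_apply, Pi.single_apply]
  conv_lhs => rw [e]
  refine (eLpNorm_sum_le (fun i _ => (hv i).smul aestronglyMeasurable_const) (by norm_num)).trans ?_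
  refine Finset.sum_le_sum fun i _ => (eLpNorm_congr_norm_ae (.of_forall fun x => ?_)).le
  simp [norm_smul]

end ChartNorms

/-! ### Approximation by one-dimensional monotone maps -/

section OneDimensional

variable {N : ℕ} {ℓ t σ : ℝ} {j₀ j₁ : Fin 2} {A : Matrix (Fin N) (Fin 2) ℝ}
  {u : EuclideanSpace ℝ (Fin 2) → EuclideanSpace ℝ (Fin N)}
  {Du : EuclideanSpace ℝ (Fin 2) → Matrix (Fin N) (Fin 2) ℝ}

/-- A shear maps the square `(-1, 1)²` to a parallelogram between `(-ℓ/4, ℓ/4)²` and `(-ℓ, ℓ)²`, one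
side of which is parallel to the kernel of the rank-one part of a matrix with an adapted frame. -/
lemma exists_shear_chart (hj : j₀ ≠ j₁) (ht : |t| ≤ 1) (hℓ : 0 < ℓ) :
    ∃ T t₁ t₂, IsSquareChart ℓ (ℓ ^ 2 / 4) t₁ t₂ T ∧ ‖t₁‖ ≤ ℓ ∧ ‖t₂‖ ≤ ℓ ∧
      openSquare (ℓ / 4) ⊆ T '' productSquare ∧
      (∀ x, (T.symm x).1 = 2 / ℓ * (x j₀ + t * x j₁)) ∧
      ∀ {N : ℕ} (p : EuclideanSpace ℝ (Fin N)) (A : Matrix (Fin N) (Fin 2) ℝ),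
        matPairing p A t₁ = ℓ / 2 * inner ℝ p (matCol A j₀) ∧
        matPairing p A t₂ = ℓ / 2 * inner ℝ p (matCol A j₁ - t • matCol A j₀) := by
  set t₁ : EuclideanSpace ℝ (Fin 2) := (ℓ / 2) • EuclideanSpace.single j₀ 1 with ht₁
  set t₂ : EuclideanSpace ℝ (Fin 2) :=
    (ℓ / 2) • (EuclideanSpace.single j₁ 1 - t • EuclideanSpace.single j₀ 1) with ht₂
  have e10 : t₁ j₀ = ℓ / 2 := by simp [ht₁]
  have e11 : t₁ j₁ = 0 := by simp [ht₁, hj]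
  have e20 : t₂ j₀ = -(ℓ / 2 * t) := by simp [ht₂, hj]
  have e21 : t₂ j₁ = ℓ / 2 := by simp [ht₂, hj.symm]
  have hcases : (j₀ = 0 ∧ j₁ = 1) ∨ (j₀ = 1 ∧ j₁ = 0) := by omega
  have hdet : |t₁ 0 * t₂ 1 - t₁ 1 * t₂ 0| = ℓ ^ 2 / 4 := by
    rcases hcases with ⟨rfl, rfl⟩ | ⟨rfl, rfl⟩
    · rw [e10, e11, e21, show ℓ / 2 * (ℓ / 2) - 0 * t₂ 0 = ℓ ^ 2 / 4 by ring,
        abs_of_pos (by positivity)]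
    · rw [e10, e11, e21, show 0 * t₂ 1 - ℓ / 2 * (ℓ / 2) = -(ℓ ^ 2 / 4) by ring, abs_neg,
        abs_of_pos (by positivity)]
  obtain ⟨T, hT, hmap⟩ := exists_linear_chart t₁ t₂ hdet (by positivity)
  have hT0 : ∀ p, T p j₀ = ℓ / 2 * (p.1 - t * p.2) := fun p => by
    rw [hT]; simp only [PiLp.add_apply, PiLp.smul_apply, smul_eq_mul, e10, e20]; ring
  have hT1 : ∀ p, T p j₁ = ℓ / 2 * p.2 := fun p => by
    rw [hT]; simp only [PiLp.add_apply, PiLp.smul_apply, smul_eq_mul, e11, e21]; ring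
  have hall : ∀ i, i = j₀ ∨ i = j₁ := by omega
  have hs1 : ∀ x, (T.symm x).1 = 2 / ℓ * (x j₀ + t * x j₁) := by
    intro x
    have h0 := hT0 (T.symm x)
    have h1 := hT1 (T.symm x)
    rw [T.apply_symm_apply] at h0 h1
    rw [h0, h1]
    field_simp
    ring
  have hs2 : ∀ x, (T.symm x).2 = 2 / ℓ * x j₁ := by
    intro x
    have h1 := hT1 (T.symm x)
    rw [T.apply_symm_apply] at h1
    rw [h1]
    field_simp
  have hn : ∀ j : Fin 2, ‖(ℓ / 2) • (EuclideanSpace.single j (1 : ℝ))‖ = ℓ / 2 := fun j => by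
    rw [norm_smul, PiLp.norm_single, Real.norm_of_nonneg (by positivity)]
    simp
  refine ⟨T, t₁, t₂, ⟨hT, by positivity, hmap, ?_⟩, ?_, ?_, ?_, hs1, ?_⟩
  · rintro p ⟨h1, h2⟩ i
    have ht' := abs_le.1 ht
    have htp : |t * p.2| ≤ 1 := by
      rw [abs_mul]
      exact mul_le_one₀ ht (abs_nonneg _) (abs_le.2 ⟨h2.1.le, h2.2.le⟩)
    rw [abs_le] at htp
    rcases hall i with rfl | rfl
    · rw [hT0]
      constructor <;> nlinarith [h1.1, h1.2]
    · rw [hT1]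
      constructor <;> nlinarith [h2.1, h2.2]
  · rw [ht₁, hn]; linarith
  · rw [ht₂, smul_sub, smul_comm _ t]
    refine (norm_sub_le _ _).trans ?_
    rw [norm_smul t, hn, hn, Real.norm_eq_abs]
    nlinarith
  · intro x hx
    refine ⟨T.symm x, ?_, T.apply_symm_apply x⟩
    have h0 := hx j₀
    have h1 := hx j₁
    have htx : |t * x j₁| ≤ ℓ / 4 := by
      rw [abs_mul]
      calc |t| * |x j₁| ≤ 1 * (ℓ / 4) :=
            mul_le_mul ht (abs_le.2 ⟨h1.1.le, h1.2.le⟩) (abs_nonneg _) zero_le_one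
        _ = ℓ / 4 := one_mul _
    rw [abs_le] at htx
    have hgen : ∀ a : ℝ, -(ℓ / 2) < a → a < ℓ / 2 → 2 / ℓ * a ∈ Ioo (-1 : ℝ) 1 := by
      intro a h h'
      rw [div_mul_eq_mul_div, mem_Ioo, lt_div_iff₀ hℓ, div_lt_iff₀ hℓ]
      constructor <;> linarith
    refine ⟨?_, ?_⟩
    · rw [hs1]
      exact hgen _ (by linarith [h0.1]) (by linarith [h0.2])
    · rw [hs2]
      exact hgen _ (by linarith [h1.1]) (by linarith [h1.2])
  · intro N p A
    rw [matPairing_eq, matPairing_eq, inner_sub_right, real_inner_smul_right]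
    rcases hcases with ⟨rfl, rfl⟩ | ⟨rfl, rfl⟩ <;>
    · rw [e10, e11, e20, e21]
      constructor <;> ring

/-- The rank-one part of `A` yields a one-dimensional monotone map; the error comes from the
component of `A` across it, of size `σ`, and from the part of `Du` that is not a nonnegative
multiple of `A`. -/
lemma exists_oneDimensional_approx (N : ℕ) : ∃ C : ℝ, 0 < C ∧
    ∀ (ℓ : ℝ) (j₀ j₁ : Fin 2) (t σ : ℝ) (A : Matrix (Fin N) (Fin 2) ℝ)
      (u : EuclideanSpace ℝ (Fin 2) → EuclideanSpace ℝ (Fin N))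
      (Du : EuclideanSpace ℝ (Fin 2) → Matrix (Fin N) (Fin 2) ℝ), 0 < ℓ → matNorm A = 1 →
      IsAdaptedFrame A j₀ j₁ t σ → IsW11WithGradient (openSquare ℓ) u Du →
      ∃ (a b : EuclideanSpace ℝ (Fin N)) (ν : EuclideanSpace ℝ (Fin 2)) (lam : ℝ → ℝ),
        ‖ν‖ = 1 ∧ Monotone lam ∧ IsW11LocWithIntegrableDeriv lam ∧
        eLpNorm (fun x => u x - (lam (inner ℝ x ν) • a + b)) 2
          (volume.restrict (openSquare (ℓ / 4))) ≤
          ENNReal.ofReal (C * (σ * etaTwo ℓ Du + etaThree ℓ A Du +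
            √(etaTwo ℓ Du * etaThree ℓ A Du)) * ℓ) ∧
        eLpNorm (fun s : ℝ => lam s • a) ⊤ volume ≤ ENNReal.ofReal (C * etaTwo ℓ Du) := by
  have hB := one_le_weightBound
  set B := weightBound with hBdef
  refine ⟨(N + 1) * (96 * B), by positivity, ?_⟩
  intro ℓ j₀ j₁ t σ A u Du hℓ hA hfr hu
  obtain ⟨T, t₁, t₂, hT, ht₁, ht₂, hq, hsymm, hpair⟩ := exists_shear_chart hfr.ne hfr.abs_le hℓ
  have hdd : ℓ ^ 2 / 4 ≤ ℓ ^ 2 / 4 := le_rfl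
  set η₂ := etaTwo ℓ Du with hη₂
  set η₃ := etaThree ℓ A Du with hη₃
  set E : EuclideanSpace ℝ (Fin 2) → Matrix (Fin N) (Fin 2) ℝ :=
    fun x => Du x - max (matInner A (Du x)) 0 • A with hE
  have hη₃' : etaTwo ℓ E = η₃ := rfl
  have hη20 : 0 ≤ η₂ := etaTwo_nonneg hℓ _
  have hη30 : 0 ≤ η₃ := etaTwo_nonneg hℓ E
  have hη32 : η₃ ≤ η₂ := etaThree_le_etaTwo hℓ hA hu.integrable_grad
  have hgrad := hu.integrable_grad
  have hEi : ∀ i k, IntegrableOn (fun x => E x i k) (openSquare ℓ) := integrableOn_sub_smul hgrad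
  have hσ : 0 ≤ σ := hfr.norm_eq ▸ norm_nonneg _
  set α := matCol A j₀ with hα
  set r := matCol A j₁ - t • α with hr
  have hαpos : 0 < ‖α‖ := by linarith [hfr.half_le]
  set a : EuclideanSpace ℝ (Fin N) := ‖α‖⁻¹ • α with ha
  have han : ‖a‖ = 1 := by
    rw [ha, norm_smul, norm_inv, norm_norm, inv_mul_cancel₀ hαpos.ne']
  have haα : inner ℝ a α = ‖α‖ := by
    rw [ha, real_inner_smul_left, real_inner_self_eq_norm_sq, sq, inv_mul_cancel_left₀ hαpos.ne']
  have har : inner ℝ a r = 0 := by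
    rw [ha, real_inner_smul_left, hfr.inner_eq_zero, mul_zero]
  -- The density of `A` in the derivative of `a · u`, in the chart.
  set μ : EuclideanSpace ℝ (Fin 2) → ℝ := fun x => max (matInner A (Du x)) 0 with hμ
  have hμi : IntegrableOn μ (openSquare ℓ) := integrableOn_max_matInner hgrad
  have hμ0 : ∀ x, 0 ≤ μ x := fun x => le_max_right _ _
  set m : ℝ × ℝ → ℝ := fun y => ℓ / 2 * ‖α‖ * μ (T y) with hm
  have hmi : Integrable m squareMeasure := (hT.integrable_comp hμi).const_mul _
  have hm0 : ∀ y, 0 ≤ m y := fun y => by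
    have := hμ0 (T y)
    positivity
  have hmL : squareL1 m ≤ 4 * 1 * η₂ := by
    refine hT.squareL1_le (f := fun x => ℓ / 2 * ‖α‖ * μ x) hℓ hdd hgrad zero_le_one
      (fun x => ?_) (hμi.const_mul _)
    have h1 := max_matInner_le hA (Du x)
    have h2 := hμ0 x
    rw [abs_of_nonneg (by positivity)]
    have : ℓ / 2 * ‖α‖ ≤ 1 * ℓ := by nlinarith [hfr.le_one]
    exact mul_le_mul this h1 h2 (by positivity)
  have hEbound : ∀ (p : EuclideanSpace ℝ (Fin N)) (c : ℝ), ‖p‖ ≤ c → ∀ s, ‖s‖ ≤ ℓ →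
      squareL1 (fun y => matPairing p (E (T y)) s) ≤ 4 * c * η₃ := fun p c hp s hs =>
    hT.squareL1_matPairing_le hℓ hdd hEi hp hs
  have hEint : ∀ (p : EuclideanSpace ℝ (Fin N)) s,
      Integrable (fun y => matPairing p (E (T y)) s) squareMeasure := fun p s =>
    hT.integrable_comp (f := fun x => matPairing p (E x) s)
      (integrable_finsetSum _ fun i _ => integrable_finsetSum _ fun k _ =>
        ((hEi i k).const_mul _).mul_const _)
  have split₁ : ∀ p : EuclideanSpace ℝ (Fin N), (fun y => matPairing p (Du (T y)) t₁) =
      fun y => ℓ / 2 * inner ℝ p α * μ (T y) + matPairing p (E (T y)) t₁ := fun p => by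
    funext y
    rw [matPairing_split p A (Du (T y)) (μ (T y)), (hpair p A).1]
    ring
  have split₂ : ∀ p : EuclideanSpace ℝ (Fin N), (fun y => matPairing p (Du (T y)) t₂) =
      fun y => ℓ / 2 * inner ℝ p r * μ (T y) + matPairing p (E (T y)) t₂ := fun p => by
    funext y
    rw [matPairing_split p A (Du (T y)) (μ (T y)), (hpair p A).2]
    ring
  -- The component along `a` is close to the profile of `m`.
  have hU := hu.hasWeakPartials hT a
  have hU1 : squareL1 (fun y => matPairing a (Du (T y)) t₁) ≤ 4 * 1 * η₂ :=
    hT.squareL1_matPairing_le hℓ hdd hgrad han.le ht₁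
  have hU2 : squareL1 (fun y => matPairing a (Du (T y)) t₂) ≤ 4 * 1 * η₃ := by
    rw [split₂, har]
    simpa using hEbound a 1 han.le t₂ ht₂
  have hU' : HasWeakPartials (fun y => inner ℝ a (u (T y)))
      (fun y => m y + matPairing a (E (T y)) t₁) (fun y => matPairing a (Du (T y)) t₂) := by
    have := hU
    rw [split₁, haα] at this
    exact this
  obtain ⟨b₀, hb₀⟩ := hU'.exists_ae_abs_avgSnd_sub_profile_le hmi (hEint a t₁)
  have hprof : Monotone (profile m) := profile_mono hmi hm0
  have hUest : eLpNorm (fun y : ℝ × ℝ => inner ℝ a (u (T y)) - (profile m y.1 + b₀)) 2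
      squareMeasure ≤ ENNReal.ofReal (96 * B * √(η₂ * η₃) + 8 * B * η₃) := by
    refine (hU.eLpNorm_sub_le (φ := fun x => profile m x + b₀)
      (hprof.measurable.add_const b₀).aestronglyMeasurable ?_ hb₀).trans
      (ENNReal.ofReal_le_ofReal ?_)
    · exact mul_nonneg weightBound_pos.le (squareL1_nonneg _)
    · have n1 := squareL1_nonneg (fun y => matPairing a (Du (T y)) t₁)
      have n2 := squareL1_nonneg (fun y => matPairing a (Du (T y)) t₂)
      have s1 : √(3 * B * squareL1 (fun y => matPairing a (Du (T y)) t₂) *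
          (squareL1 (fun y => matPairing a (Du (T y)) t₁) +
            squareL1 (fun y => matPairing a (Du (T y)) t₂))) ≤ 96 * B * √(η₂ * η₃) := by
        have hle : 3 * B * squareL1 (fun y => matPairing a (Du (T y)) t₂) *
            (squareL1 (fun y => matPairing a (Du (T y)) t₁) +
              squareL1 (fun y => matPairing a (Du (T y)) t₂)) ≤
            3 * B * (4 * 1 * η₃) * (4 * 1 * η₂ + 4 * 1 * η₂) := by
          gcongr
          exact hU2.trans (by gcongr)
        refine Real.sqrt_le_iff.2 ⟨by positivity, hle.trans ?_⟩
        rw [mul_pow, Real.sq_sqrt (by positivity)]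
        have : 0 ≤ η₂ * η₃ := by positivity
        nlinarith [mul_le_mul_of_nonneg_right (show 96 * B ≤ (96 * B) ^ 2 by nlinarith) this]
      have s2 := hEbound a 1 han.le t₁ ht₁
      have s3 : 2 * (B * squareL1 (fun y => matPairing a (E (T y)) t₁)) ≤ 8 * B * η₃ := by
        calc 2 * (B * squareL1 (fun y => matPairing a (E (T y)) t₁)) ≤ 2 * (B * (4 * 1 * η₃)) := by
              gcongr
          _ = 8 * B * η₃ := by ring
      exact add_le_add s1 s3
  -- The components across `a` are nearly constant.
  set P : Fin N → EuclideanSpace ℝ (Fin N) := fun i => EuclideanSpace.single i 1 - a i • a with hP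
  have hai : ∀ i, |a i| ≤ 1 := fun i => (abs_apply_le_norm a i).trans han.le
  have hPn : ∀ i, ‖P i‖ ≤ 2 := fun i => by
    refine (norm_sub_le _ _).trans ?_
    rw [norm_smul, han, PiLp.norm_single, norm_one, Real.norm_eq_abs]
    linarith [hai i]
  have hPv : ∀ i v, inner ℝ (P i) v = v i - a i * inner ℝ a v := fun i v => by
    rw [hP, inner_sub_left, real_inner_smul_left, EuclideanSpace.inner_single_left]
    simp
  have hPα : ∀ i, inner ℝ (P i) α = 0 := fun i => by
    rw [hPv, haα, ha]
    simp only [PiLp.smul_apply, smul_eq_mul]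
    field_simp
    ring
  have hPr : ∀ i, inner ℝ (P i) r = r i := fun i => by rw [hPv, har, mul_zero, sub_zero]
  have hWest : ∀ i, eLpNorm (fun y : ℝ × ℝ => inner ℝ (P i) (u (T y)) -
      weightedMean fun y => inner ℝ (P i) (u (T y))) 2 squareMeasure ≤
      ENNReal.ofReal (5 * B * (4 * σ * η₂ + 16 * η₃)) := by
    intro i
    refine (hu.hasWeakPartials hT (P i)).eLpNorm_sub_weightedMean_le.trans
      (ENNReal.ofReal_le_ofReal ?_)
    have w1 : squareL1 (fun y => matPairing (P i) (Du (T y)) t₁) ≤ 4 * 2 * η₃ := by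
      rw [split₁, hPα]
      simpa using hEbound (P i) 2 (hPn i) t₁ ht₁
    have w2 : squareL1 (fun y => matPairing (P i) (Du (T y)) t₂) ≤ 4 * σ * η₂ + 4 * 2 * η₃ := by
      rw [split₂, hPr]
      refine (squareL1_add_le ((hT.integrable_comp hμi).const_mul _) (hEint (P i) t₂)).trans
        (add_le_add ?_ (hEbound (P i) 2 (hPn i) t₂ ht₂))
      refine hT.squareL1_le (f := fun x => ℓ / 2 * r i * μ x) hℓ hdd hgrad hσ
        (fun x => ?_) (hμi.const_mul _)
      have h1 := max_matInner_le hA (Du x)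
      have h3 : |r i| ≤ σ := (abs_apply_le_norm r i).trans hfr.norm_eq.le
      rw [abs_mul, abs_mul, abs_of_nonneg (hμ0 x), abs_of_pos (by positivity : 0 < ℓ / 2)]
      have : ℓ / 2 * |r i| ≤ σ * ℓ := by nlinarith [abs_nonneg (r i)]
      exact mul_le_mul this h1 (hμ0 x) (by positivity)
    exact mul_le_mul_of_nonneg_left (by linarith) (by positivity)
  -- The direction of the one-dimensional map.
  set w : EuclideanSpace ℝ (Fin 2) :=
    EuclideanSpace.single j₀ 1 + t • EuclideanSpace.single j₁ 1 with hw
  have hwx : ∀ x : EuclideanSpace ℝ (Fin 2), inner ℝ x w = x j₀ + t * x j₁ := fun x => by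
    rw [hw, inner_add_right, real_inner_smul_right, EuclideanSpace.inner_single_right,
      EuclideanSpace.inner_single_right]
    simp
  have hw0 : 0 < ‖w‖ := by
    rw [norm_pos_iff]
    intro h0
    have : w j₀ = 1 := by simp [hw, hfr.ne]
    rw [h0] at this
    simp at this
  set κ := 2 / ℓ * ‖w‖ with hκ
  have hκ0 : 0 < κ := by positivity
  set b : EuclideanSpace ℝ (Fin N) :=
    WithLp.toLp 2 fun i => a i * b₀ + weightedMean fun y => inner ℝ (P i) (u (T y)) with hb
  have hlam : ∀ x, profile m (κ * inner ℝ x (‖w‖⁻¹ • w)) = profile m (T.symm x).1 := fun x => by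
    rw [hsymm, real_inner_smul_right, hwx, hκ]
    congr 1
    field_simp
  refine ⟨a, b, ‖w‖⁻¹ • w, fun s => profile m (κ * s), ?_, fun s s' hs => hprof (by gcongr),
    isW11LocWithIntegrableDeriv_profile hmi hm0 hκ0, ?_, ?_⟩
  · rw [norm_smul, norm_inv, norm_norm, inv_mul_cancel₀ hw0.ne']
  · refine (hT.eLpNorm_restrict_le hq _).trans ?_
    have hmeas : ∀ i, AEStronglyMeasurable (fun y : ℝ × ℝ => inner ℝ (P i) (u (T y)) -
        weightedMean fun y => inner ℝ (P i) (u (T y))) squareMeasure := fun i =>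
      (hu.hasWeakPartials hT (P i)).snd.integrable_fun.aestronglyMeasurable.sub
        aestronglyMeasurable_const
    have hmeasU : AEStronglyMeasurable
        (fun y : ℝ × ℝ => inner ℝ a (u (T y)) - (profile m y.1 + b₀)) squareMeasure :=
      hU.snd.integrable_fun.aestronglyMeasurable.sub
        ((hprof.measurable.comp measurable_fst).add_const b₀).aestronglyMeasurable
    have hcomp : ∀ i, (fun y => (u (T y) -
        (profile m (κ * inner ℝ (T y) (‖w‖⁻¹ • w)) • a + b)) i) =
        (a i • fun y : ℝ × ℝ => inner ℝ a (u (T y)) - (profile m y.1 + b₀)) +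
        fun y : ℝ × ℝ => inner ℝ (P i) (u (T y)) -
          weightedMean fun y => inner ℝ (P i) (u (T y)) := by
      intro i
      funext y
      rw [hlam, T.symm_apply_apply]
      simp only [hb, PiLp.sub_apply, PiLp.add_apply, PiLp.smul_apply, smul_eq_mul, Pi.add_apply,
        Pi.smul_apply]
      rw [hPv i (u (T y))]
      ring
    have hbound : ∀ i, eLpNorm (fun y => (u (T y) -
        (profile m (κ * inner ℝ (T y) (‖w‖⁻¹ • w)) • a + b)) i) 2 squareMeasure ≤
        ENNReal.ofReal (96 * B * (σ * η₂ + η₃ + √(η₂ * η₃))) := by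
      intro i
      rw [hcomp]
      refine (eLpNorm_add_le (hmeasU.const_smul _) (hmeas i) (by norm_num)).trans ?_
      rw [eLpNorm_const_smul]
      have h1 : ‖a i‖ₑ ≤ 1 := by
        rw [Real.enorm_eq_ofReal_abs]
        exact ENNReal.ofReal_le_one.2 (hai i)
      refine (add_le_add (mul_le_of_le_one_left' h1) le_rfl).trans
        ((add_le_add hUest (hWest i)).trans ?_)
      rw [← ENNReal.ofReal_add (by positivity) (by positivity)]
      refine ENNReal.ofReal_le_ofReal ?_
      have p1 : 0 ≤ B * (σ * η₂) := by positivity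
      have p2 : 0 ≤ B * η₃ := by positivity
      linarith
    have hsum := eLpNorm_le_sum_apply (μ := squareMeasure)
      (v := fun y => u (T y) - (profile m (κ * inner ℝ (T y) (‖w‖⁻¹ • w)) • a + b)) fun i => by
        rw [hcomp]
        exact (hmeasU.const_smul _).add (hmeas i)
    have hsum' := hsum.trans (Finset.sum_le_sum fun i _ => hbound i)
    rw [Finset.sum_const, Finset.card_univ, Fintype.card_fin, nsmul_eq_mul] at hsum'
    have hsq : √(ℓ ^ 2 / 4) = ℓ / 2 := by
      rw [show ℓ ^ 2 / 4 = (ℓ / 2) ^ 2 by ring, Real.sqrt_sq (by positivity)]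
    rw [hsq]
    refine (mul_le_mul_right hsum' _).trans ?_
    rw [← ENNReal.ofReal_natCast, ← ENNReal.ofReal_mul (by positivity),
      ← ENNReal.ofReal_mul (by positivity)]
    refine ENNReal.ofReal_le_ofReal ?_
    have hX : 0 ≤ σ * η₂ + η₃ + √(η₂ * η₃) := by positivity
    generalize σ * η₂ + η₃ + √(η₂ * η₃) = X at hX
    have p1 : 0 ≤ B * X * ℓ := by positivity
    have p2 : 0 ≤ N * (B * X * ℓ) := by positivity
    linarith
  · rw [eLpNorm_exponent_top]
    refine eLpNormEssSup_le_of_ae_bound (.of_forall fun s => ?_)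
    rw [norm_smul, han, mul_one, Real.norm_eq_abs]
    refine (abs_profile_le hmi _).trans ?_
    have p1 : weightBound * squareL1 m ≤ B * (4 * 1 * η₂) := by gcongr
    have p2 : 0 ≤ N * (B * η₂) := by positivity
    have p3 : 0 ≤ B * η₂ := by positivity
    linarith

end OneDimensional

/-! ### Approximation by affine maps -/

section Affine

variable {N : ℕ} {ℓ : ℝ}

/-- The dilation by `ℓ` as a chart of the square `(-ℓ, ℓ)²`. -/
lemma exists_dilation_chart (hℓ : 0 < ℓ) :
    ∃ T, IsSquareChart ℓ (ℓ ^ 2) (EuclideanSpace.single 0 ℓ) (EuclideanSpace.single 1 ℓ) T ∧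
      T '' productSquare = openSquare ℓ ∧ ∀ y, T y 0 = ℓ * y.1 ∧ T y 1 = ℓ * y.2 := by
  obtain ⟨T, hT, hmap⟩ := exists_linear_chart (EuclideanSpace.single 0 ℓ)
    (EuclideanSpace.single 1 ℓ) (d := ℓ ^ 2) (by simp [sq]) (by positivity)
  have hval : ∀ y, T y 0 = ℓ * y.1 ∧ T y 1 = ℓ * y.2 := fun y => by
    rw [hT]
    simp [mul_comm]
  have hgen : ∀ s : ℝ, ℓ * s ∈ Ioo (-ℓ) ℓ ↔ s ∈ Ioo (-1 : ℝ) 1 := by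
    intro s
    rw [mem_Ioo, mem_Ioo]
    constructor
    · rintro ⟨h1, h2⟩
      constructor <;> nlinarith
    · rintro ⟨h1, h2⟩
      constructor <;> nlinarith
  have hmem : ∀ y, T y ∈ openSquare ℓ ↔ y ∈ productSquare := by
    intro y
    simp only [openSquare, mem_ofPred_eq, Fin.forall_fin_two, (hval y).1, (hval y).2, hgen]
    rfl
  refine ⟨T, ⟨hT, by positivity, hmap, fun p hp => (hmem p).2 hp⟩, ?_, hval⟩
  ext x
  constructor
  · rintro ⟨y, hy, rfl⟩
    exact (hmem y).2 hy
  · intro hx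
    refine ⟨T.symm x, (hmem _).1 ?_, T.apply_symm_apply x⟩
    rwa [T.apply_symm_apply]

lemma affineFun_apply (M : Matrix (Fin N) (Fin 2) ℝ) (b : EuclideanSpace ℝ (Fin N))
    (x : EuclideanSpace ℝ (Fin 2)) (i : Fin N) :
    affineFun M b x i = M i 0 * x 0 + M i 1 * x 1 + b i := by
  simp [affineFun, Matrix.mulVec, dotProduct, Fin.sum_univ_two]

lemma sqrt_mul_add_le {B e η : ℝ} (hB : 1 ≤ B) (he : 0 ≤ e) (hη : 0 ≤ η) :
    √(3 * B * e * (η + 2 * e)) ≤ 3 * B * (√(η * e) + e) := by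
  refine Real.sqrt_le_iff.2 ⟨by positivity, ?_⟩
  have h1 : √(η * e) ^ 2 = η * e := Real.sq_sqrt (by positivity)
  have h2 : 0 ≤ √(η * e) * e := by positivity
  have h3 : 3 * B ≤ (3 * B) ^ 2 := by nlinarith
  have h4 : e * (η + 2 * e) ≤ 2 * (√(η * e) + e) ^ 2 := by nlinarith [mul_nonneg hη he, sq_nonneg e]
  have h5 : 0 ≤ (√(η * e) + e) ^ 2 := sq_nonneg _
  calc 3 * B * e * (η + 2 * e) = 3 * B * (e * (η + 2 * e)) := by ring
    _ ≤ 3 * B * (2 * (√(η * e) + e) ^ 2) := by gcongr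
    _ = 6 * B * (√(η * e) + e) ^ 2 := by ring
    _ ≤ (3 * B) ^ 2 * (√(η * e) + e) ^ 2 := by
        refine mul_le_mul_of_nonneg_right ?_ h5
        nlinarith
    _ = (3 * B * (√(η * e) + e)) ^ 2 := by ring

/-- The estimates for `w = P u`, where the rows of `P` are dual to the columns of `A`: the map `w`
has nearly conformal and curl-free derivative, hence is nearly a homothety. -/
lemma HasWeakPartials.exists_affine_approx {U V m e₁ e₂ e₃ e₄ : ℝ × ℝ → ℝ} {e η : ℝ}
    (hU : HasWeakPartials U (fun p => m p + e₁ p) e₂)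
    (hV : HasWeakPartials V e₃ (fun p => m p + e₄ p)) (hm : Integrable m squareMeasure)
    (h1 : Integrable e₁ squareMeasure) (h4 : Integrable e₄ squareMeasure)
    (hη : squareL1 m ≤ η) (b1 : squareL1 e₁ ≤ e) (b2 : squareL1 e₂ ≤ e) (b3 : squareL1 e₃ ≤ e)
    (b4 : squareL1 e₄ ≤ e) :
    ∃ b, eLpNorm (fun p : ℝ × ℝ => U p - (weightedMean m * p.1 + b)) 2 squareMeasure ≤
        ENNReal.ofReal (30 * weightBound ^ 2 * (√(η * e) + e)) ∧
      squareL1 (fun p => U p - (weightedMean m * p.1 + b)) ≤ 50 * weightBound ^ 2 * e := by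
  have hB := one_le_weightBound
  obtain ⟨b, hb⟩ := hU.exists_ae_abs_avgSnd_sub_affine_le hV hm h1 h4
  have he : 0 ≤ e := (squareL1_nonneg _).trans b1
  have hη0 : 0 ≤ η := (squareL1_nonneg _).trans hη
  have hB2 : weightBound ≤ weightBound ^ 2 := by nlinarith
  have hle : 4 * weightBound ^ 2 * (squareL1 e₁ + squareL1 e₃ + squareL1 e₄) ≤
      12 * weightBound ^ 2 * e := by
    have : squareL1 e₁ + squareL1 e₃ + squareL1 e₄ ≤ 3 * e := by linarith
    calc 4 * weightBound ^ 2 * (squareL1 e₁ + squareL1 e₃ + squareL1 e₄)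
        ≤ 4 * weightBound ^ 2 * (3 * e) := by gcongr
      _ = _ := by ring
  have hb' : ∀ᵐ x ∂intervalMeasure, |avgSnd U x - (weightedMean m * x + b)| ≤
      12 * weightBound ^ 2 * e := hb.mono fun x hx => hx.trans hle
  have hφ : Continuous fun x : ℝ => weightedMean m * x + b := by fun_prop
  have hid : Integrable (fun x : ℝ => weightedMean m * x + b) intervalMeasure :=
    (hφ.integrableOn_Icc (a := -1) (b := 1)).mono_set Ioo_subset_Icc_self
  refine ⟨b, ?_, ?_⟩
  · refine (hU.eLpNorm_sub_le (φ := fun x => weightedMean m * x + b) hφ.aestronglyMeasurable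
      (by positivity) hb').trans (ENNReal.ofReal_le_ofReal ?_)
    have h5 : √(3 * weightBound * squareL1 e₂ * (squareL1 (fun p => m p + e₁ p) + squareL1 e₂)) ≤
        3 * weightBound * (√(η * e) + e) := by
      refine le_trans (Real.sqrt_le_sqrt ?_) (sqrt_mul_add_le hB he hη0)
      have n2 := squareL1_nonneg e₂
      have := squareL1_add_le hm h1
      have n3 := squareL1_nonneg (fun p => m p + e₁ p)
      exact mul_le_mul (by gcongr) (by linarith) (by positivity) (by positivity)
    have n1 : 0 ≤ √(η * e) := Real.sqrt_nonneg _
    have h6 := mul_le_mul_of_nonneg_right hB2 n1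
    have h7 := mul_le_mul_of_nonneg_right hB2 he
    have h8 : 0 ≤ weightBound ^ 2 * √(η * e) := by positivity
    have h9 : 0 ≤ weightBound ^ 2 * e := by positivity
    linarith
  · refine (hU.squareL1_sub_le hid hb').trans ?_
    have : 1 * e ≤ weightBound ^ 2 * e := by
      gcongr
      nlinarith
    linarith

/-- If `A` has rank two, then `u` is close to an affine map, in `L¹` with an error controlled by the
part of `Du` that is not a nonnegative multiple of `A`. -/
lemma exists_affine_approx (N : ℕ) : ∃ C : ℝ, 0 < C ∧
    ∀ (ℓ : ℝ) (j₀ j₁ : Fin 2) (t σ : ℝ) (A : Matrix (Fin N) (Fin 2) ℝ)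
      (u : EuclideanSpace ℝ (Fin 2) → EuclideanSpace ℝ (Fin N))
      (Du : EuclideanSpace ℝ (Fin 2) → Matrix (Fin N) (Fin 2) ℝ), 0 < ℓ → matNorm A = 1 →
      IsAdaptedFrame A j₀ j₁ t σ → 0 < σ → IsW11WithGradient (openSquare ℓ) u Du →
      ∀ T, IsSquareChart ℓ (ℓ ^ 2) (EuclideanSpace.single 0 ℓ) (EuclideanSpace.single 1 ℓ) T →
        (∀ y, T y 0 = ℓ * y.1 ∧ T y 1 = ℓ * y.2) →
      ∃ (M : Matrix (Fin N) (Fin 2) ℝ) (b : EuclideanSpace ℝ (Fin N)), ∀ i,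
        eLpNorm (fun y => u (T y) i - affineFun M b (T y) i) 2 squareMeasure ≤
          ENNReal.ofReal (C * (etaThree ℓ A Du / σ + √(etaTwo ℓ Du * (etaThree ℓ A Du / σ)))) ∧
        squareL1 (fun y => u (T y) i - affineFun M b (T y) i) ≤ C * (etaThree ℓ A Du / σ) := by
  have hB := one_le_weightBound
  set B := weightBound with hBdef
  refine ⟨10000 * B ^ 2, by positivity, ?_⟩
  intro ℓ j₀ j₁ t σ A u Du hℓ hA hfr hσ hu T hT hval
  obtain ⟨P, hPn, hPd⟩ := hfr.exists_dual hσ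
  have hdd : ℓ ^ 2 / 4 ≤ ℓ ^ 2 := by nlinarith [sq_nonneg ℓ]
  set η₂ := etaTwo ℓ Du with hη₂
  set η₃ := etaThree ℓ A Du with hη₃
  set E : EuclideanSpace ℝ (Fin 2) → Matrix (Fin N) (Fin 2) ℝ :=
    fun x => Du x - max (matInner A (Du x)) 0 • A with hE
  have hη20 : 0 ≤ η₂ := etaTwo_nonneg hℓ _
  have hη30 : 0 ≤ η₃ := etaTwo_nonneg hℓ E
  have hgrad := hu.integrable_grad
  have hEi : ∀ i k, IntegrableOn (fun x => E x i k) (openSquare ℓ) := integrableOn_sub_smul hgrad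
  have ht : ∀ k : Fin 2, ‖(EuclideanSpace.single k ℓ : EuclideanSpace ℝ (Fin 2))‖ ≤ ℓ := fun k => by
    rw [PiLp.norm_single, Real.norm_of_nonneg hℓ.le]
  set μ : EuclideanSpace ℝ (Fin 2) → ℝ := fun x => max (matInner A (Du x)) 0 with hμ
  have hμi : IntegrableOn μ (openSquare ℓ) := integrableOn_max_matInner hgrad
  have hμ0 : ∀ x, 0 ≤ μ x := fun x => le_max_right _ _
  set m : ℝ × ℝ → ℝ := fun y => ℓ * μ (T y) with hm
  have hmi : Integrable m squareMeasure := (hT.integrable_comp hμi).const_mul _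
  have hmL : squareL1 m ≤ 4 * 1 * η₂ := by
    refine hT.squareL1_le (f := fun x => ℓ * μ x) hℓ hdd hgrad zero_le_one
      (fun x => ?_) (hμi.const_mul _)
    rw [abs_of_nonneg (mul_nonneg hℓ.le (hμ0 x)), one_mul]
    exact mul_le_mul_of_nonneg_left (max_matInner_le hA (Du x)) hℓ.le
  have hEbound : ∀ (p : EuclideanSpace ℝ (Fin N)) (c : ℝ), ‖p‖ ≤ c → ∀ k : Fin 2,
      squareL1 (fun y => matPairing p (E (T y)) (EuclideanSpace.single k ℓ)) ≤ 4 * c * η₃ :=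
    fun p c hp k => hT.squareL1_matPairing_le hℓ hdd hEi hp (ht k)
  have hEint : ∀ (p : EuclideanSpace ℝ (Fin N)) s,
      Integrable (fun y => matPairing p (E (T y)) s) squareMeasure := fun p s =>
    hT.integrable_comp (f := fun x => matPairing p (E x) s)
      (integrable_finsetSum _ fun i _ => integrable_finsetSum _ fun k _ =>
        ((hEi i k).const_mul _).mul_const _)
  have split : ∀ (p : EuclideanSpace ℝ (Fin N)) (k : Fin 2),
      (fun y => matPairing p (Du (T y)) (EuclideanSpace.single k ℓ)) =
      fun y => inner ℝ p (matCol A k) * m y +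
        matPairing p (E (T y)) (EuclideanSpace.single k ℓ) := fun p k => by
    funext y
    rw [matPairing_split p A (Du (T y)) (μ (T y)), matPairing_eq]
    fin_cases k <;> simp [hm] <;> ring
  set e := 4 * (7 / σ) * η₃ with he
  have he0 : 0 ≤ e := by positivity
  have hPn' : ∀ k, ‖P k‖ ≤ 7 / σ := fun k => (hPn k).trans (by gcongr; norm_num)
  have hU : HasWeakPartials (fun y => inner ℝ (P 0) (u (T y)))
      (fun y => m y + matPairing (P 0) (E (T y)) (EuclideanSpace.single 0 ℓ))
      (fun y => matPairing (P 0) (E (T y)) (EuclideanSpace.single 1 ℓ)) := by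
    have := hu.hasWeakPartials hT (P 0)
    rw [split, split, hPd, hPd] at this
    simpa using this
  have hV : HasWeakPartials (fun y => inner ℝ (P 1) (u (T y)))
      (fun y => matPairing (P 1) (E (T y)) (EuclideanSpace.single 0 ℓ))
      (fun y => m y + matPairing (P 1) (E (T y)) (EuclideanSpace.single 1 ℓ)) := by
    have := hu.hasWeakPartials hT (P 1)
    rw [split, split, hPd, hPd] at this
    simpa using this
  obtain ⟨b₀, hb₀, hb₀'⟩ := hU.exists_affine_approx hV hmi (hEint _ _) (hEint _ _) hmL
    (hEbound _ _ (hPn' 0) 0) (hEbound _ _ (hPn' 0) 1) (hEbound _ _ (hPn' 1) 0)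
    (hEbound _ _ (hPn' 1) 1)
  obtain ⟨b₁, hb₁, hb₁'⟩ := hV.swap.exists_affine_approx (m := m ∘ Prod.swap)
    (e₁ := (fun y => matPairing (P 1) (E (T y)) (EuclideanSpace.single 1 ℓ)) ∘ Prod.swap)
    (e₄ := (fun y => matPairing (P 0) (E (T y)) (EuclideanSpace.single 0 ℓ)) ∘ Prod.swap)
    hU.swap hmi.swap (hEint _ _).swap (hEint _ _).swap
    ((squareL1_swap _).trans_le hmL)
    ((squareL1_swap _).trans_le (hEbound _ _ (hPn' 1) 1))
    ((squareL1_swap _).trans_le (hEbound _ _ (hPn' 1) 0))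
    ((squareL1_swap _).trans_le (hEbound _ _ (hPn' 0) 1))
    ((squareL1_swap _).trans_le (hEbound _ _ (hPn' 0) 0))
  rw [weightedMean_swap hmi] at hb₁ hb₁'
  set m₀ := weightedMean m with hm₀
  rw [← hBdef, ← he] at hb₀ hb₀' hb₁ hb₁'
  set W₀ : ℝ × ℝ → ℝ := fun y => inner ℝ (P 0) (u (T y)) - (m₀ * y.1 + b₀) with hW₀
  set W₁ : ℝ × ℝ → ℝ := fun y => inner ℝ (P 1) (u (T y)) - (m₀ * y.2 + b₁) with hW₁
  have hW₀i : Integrable W₀ squareMeasure := by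
    have hφ : Continuous fun x : ℝ => m₀ * x + b₀ := by fun_prop
    have hid : Integrable (fun x : ℝ => m₀ * x + b₀) intervalMeasure :=
      (hφ.integrableOn_Icc (a := -1) (b := 1)).mono_set Ioo_subset_Icc_self
    exact hU.snd.integrable_fun.sub (hid.comp_fst intervalMeasure)
  have hW₁i : Integrable W₁ squareMeasure := by
    have hφ : Continuous fun x : ℝ => m₀ * x + b₁ := by fun_prop
    have hid : Integrable (fun x : ℝ => m₀ * x + b₁) intervalMeasure :=
      (hφ.integrableOn_Icc (a := -1) (b := 1)).mono_set Ioo_subset_Icc_self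
    exact hV.snd.integrable_fun.sub (hid.comp_snd intervalMeasure)
  have hW₁L : squareL1 W₁ ≤ 50 * B ^ 2 * e := by
    rw [← squareL1_swap]
    exact hb₁'
  have hW₁2 : eLpNorm W₁ 2 squareMeasure ≤
      ENNReal.ofReal (30 * B ^ 2 * (√(4 * 1 * η₂ * e) + e)) := by
    have := eLpNorm_comp_measurePreserving (p := 2) hW₁i.aestronglyMeasurable
      (Measure.measurePreserving_swap (μ := intervalMeasure) (ν := intervalMeasure))
    rw [← this]
    exact hb₁
  -- The remaining components see only the part `E` of the derivative.
  set q : Fin N → EuclideanSpace ℝ (Fin N) :=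
    fun i => EuclideanSpace.single i 1 - A i 0 • P 0 - A i 1 • P 1 with hq
  have hqv : ∀ i v, inner ℝ (q i) v = v i - A i 0 * inner ℝ (P 0) v - A i 1 * inner ℝ (P 1) v :=
    fun i v => by
    rw [hq, inner_sub_left, inner_sub_left, real_inner_smul_left, real_inner_smul_left,
      EuclideanSpace.inner_single_left]
    simp
  have hAi : ∀ i k, |A i k| ≤ 1 := fun i k => by
    have hcol : |matCol A k i| ≤ ‖matCol A k‖ := abs_apply_le_norm _ _
    have hsum := norm_matCol_sq_add A
    rw [hA, one_pow] at hsum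
    have : ‖matCol A k‖ ≤ 1 := by
      have n0 := norm_nonneg (matCol A 0)
      have n1 := norm_nonneg (matCol A 1)
      fin_cases k <;> simp only [Fin.zero_eta, Fin.mk_one] <;> nlinarith
    exact hcol.trans this
  have hqn : ∀ i, ‖q i‖ ≤ 7 / σ := fun i => by
    have h1 : 1 ≤ 1 / σ := by rw [le_div_iff₀ hσ]; linarith [hfr.sigma_le]
    have h2 : ∀ k, ‖A i k • P k‖ ≤ 3 / σ := fun k => by
      rw [norm_smul]
      exact (mul_le_of_le_one_left (norm_nonneg _) (hAi i k)).trans (hPn k)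
    have h3 : ‖(EuclideanSpace.single i 1 : EuclideanSpace ℝ (Fin N))‖ = 1 := by
      rw [PiLp.norm_single, norm_one]
    calc ‖q i‖ ≤ 1 + 3 / σ + 3 / σ := (norm_sub_le _ _).trans
          (add_le_add ((norm_sub_le _ _).trans (add_le_add h3.le (h2 0))) (h2 1))
      _ ≤ 1 / σ + 3 / σ + 3 / σ := by gcongr
      _ = 7 / σ := by ring
  have hqA : ∀ i k, inner ℝ (q i) (matCol A k) = 0 := fun i k => by
    rw [hqv, hPd, hPd]
    fin_cases k <;> simp [matCol]
  have hR : ∀ i, HasWeakPartials (fun y => inner ℝ (q i) (u (T y)))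
      (fun y => matPairing (q i) (E (T y)) (EuclideanSpace.single 0 ℓ))
      (fun y => matPairing (q i) (E (T y)) (EuclideanSpace.single 1 ℓ)) := fun i => by
    have := hu.hasWeakPartials hT (q i)
    rw [split, split, hqA, hqA] at this
    simpa using this
  set c : Fin N → ℝ := fun i => weightedMean fun y => inner ℝ (q i) (u (T y)) with hc
  set R : Fin N → ℝ × ℝ → ℝ := fun i y => inner ℝ (q i) (u (T y)) - c i with hRdef
  have hRi : ∀ i, Integrable (R i) squareMeasure := fun i =>
    (hR i).snd.integrable_fun.sub (integrable_const _)
  have hR2 : ∀ i, eLpNorm (R i) 2 squareMeasure ≤ ENNReal.ofReal (10 * B * e) := fun i => by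
    refine (hR i).eLpNorm_sub_weightedMean_le.trans (ENNReal.ofReal_le_ofReal ?_)
    have h1 := hEbound _ _ (hqn i) 0
    have h2 := hEbound _ _ (hqn i) 1
    calc 5 * weightBound * (_ + _) ≤ 5 * B * (e + e) :=
          mul_le_mul_of_nonneg_left (add_le_add h1 h2) (by positivity)
      _ = 10 * B * e := by ring
  have hR1 : ∀ i, squareL1 (R i) ≤ 6 * B * e := fun i => by
    have h1 := hEbound _ _ (hqn i) 0
    have h2 := hEbound _ _ (hqn i) 1
    refine ((hR i).squareL1_sub_le (φ := fun _ => c i) (integrable_const _)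
      (hR i).ae_abs_avgSnd_sub_le).trans ?_
    have h3 : weightBound * squareL1 (fun y => matPairing (q i) (E (T y))
        (EuclideanSpace.single 0 ℓ)) ≤ B * e := mul_le_mul_of_nonneg_left h1 (by positivity)
    have h4 : 1 * e ≤ B * e := by gcongr
    linarith
  refine ⟨(m₀ / ℓ) • A, WithLp.toLp 2 fun i => A i 0 * b₀ + A i 1 * b₁ + c i, fun i => ?_⟩
  have hdecomp : (fun y => u (T y) i - affineFun ((m₀ / ℓ) • A)
      (WithLp.toLp 2 fun i => A i 0 * b₀ + A i 1 * b₁ + c i) (T y) i) =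
      (A i 0 • W₀ + A i 1 • W₁) + R i := by
    funext y
    rw [affineFun_apply]
    simp only [Pi.add_apply, Pi.smul_apply, smul_eq_mul, hW₀, hW₁, hRdef, Matrix.smul_apply]
    rw [hqv, (hval y).1, (hval y).2]
    field_simp
    ring
  have hB2 : B ≤ B ^ 2 := by nlinarith
  have hee : e = 28 * (η₃ / σ) := by rw [he]; ring
  have hx0 : 0 ≤ η₃ / σ := by positivity
  have hBe := mul_le_mul_of_nonneg_right hB2 he0
  rw [hdecomp]
  constructor
  · have hs : ∀ (k : Fin 2) (W : ℝ × ℝ → ℝ), eLpNorm (A i k • W) 2 squareMeasure ≤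
        eLpNorm W 2 squareMeasure := fun k W => by
      rw [eLpNorm_const_smul]
      refine mul_le_of_le_one_left' ?_
      rw [Real.enorm_eq_ofReal_abs]
      exact ENNReal.ofReal_le_one.2 (hAi i k)
    have m0 := hW₀i.aestronglyMeasurable.const_smul (A i 0)
    have m1 := hW₁i.aestronglyMeasurable.const_smul (A i 1)
    refine (eLpNorm_add_le (m0.add m1) (hRi i).aestronglyMeasurable (by norm_num)).trans ?_
    refine (add_le_add ((eLpNorm_add_le m0 m1 (by norm_num)).trans
      (add_le_add ((hs 0 W₀).trans hb₀) ((hs 1 W₁).trans hW₁2))) (hR2 i)).trans ?_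
    rw [← ENNReal.ofReal_add (by positivity) (by positivity),
      ← ENNReal.ofReal_add (by positivity) (by positivity)]
    refine ENNReal.ofReal_le_ofReal ?_
    have hsq : √(4 * 1 * η₂ * e) ≤ 11 * √(η₂ * (η₃ / σ)) := by
      refine Real.sqrt_le_iff.2 ⟨by positivity, ?_⟩
      have : 0 ≤ η₂ * (η₃ / σ) := by positivity
      rw [mul_pow, Real.sq_sqrt this, hee]
      linarith
    have h1 : B ^ 2 * √(4 * 1 * η₂ * e) ≤ B ^ 2 * (11 * √(η₂ * (η₃ / σ))) := by gcongr
    have h2 : 0 ≤ B ^ 2 * √(η₂ * (η₃ / σ)) := by positivity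
    have h3 : 0 ≤ B ^ 2 * (η₃ / σ) := by positivity
    have h4 : B ^ 2 * e = 28 * (B ^ 2 * (η₃ / σ)) := by rw [hee]; ring
    linarith
  · have hs : ∀ (k : Fin 2) (W : ℝ × ℝ → ℝ), squareL1 (A i k • W) ≤ squareL1 W := fun k W => by
      have : squareL1 (A i k • W) = |A i k| * squareL1 W := by
        simp only [squareL1, Pi.smul_apply, smul_eq_mul, abs_mul]
        exact integral_const_mul _ _
      rw [this]
      exact mul_le_of_le_one_left (squareL1_nonneg _) (hAi i k)
    have i0 := hW₀i.smul (A i 0)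
    have i1 := hW₁i.smul (A i 1)
    have h1 : squareL1 (A i 0 • W₀ + A i 1 • W₁ + R i) ≤
        squareL1 (A i 0 • W₀ + A i 1 • W₁) + squareL1 (R i) :=
      squareL1_add_le (i0.add i1) (hRi i)
    have h2 : squareL1 (A i 0 • W₀ + A i 1 • W₁) ≤ squareL1 (A i 0 • W₀) + squareL1 (A i 1 • W₁) :=
      squareL1_add_le i0 i1
    have h3 := hs 0 W₀
    have h4 := hs 1 W₁
    have h5 := hR1 i
    have h6 : 0 ≤ B ^ 2 * (η₃ / σ) := by positivity
    have h7 : B ^ 2 * e = 28 * (B ^ 2 * (η₃ / σ)) := by rw [hee]; ring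
    linarith

end Affine

/-! ### Rigidity of affine maps near the integer lattice -/

section Rigidity

variable {N : ℕ} {ℓ : ℝ}

lemma convex_openSquare (ℓ : ℝ) : Convex ℝ (openSquare ℓ) := by
  intro x hx y hy a b ha hb hab i
  exact convex_Ioo (-ℓ) ℓ (hx i) (hy i) ha hb hab

lemma zero_mem_openSquare (hℓ : 0 < ℓ) : 0 ∈ openSquare ℓ := fun i => by
  simp [hℓ]

lemma openSquare_subset_closedBall (ℓ : ℝ) :
    openSquare ℓ ⊆ Metric.closedBall (0 : EuclideanSpace ℝ (Fin 2)) (2 * ℓ) := by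
  intro x hx
  have hℓ : 0 < ℓ := by linarith [(hx 0).1, (hx 0).2]
  rw [mem_closedBall_zero_iff]
  refine le_of_sq_le_sq ?_ (by positivity)
  rw [norm_sq_eq_sum, Fin.sum_univ_two]
  nlinarith [(hx 0).1, (hx 0).2, (hx 1).1, (hx 1).2]

lemma Continuous.integrableOn_openSquare {F : Type*} [NormedAddCommGroup F]
    {f : EuclideanSpace ℝ (Fin 2) → F} (hf : Continuous f) (ℓ : ℝ) :
    IntegrableOn f (openSquare ℓ) :=
  (hf.continuousOn.integrableOn_compact (isCompact_closedBall 0 (2 * ℓ))).mono_set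
    (openSquare_subset_closedBall ℓ)

lemma continuous_affineFun (M : Matrix (Fin N) (Fin 2) ℝ) (b : EuclideanSpace ℝ (Fin N)) :
    Continuous (affineFun M b) := by
  unfold affineFun
  refine (Continuous.add ?_ continuous_const)
  refine (PiLp.continuous_toLp 2 _).comp ?_
  exact continuous_const.matrix_mulVec (PiLp.continuous_ofLp 2 _)

lemma zero_mem_intLattice (N : ℕ) : 0 ∈ intLattice N := fun _ => ⟨0, by simp⟩

/-- The integral over the square in terms of the dilation chart. -/
lemma setIntegral_openSquare_eq {T : (ℝ × ℝ) ≃L[ℝ] EuclideanSpace ℝ (Fin 2)}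
    {t₁ t₂ : EuclideanSpace ℝ (Fin 2)} (hT : IsSquareChart ℓ (ℓ ^ 2) t₁ t₂ T)
    (himg : T '' productSquare = openSquare ℓ) (f : EuclideanSpace ℝ (Fin 2) → ℝ) :
    1 / ℓ ^ 2 * ∫ x in openSquare ℓ, f x = ∫ y, f (T y) ∂squareMeasure := by
  rw [hT.integral_comp, himg, one_div]

lemma setIntegral_openSquare_const (hℓ : 0 < ℓ) (c : ℝ) :
    ∫ _ in openSquare ℓ, c = 4 * ℓ ^ 2 * c := by
  obtain ⟨T, hT, himg, -⟩ := exists_dilation_chart hℓ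
  have h := setIntegral_openSquare_eq hT himg fun _ => c
  rw [integral_const (μ := squareMeasure), Measure.real, squareMeasure_univ] at h
  simp only [ENNReal.toReal_ofNat, smul_eq_mul] at h
  rw [one_div, inv_mul_eq_iff_eq_mul₀ (by positivity)] at h
  rw [h]
  ring

lemma abs_half_integer_sub_ge (k z : ℤ) : 1 / 2 ≤ |(k : ℝ) + 1 / 2 - z| := by
  rcases le_or_gt z k with h | h
  · have : (z : ℝ) ≤ k := by exact_mod_cast h
    exact le_trans (by linarith) (le_abs_self _)
  · have : (k : ℝ) + 1 ≤ z := by exact_mod_cast h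
    exact le_trans (by linarith) (neg_le_abs _)

lemma abs_sub_round_le_infDist (v : EuclideanSpace ℝ (Fin N)) (i : Fin N) :
    |v i - round (v i)| ≤ Metric.infDist v (intLattice N) := by
  rw [Metric.le_infDist ⟨0, zero_mem_intLattice N⟩]
  intro z hz
  obtain ⟨k, hk⟩ := hz i
  rw [dist_eq_norm]
  refine (round_le (v i) k).trans ?_
  rw [← hk]
  exact abs_apply_le_norm (v - z) i

/-- Contracting the square by the factor `1/2` towards one of its points maps it into itself and
divides areas by `4`, whence the bound for the composition of a nonnegative function with this map. -/
lemma setIntegral_comp_midpoint_le {g : EuclideanSpace ℝ (Fin 2) → ℝ} (hg : Continuous g)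
    (h0 : ∀ x, 0 ≤ g x) {x₀ : EuclideanSpace ℝ (Fin 2)} (hx₀ : x₀ ∈ openSquare ℓ) :
    ∫ x in openSquare ℓ, g ((1 / 2 : ℝ) • (x + x₀)) ≤ 4 * ∫ x in openSquare ℓ, g x := by
  have hQ := measurableSet_openSquare ℓ
  set h := (openSquare ℓ).indicator g with hh
  have hi : Integrable h := (integrable_indicator_iff hQ).2 (hg.integrableOn_openSquare ℓ)
  have hi2 : Integrable fun x => h ((1 / 2 : ℝ) • (x + x₀)) :=
    (hi.comp_smul (by norm_num : (1 / 2 : ℝ) ≠ 0)).comp_add_right x₀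
  have e1 : ∫ x, h ((1 / 2 : ℝ) • (x + x₀)) = 4 * ∫ x in openSquare ℓ, g x := by
    rw [integral_add_right_eq_self (fun x => h ((1 / 2 : ℝ) • x)),
      Measure.integral_comp_smul volume h, hh, integral_indicator hQ, finrank_euclideanSpace_fin]
    norm_num
  rw [← e1, ← integral_indicator hQ]
  refine integral_mono ((integrable_indicator_iff hQ).2
    (Continuous.integrableOn_openSquare (by fun_prop) ℓ)) hi2 fun x => ?_
  by_cases hx : x ∈ openSquare ℓ
  · have hmid : (1 / 2 : ℝ) • (x + x₀) ∈ openSquare ℓ := by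
      rw [smul_add]
      exact convex_openSquare ℓ hx hx₀ (by norm_num) (by norm_num) (by norm_num)
    simp only [hh, indicator_of_mem hx, indicator_of_mem hmid]
    exact le_rfl
  · simp only [indicator_of_notMem hx]
    exact indicator_nonneg (fun _ _ => h0 _) _

/-- If a component of an affine map takes a half-integer value at a point of the square, then the
map is far from the lattice on average: its distance to the lattice at that point is controlled by
the distances at `x` and at the midpoint, for each `x`. -/
lemma two_div_nine_le_etaOne (hℓ : 0 < ℓ) (M : Matrix (Fin N) (Fin 2) ℝ)
    (b : EuclideanSpace ℝ (Fin N)) {x₀ : EuclideanSpace ℝ (Fin 2)} (hx₀ : x₀ ∈ openSquare ℓ)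
    (i : Fin N) (k : ℤ) (hk : affineFun M b x₀ i = k + 1 / 2) :
    2 / 9 ≤ etaOne ℓ (affineFun M b) := by
  set g := fun x => Metric.infDist (affineFun M b x) (intLattice N) with hg
  have hgc : Continuous g := (Metric.continuous_infDist_pt _).comp (continuous_affineFun M b)
  have hg0 : ∀ x, 0 ≤ g x := fun x => Metric.infDist_nonneg
  have hpt : ∀ x, 1 / 2 ≤ 2 * g ((1 / 2 : ℝ) • (x + x₀)) + g x := by
    intro x
    set v := affineFun M b ((1 / 2 : ℝ) • (x + x₀)) with hv
    set w := affineFun M b x with hw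
    have hrel : 2 * v i - w i = k + 1 / 2 := by
      rw [← hk, hv, hw]
      simp only [affineFun_apply, PiLp.smul_apply, PiLp.add_apply, smul_eq_mul]
      ring
    have h1 := abs_sub_round_le_infDist v i
    have h2 := abs_sub_round_le_infDist w i
    have h3 := abs_half_integer_sub_ge k (2 * round (v i) - round (w i))
    push_cast at h3
    rw [← hrel, show 2 * v i - w i - (2 * (round (v i) : ℝ) - round (w i)) =
      2 * (v i - round (v i)) - (w i - round (w i)) by ring] at h3
    have h4 := abs_sub (2 * (v i - round (v i))) (w i - round (w i))
    rw [abs_mul, abs_two] at h4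
    have h5 : g ((1 / 2 : ℝ) • (x + x₀)) = Metric.infDist v (intLattice N) := rfl
    have h6 : g x = Metric.infDist w (intLattice N) := rfl
    linarith
  have i1 : IntegrableOn (fun x => 2 * g ((1 / 2 : ℝ) • (x + x₀))) (openSquare ℓ) :=
    Continuous.integrableOn_openSquare (by fun_prop) ℓ
  have i2 : IntegrableOn g (openSquare ℓ) := hgc.integrableOn_openSquare ℓ
  have hint : ∫ _ in openSquare ℓ, (1 / 2 : ℝ) ≤
      ∫ x in openSquare ℓ, (2 * g ((1 / 2 : ℝ) • (x + x₀)) + g x) :=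
    integral_mono (Continuous.integrableOn_openSquare continuous_const ℓ) (i1.add i2) hpt
  rw [setIntegral_openSquare_const hℓ, integral_add i1 i2, integral_const_mul] at hint
  have hmid := setIntegral_comp_midpoint_le hgc hg0 hx₀
  have h9 : 2 * ℓ ^ 2 ≤ 9 * ∫ x in openSquare ℓ, g x := by linarith
  rw [etaOne, one_div, inv_mul_eq_div, le_div_iff₀ (by positivity)]
  linarith

theorem isAffineRigidityThreshold_one_div_five (N : ℕ) : IsAffineRigidityThreshold N (1 / 5) := by
  intro ℓ hℓ M b hη
  have hno : ∀ x ∈ openSquare ℓ, ∀ (i : Fin N) (k : ℤ), affineFun M b x i ≠ k + 1 / 2 := by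
    intro x hx i k hk
    have := two_div_nine_le_etaOne hℓ M b hx i k hk
    norm_num at hη this
    linarith
  have hcont : ∀ i, Continuous fun x => affineFun M b x i := fun i =>
    (EuclideanSpace.proj i : EuclideanSpace ℝ (Fin N) →L[ℝ] ℝ).continuous.comp
      (continuous_affineFun M b)
  set z : EuclideanSpace ℝ (Fin N) :=
    WithLp.toLp 2 fun i => (round (affineFun M b 0 i) : ℝ) with hz
  -- By connectedness no component leaves the interval of length one around its rounded value at 0.
  have hnear : ∀ x ∈ openSquare ℓ, ∀ i, |affineFun M b x i - round (affineFun M b 0 i)| ≤ 1 / 2 := by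
    intro x hx i
    have hpre := (convex_openSquare ℓ).isPreconnected
    set k := round (affineFun M b 0 i)
    have h0 := abs_sub_round (affineFun M b 0 i)
    rw [abs_le] at h0 ⊢
    constructor
    · by_contra! hlt
      obtain ⟨y, hy, hyk⟩ := hpre.intermediate_value hx (zero_mem_openSquare hℓ)
        (hcont i).continuousOn
        (show (k : ℝ) - 1 / 2 ∈ Icc _ _ from ⟨by linarith, by linarith [h0.1]⟩)
      refine hno y hy i (k - 1) ?_
      simp only at hyk
      rw [hyk]
      push_cast
      ring
    · by_contra! hlt
      obtain ⟨y, hy, hyk⟩ := hpre.intermediate_value (zero_mem_openSquare hℓ) hx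
        (hcont i).continuousOn
        (show (k : ℝ) + 1 / 2 ∈ Icc _ _ from ⟨by linarith [h0.2], by linarith⟩)
      exact hno y hy i k hyk
  refine ⟨z, fun i => ⟨_, rfl⟩, setIntegral_congr_fun (measurableSet_openSquare ℓ) fun x hx => ?_⟩
  have hzmem : z ∈ intLattice N := fun i => ⟨_, rfl⟩
  refine le_antisymm ?_ ?_
  · rw [Metric.le_infDist ⟨0, zero_mem_intLattice N⟩]
    intro y hy
    rw [dist_eq_norm]
    refine le_of_sq_le_sq ?_ (norm_nonneg _)
    rw [norm_sq_eq_sum, norm_sq_eq_sum]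
    refine Finset.sum_le_sum fun i _ => sq_le_sq.2 ?_
    obtain ⟨m, hm⟩ := hy i
    simp only [PiLp.sub_apply, hm]
    have h1 := hnear x hx i
    change |affineFun M b x i - round (affineFun M b 0 i)| ≤ _
    rcases eq_or_ne m (round (affineFun M b 0 i)) with h | h
    · rw [h]
    · have h2 : (1 : ℝ) ≤ |(m : ℝ) - round (affineFun M b 0 i)| := by
        have := Int.one_le_abs (sub_ne_zero.2 h)
        exact_mod_cast this
      have h3 := abs_sub_le (m : ℝ) (affineFun M b x i) (round (affineFun M b 0 i))
      rw [abs_sub_comm (m : ℝ) (affineFun M b x i)] at h3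
      linarith
  · rw [← dist_eq_norm]
    exact Metric.infDist_le_dist_of_mem hzmem

end Rigidity

/-! ### Approximation by a lattice point -/

section Lattice

variable {N : ℕ} {ℓ δ κ ε : ℝ} {u : EuclideanSpace ℝ (Fin 2) → EuclideanSpace ℝ (Fin N)}

lemma norm_le_sum_abs (v : EuclideanSpace ℝ (Fin N)) : ‖v‖ ≤ ∑ i, |v i| := by
  have e : v = ∑ i, v i • EuclideanSpace.single i (1 : ℝ) := by
    ext j
    simp [Pi.single_apply]
  conv_lhs => rw [e]
  refine (norm_sum_le _ _).trans (Finset.sum_le_sum fun i _ => ?_)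
  simp [norm_smul]

lemma integrableOn_infDist (hu : IntegrableOn u (openSquare ℓ)) :
    IntegrableOn (fun x => Metric.infDist (u x) (intLattice N)) (openSquare ℓ) := by
  refine Integrable.mono hu ((Metric.continuous_infDist_pt _).comp_aestronglyMeasurable
    hu.aestronglyMeasurable) (.of_forall fun x => ?_)
  rw [Real.norm_of_nonneg Metric.infDist_nonneg]
  simpa using Metric.infDist_le_dist_of_mem (x := u x) (zero_mem_intLattice N)

lemma etaOne_nonneg (hℓ : 0 < ℓ) (u : EuclideanSpace ℝ (Fin 2) → EuclideanSpace ℝ (Fin N)) :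
    0 ≤ etaOne ℓ u :=
  mul_nonneg (by positivity) (integral_nonneg fun _ => Metric.infDist_nonneg)

/-- If `u` is close to an affine map in `L¹` and close to the lattice, then this affine map is close
to the lattice, so by rigidity it is close to one lattice point; as the `L¹` and `L²` norms are
equivalent on affine functions, so is `u`. -/
lemma exists_lattice_approx (hℓ : 0 < ℓ) (hδ : IsAffineRigidityThreshold N δ)
    (hu : IntegrableOn u (openSquare ℓ)) {T : (ℝ × ℝ) ≃L[ℝ] EuclideanSpace ℝ (Fin 2)}
    {t₁ t₂ : EuclideanSpace ℝ (Fin 2)} (hT : IsSquareChart ℓ (ℓ ^ 2) t₁ t₂ T)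
    (himg : T '' productSquare = openSquare ℓ) (hval : ∀ y, T y 0 = ℓ * y.1 ∧ T y 1 = ℓ * y.2)
    {M : Matrix (Fin N) (Fin 2) ℝ} {b : EuclideanSpace ℝ (Fin N)} (hκ : 0 ≤ κ)
    (h2 : ∀ i, eLpNorm (fun y => u (T y) i - affineFun M b (T y) i) 2 squareMeasure ≤
      ENNReal.ofReal κ)
    (h1 : ∀ i, squareL1 (fun y => u (T y) i - affineFun M b (T y) i) ≤ ε)
    (hη : etaOne ℓ u + N * ε ≤ δ) :
    ∃ z : EuclideanSpace ℝ (Fin N),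
      eLpNorm (fun x => u x - z) 2 (volume.restrict (openSquare (ℓ / 4))) ≤
        ENNReal.ofReal (N * (κ + 4 * (etaOne ℓ u + N * ε)) * ℓ) := by
  set v := affineFun M b with hv
  have hvc : Continuous v := continuous_affineFun M b
  have hvi : IntegrableOn v (openSquare ℓ) := hvc.integrableOn_openSquare ℓ
  have hcomp : ∀ {w : EuclideanSpace ℝ (Fin 2) → EuclideanSpace ℝ (Fin N)},
      IntegrableOn w (openSquare ℓ) → ∀ i, IntegrableOn (fun x => w x i) (openSquare ℓ) :=
    fun hw i => (EuclideanSpace.proj i : EuclideanSpace ℝ (Fin N) →L[ℝ] ℝ).integrable_comp hw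
  have hui := hcomp hu
  have hd : ∀ i, Integrable (fun y => |u (T y) i - v (T y) i|) squareMeasure := fun i =>
    (hT.integrable_comp ((hui i).sub (hcomp hvi i))).abs
  have hsum : ∫ y, ∑ i, |u (T y) i - v (T y) i| ∂squareMeasure ≤ N * ε := by
    rw [integral_finsetSum _ fun i _ => hd i]
    refine (Finset.sum_le_sum fun i _ => h1 i).trans ?_
    simp
  have hvη : etaOne ℓ v ≤ etaOne ℓ u + N * ε := by
    simp only [etaOne]
    rw [setIntegral_openSquare_eq hT himg, setIntegral_openSquare_eq hT himg]
    refine le_trans ?_ (add_le_add_right hsum _)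
    have iu := hT.integrable_comp (integrableOn_infDist hu)
    have iv := hT.integrable_comp (integrableOn_infDist hvi)
    have is : Integrable (fun y => ∑ i, |u (T y) i - v (T y) i|) squareMeasure :=
      integrable_finsetSum _ fun i _ => hd i
    rw [← integral_add iu is]
    refine integral_mono iv (iu.add is) fun y => ?_
    refine (Metric.infDist_le_infDist_add_dist (x := v (T y)) (y := u (T y))).trans ?_
    rw [dist_comm, dist_eq_norm]
    exact add_le_add_right (norm_le_sum_abs _) _
  obtain ⟨z, -, hz⟩ := hδ ℓ hℓ M b (hvη.trans hη)
  have hz1 : ∀ i, squareL1 (fun y => v (T y) i - z i) ≤ etaOne ℓ v := fun i => by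
    rw [etaOne, ← hz, setIntegral_openSquare_eq hT himg]
    refine integral_mono (hT.integrable_comp ((hcomp hvi i).sub
      (Continuous.integrableOn_openSquare (continuous_const (y := z i)) ℓ))).abs
      (hT.integrable_comp (Continuous.integrableOn_openSquare
        (f := fun x => ‖v x - z‖) (by fun_prop) ℓ)) fun y => ?_
    exact abs_apply_le_norm (v (T y) - z) i
  have hz2 : ∀ i, eLpNorm (fun y => v (T y) i - z i) 2 squareMeasure ≤
      ENNReal.ofReal (4 * (etaOne ℓ u + N * ε)) := fun i => by
    have e : (fun y => v (T y) i - z i) =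
        fun p : ℝ × ℝ => (b i - z i) + p.1 * (M i 0 * ℓ) + p.2 * (M i 1 * ℓ) := by
      funext y
      rw [hv, affineFun_apply, (hval y).1, (hval y).2]
      ring
    have := hz1 i
    rw [e] at this ⊢
    exact (eLpNorm_affine_le _ _ _).trans (ENNReal.ofReal_le_ofReal (by linarith))
  have hηu := etaOne_nonneg hℓ u
  have hηv := etaOne_nonneg hℓ v
  refine ⟨z, ?_⟩
  have hq : openSquare (ℓ / 4) ⊆ T '' productSquare := by
    rw [himg]
    intro x hx i
    exact ⟨by linarith [(hx i).1], by linarith [(hx i).2]⟩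
  have hzi : IntegrableOn (fun _ => z) (openSquare ℓ) :=
    Continuous.integrableOn_openSquare continuous_const ℓ
  refine (hT.eLpNorm_restrict_le hq _).trans ?_
  rw [Real.sqrt_sq hℓ.le]
  have hk : ∀ i, eLpNorm (fun y => (u (T y) - z) i) 2 squareMeasure ≤
      ENNReal.ofReal (κ + 4 * (etaOne ℓ u + N * ε)) := fun i => by
    have e : (fun y => (u (T y) - z) i) =
        (fun y => u (T y) i - v (T y) i) + fun y => v (T y) i - z i := by
      funext y
      simp
    rw [e, ENNReal.ofReal_add hκ (by linarith)]
    exact (eLpNorm_add_le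
      (hT.integrable_comp ((hui i).sub (hcomp hvi i))).aestronglyMeasurable
      (hT.integrable_comp ((hcomp hvi i).sub (hcomp hzi i))).aestronglyMeasurable
      (by norm_num)).trans (add_le_add (h2 i) (hz2 i))
  have hs := eLpNorm_le_sum_apply (v := fun y => u (T y) - z) fun i =>
    (hT.integrable_comp ((hui i).sub (hcomp hzi i))).aestronglyMeasurable
  calc ENNReal.ofReal ℓ * eLpNorm (fun y => u (T y) - z) 2 squareMeasure
      ≤ ENNReal.ofReal ℓ * ∑ _i : Fin N, ENNReal.ofReal (κ + 4 * (etaOne ℓ u + N * ε)) :=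
        mul_le_mul_right (hs.trans (Finset.sum_le_sum fun i _ => hk i)) _
    _ = ENNReal.ofReal (N * (κ + 4 * (etaOne ℓ u + N * ε)) * ℓ) := by
        rw [Finset.sum_const, Finset.card_univ, Fintype.card_fin, nsmul_eq_mul,
          mul_comm (ENNReal.ofReal ℓ), ENNReal.ofReal_mul (by
            exact mul_nonneg (Nat.cast_nonneg _) (by linarith)),
          ENNReal.ofReal_mul (Nat.cast_nonneg _), ENNReal.ofReal_natCast]

lemma isW11LocWithIntegrableDeriv_zero : IsW11LocWithIntegrableDeriv fun _ => 0 :=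
  ⟨locallyIntegrable_const 0, fun _ => 0, integrable_zero _ _ _, fun φ _ _ _ => by simp⟩

end Lattice

/-! ### Comparison with the geometric mean `X` of `x`, `x` and `y` -/

section ErrorTerms

variable {x y s X : ℝ}

lemma rpow_two_thirds_mul_rpow_third_pow (hx : 0 ≤ x) (hy : 0 ≤ y) :
    (x ^ (2 / 3 : ℝ) * y ^ (1 / 3 : ℝ)) ^ 3 = x ^ 2 * y := by
  rw [mul_pow, ← Real.rpow_natCast (x ^ (2 / 3 : ℝ)), ← Real.rpow_natCast (y ^ (1 / 3 : ℝ)),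
    ← Real.rpow_mul hx, ← Real.rpow_mul hy]
  norm_num

lemma le_of_cube_eq (hy : 0 ≤ y) (hX : 0 ≤ X) (h : X ^ 3 = x ^ 2 * y) (hyx : y ≤ x) : y ≤ X := by
  refine le_of_pow_le_pow_left₀ (by norm_num : (3 : ℕ) ≠ 0) hX ?_
  rw [h]
  nlinarith [mul_le_mul hyx hyx hy (hy.trans hyx)]

lemma sqrt_mul_le_of_cube_eq (hy : 0 ≤ y) (hX : 0 ≤ X) (h : X ^ 3 = x ^ 2 * y) (hyx : y ≤ x) :
    √(x * y) ≤ X := by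
  have hx := hy.trans hyx
  refine Real.sqrt_le_iff.2 ⟨hX, ?_⟩
  refine le_of_pow_le_pow_left₀ (by norm_num : (3 : ℕ) ≠ 0) (sq_nonneg X) ?_
  calc (x * y) ^ 3 = x ^ 3 * y ^ 2 * y := by ring
    _ ≤ x ^ 3 * y ^ 2 * x := by gcongr
    _ = (X ^ 3) ^ 2 := by rw [h]; ring
    _ = (X ^ 2) ^ 3 := by ring

lemma mul_le_of_cube_eq (hX : 0 ≤ X) (h : X ^ 3 = x ^ 2 * y) (hs : s ^ 3 * x ≤ y) : s * x ≤ X := by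
  refine le_of_pow_le_pow_left₀ (by norm_num : (3 : ℕ) ≠ 0) hX ?_
  rw [h]
  nlinarith [mul_le_mul_of_nonneg_left hs (sq_nonneg x)]

lemma div_le_of_cube_eq (hs0 : 0 < s) (hy : 0 ≤ y) (hX : 0 ≤ X) (h : X ^ 3 = x ^ 2 * y)
    (hs : y ≤ s ^ 3 * x) (hs1 : s ≤ 1) : y / s ≤ X := by
  have hx : 0 ≤ x := by
    by_contra! hx
    have : s ^ 3 * x < 0 := mul_neg_of_pos_of_neg (by positivity) hx
    linarith
  have hyx : y ≤ x := hs.trans (mul_le_of_le_one_left hx (pow_le_one₀ hs0.le hs1))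
  refine le_of_pow_le_pow_left₀ (by norm_num : (3 : ℕ) ≠ 0) hX ?_
  rw [h, div_pow, div_le_iff₀ (by positivity)]
  calc y ^ 3 = y * y * y := by ring
    _ ≤ s ^ 3 * x * x * y := by gcongr
    _ = x ^ 2 * y * s ^ 3 := by ring

lemma sqrt_mul_div_le_of_cube_eq (hs0 : 0 < s) (hx : 0 ≤ x) (hX : 0 ≤ X)
    (h : X ^ 3 = x ^ 2 * y) (hs : y ≤ s ^ 3 * x) : √(x * (y / s)) ≤ X := by
  refine Real.sqrt_le_iff.2 ⟨hX, ?_⟩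
  refine le_of_pow_le_pow_left₀ (by norm_num : (3 : ℕ) ≠ 0) (sq_nonneg X) ?_
  have e : (x * (y / s)) ^ 3 = x ^ 3 * y ^ 2 * y / s ^ 3 := by
    rw [mul_pow, div_pow]
    ring
  rw [e, div_le_iff₀ (by positivity)]
  calc x ^ 3 * y ^ 2 * y ≤ x ^ 3 * y ^ 2 * (s ^ 3 * x) := by gcongr
    _ = (X ^ 3) ^ 2 * s ^ 3 := by rw [h]; ring
    _ = (X ^ 2) ^ 3 * s ^ 3 := by ring

end ErrorTerms

/-! ### Choice of the approximation -/

theorem mainTheorem4 :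
    (∃ δ : ℝ, 0 < δ ∧ ∀ N : ℕ, IsAffineRigidityThreshold N δ) ∧
    ∀ N : ℕ, ∃ c : ℝ, 0 < c ∧
      ∀ δ : ℝ, 0 < δ → IsAffineRigidityThreshold N δ →
      ∀ ℓ : ℝ, 0 < ℓ →
      ∀ A : Matrix (Fin N) (Fin 2) ℝ, matNorm A = 1 →
      ∀ (u : EuclideanSpace ℝ (Fin 2) → EuclideanSpace ℝ (Fin N))
        (Du : EuclideanSpace ℝ (Fin 2) → Matrix (Fin N) (Fin 2) ℝ),
        IsW11WithGradient (openSquare ℓ) u Du →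
        etaOne ℓ u ≤ δ / 2 →
        ∃ (a b : EuclideanSpace ℝ (Fin N)) (ν : EuclideanSpace ℝ (Fin 2)) (lam : ℝ → ℝ),
          ‖ν‖ = 1 ∧ Monotone lam ∧ IsW11LocWithIntegrableDeriv lam ∧
          eLpNorm (fun x => u x - (lam (inner ℝ x ν) • a + b)) 2
              (volume.restrict (openSquare (ℓ / 4))) ≤
            ENNReal.ofReal
              ((c * (etaTwo ℓ Du ^ (2 / 3 : ℝ) * etaThree ℓ A Du ^ (1 / 3 : ℝ)) +
                c * (etaTwo ℓ Du * etaThree ℓ A Du ^ (1 / 2 : ℝ)) + c * etaOne ℓ u) * ℓ) ∧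
          eLpNorm (fun t : ℝ => lam t • a) ⊤ volume ≤ ENNReal.ofReal (c * etaTwo ℓ Du) := by
  refine ⟨⟨1 / 5, by norm_num, isAffineRigidityThreshold_one_div_five⟩, fun N => ?_⟩
  obtain ⟨C₁, hC₁, hone⟩ := exists_oneDimensional_approx N
  obtain ⟨C₂, hC₂, haff⟩ := exists_affine_approx N
  set K := 10 * (N * C₂) with hK
  have hK0 : 0 ≤ K := by positivity
  have hc₁ : 0 ≤ C₁ * √K := by positivity
  have hc₂ : 0 ≤ N * (2 * C₂ + 4 * (N * C₂)) := by positivity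
  have hc₃ : (0 : ℝ) ≤ 4 * N := by positivity
  refine ⟨3 * C₁ + C₁ * √K + N * (2 * C₂ + 4 * (N * C₂)) + 4 * N, by positivity, ?_⟩
  intro δ hδ0 hδ ℓ hℓ A hA u Du hu hη
  set c := 3 * C₁ + C₁ * √K + N * (2 * C₂ + 4 * (N * C₂)) + 4 * N with hc
  have hη₁ := etaOne_nonneg hℓ u
  have hη₂ : 0 ≤ etaTwo ℓ Du := etaTwo_nonneg hℓ Du
  have hη₃ : 0 ≤ etaThree ℓ A Du := by
    rw [etaThree_eq_etaTwo]
    exact etaTwo_nonneg hℓ _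
  have h32 : etaThree ℓ A Du ≤ etaTwo ℓ Du := etaThree_le_etaTwo hℓ hA hu.integrable_grad
  obtain ⟨j₀, j₁, t, σ, hfr⟩ := exists_isAdaptedFrame hA
  have hσ0 : 0 ≤ σ := hfr.norm_eq ▸ norm_nonneg _
  have hσ1 : σ ≤ 1 := hfr.sigma_le
  set X := etaTwo ℓ Du ^ (2 / 3 : ℝ) * etaThree ℓ A Du ^ (1 / 3 : ℝ) with hX
  have hX0 : 0 ≤ X := by positivity
  have hX3 : X ^ 3 = etaTwo ℓ Du ^ 2 * etaThree ℓ A Du := rpow_two_thirds_mul_rpow_third_pow hη₂ hη₃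
  have hroot : etaThree ℓ A Du ^ (1 / 2 : ℝ) = √(etaThree ℓ A Du) := (Real.sqrt_eq_rpow _).symm
  rw [hroot]
  set η₁ := etaOne ℓ u
  set η₂ := etaTwo ℓ Du
  set η₃ := etaThree ℓ A Du
  have hle := le_of_cube_eq hη₃ hX0 hX3 h32
  have hsqrt := sqrt_mul_le_of_cube_eq hη₃ hX0 hX3 h32
  -- A one-dimensional approximation suffices as soon as `σ * η₂` is bounded by the error terms.
  have finish_one : σ * η₂ ≤ X + √K * (η₂ * √η₃) → ∃ (a b : EuclideanSpace ℝ (Fin N))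
      (ν : EuclideanSpace ℝ (Fin 2)) (lam : ℝ → ℝ),
      ‖ν‖ = 1 ∧ Monotone lam ∧ IsW11LocWithIntegrableDeriv lam ∧
      eLpNorm (fun x => u x - (lam (inner ℝ x ν) • a + b)) 2
          (volume.restrict (openSquare (ℓ / 4))) ≤
        ENNReal.ofReal ((c * X + c * (η₂ * √η₃) + c * η₁) * ℓ) ∧
      eLpNorm (fun t : ℝ => lam t • a) ⊤ volume ≤ ENNReal.ofReal (c * η₂) := by
    intro hσ
    obtain ⟨a, b, ν, lam, hν, hmono, hlam, h2, hinf⟩ := hone ℓ j₀ j₁ t σ A u Du hℓ hA hfr hu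
    refine ⟨a, b, ν, lam, hν, hmono, hlam, h2.trans (ENNReal.ofReal_le_ofReal ?_),
      hinf.trans (ENNReal.ofReal_le_ofReal ?_)⟩
    · refine mul_le_mul_of_nonneg_right ?_ hℓ.le
      calc C₁ * (σ * η₂ + η₃ + √(η₂ * η₃)) ≤ C₁ * (X + √K * (η₂ * √η₃) + X + X) := by gcongr
        _ = 3 * C₁ * X + C₁ * √K * (η₂ * √η₃) + 0 * η₁ := by ring
        _ ≤ c * X + c * (η₂ * √η₃) + c * η₁ := by gcongr <;> linarith
    · exact mul_le_mul_of_nonneg_right (by linarith) hη₂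
  rcases le_or_gt (σ ^ 3 * η₂) η₃ with hσ | hσ
  · refine finish_one ((mul_le_of_cube_eq hX0 hX3 hσ).trans ?_)
    exact le_add_of_nonneg_right (by positivity)
  have hσp : 0 < σ := by
    refine hσ0.lt_of_ne fun h => ?_
    rw [← h] at hσ
    norm_num at hσ
    linarith
  rcases le_or_gt (N * (C₂ * (η₃ / σ))) (1 / 10) with hsmall | hlarge
  · obtain ⟨T, hT, himg, hval⟩ := exists_dilation_chart hℓ
    obtain ⟨M, b, hMb⟩ := haff ℓ j₀ j₁ t σ A u Du hℓ hA hfr hσp hu T hT hval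
    have hδ' : IsAffineRigidityThreshold N (max δ (1 / 5)) := by
      rcases max_choice δ (1 / 5) with h | h <;> rw [h]
      exacts [hδ, isAffineRigidityThreshold_one_div_five N]
    have hm1 := le_max_left δ (1 / 5)
    have hm2 := le_max_right δ (1 / 5)
    obtain ⟨z, hz⟩ := exists_lattice_approx hℓ hδ' hu.integrable_fun hT himg hval
      (by positivity) (fun i => (hMb i).1) (fun i => (hMb i).2) (by linarith)
    refine ⟨0, z, EuclideanSpace.single 0 1, fun _ => 0, by simp, monotone_const,
      isW11LocWithIntegrableDeriv_zero, ?_, by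
        simp only [smul_zero, eLpNorm_zero', zero_le]⟩
    simp only [smul_zero, zero_add]
    refine hz.trans (ENNReal.ofReal_le_ofReal (mul_le_mul_of_nonneg_right ?_ hℓ.le))
    have d1 := div_le_of_cube_eq hσp hη₃ hX0 hX3 hσ.le hσ1
    have d2 := sqrt_mul_div_le_of_cube_eq hσp hη₂ hX0 hX3 hσ.le
    calc N * (C₂ * (η₃ / σ + √(η₂ * (η₃ / σ))) + 4 * (η₁ + N * (C₂ * (η₃ / σ))))
        ≤ N * (C₂ * (X + X) + 4 * (η₁ + N * (C₂ * X))) := by gcongr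
      _ = N * (2 * C₂ + 4 * (N * C₂)) * X + 0 * (η₂ * √η₃) + 4 * N * η₁ := by ring
      _ ≤ c * X + c * (η₂ * √η₃) + c * η₁ := by gcongr <;> linarith
  · refine finish_one (le_trans ?_ (le_add_of_nonneg_left hX0))
    -- Here `A` is so close to rank one that `σ ≤ √σ ≤ √(K * η₃)`.
    have hσK : σ ≤ K * η₃ := by
      have e : N * (C₂ * (η₃ / σ)) = N * C₂ * η₃ / σ := by ring
      rw [e, lt_div_iff₀ hσp] at hlarge
      rw [hK]
      linarith
    have hsq : σ ≤ √K * √η₃ := by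
      rw [← Real.sqrt_mul hK0]
      refine Real.le_sqrt_of_sq_le (le_trans ?_ hσK)
      nlinarith
    calc σ * η₂ ≤ √K * √η₃ * η₂ := mul_le_mul_of_nonneg_right hsq hη₂
      _ = √K * (η₂ * √η₃) := by ring
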